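/- Let $n\ge 1$, let $K\subset\mathbb{R}^{n+1}$ be a nonempty bounded convex set with smooth boundary that is uniformly convex (the second fundamental form of $\partial K$ with respect to the inner normal is bounded below by a positive constant), let $\Phi(x)=\sup_{y\in K} y\cdot x$ be its support function, and let $A_\Phi(\Sigma)=\int_\Sigma \Phi(\nu)\,d\mathcal{H}^n$ for hypersurfaces $\Sigma\subset\mathbb{R}^{n+1}$ with unit normal $\nu$. Write $B_r$ for the open ball of radius $r$ centered at the origin in $\mathbb{R}^n$, and $Q=B_1\times(0,1)\subset\mathbb{R}^{n+1}$. There exist $C_1>0$ and $\delta_0>0$ depending only on $n$ and $K$ such that for every $\delta\in(0,\delta_0)$ there is $\epsilon_0=\epsilon_0(\delta,n,K)>0$ with the following property. Let $E\subset Q$ be a set whose boundary in $Q$, $S=\partial E\cap Q$, is a smooth embedded hypersurface with $E$ locally on one side of it; assume that $\overline{S}$ does not meet the bottom $B_1\times\{0\}$ of the cylinder, and that $S$, oriented by the outer or by the inner unit normal of $E$, is a critical point of $A_\Phi$ with respect to smooth variations compactly supported in $Q$. If $\epsilon e_{n+1}\in S$ and $\epsilon<\epsilon_0$, then there are an open set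 $G\subset B_{1/3}$ and a smooth function $w:G\to\mathbb{R}$ such that $$|G|\ge |B_{1/3}|-C_1\delta^{1/2},$$ and for every $x\in G$: $(x,w(x))\in S$; every point $(x,t)\in S$ satisfies $t\ge w(x)$; and $$0<w(x)<C_1\delta^{3/2},\qquad |\nabla w(x)|<C_1\delta^{1/2}.$$ -/

import Mathlib

open Set Filter Topology MeasureTheory
open scoped ContDiff

/-- `ℝᵐ` with its Euclidean norm. -/
abbrev Euc (m : ℕ) : Type := EuclideanSpace ℝ (Fin m)

/-! ### Points and cylinders in `ℝⁿ⁺¹ = ℝⁿ × ℝ` -/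

/-- The point `(x, t)` of `ℝⁿ⁺¹`. -/
def vpoint {n : ℕ} (x : Euc n) (t : ℝ) : Euc (n + 1) :=
  WithLp.toLp 2 (Fin.snoc (α := fun _ => ℝ) (fun i => x i) t)

/-- The projection of a point of `ℝⁿ⁺¹` to its first `n` coordinates. -/
def horiz {n : ℕ} (p : Euc (n + 1)) : Euc n :=
  WithLp.toLp 2 (fun i : Fin n => p i.castSucc)

/-- The open cylinder `B_r(x) × (s, t)`. -/
def solidCylinder {n : ℕ} (x : Euc n) (r s t : ℝ) : Set (Euc (n + 1)) :=
  {p | horiz p ∈ Metric.ball x r ∧ p (Fin.last n) ∈ Ioo s t}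

/-! ### Sets with smooth boundary -/

/-- `g` is a smooth defining function of the set `E` in the open set `U`: its differential does not
vanish, it is negative only at points of `E` and positive only off `E`. Thus the boundary of `E` in
`U` is the smooth hypersurface `{g = 0}`, the set `E` lies on one side of it, and nothing is said on
whether boundary points belong to `E`. -/
structure IsDefiningFunctionOn {m : ℕ} (g : Euc m → ℝ) (E U : Set (Euc m)) : Prop where
  isOpen : IsOpen U
  smooth : ContDiffOn ℝ ∞ g U
  regular : ∀ x ∈ U, fderiv ℝ g x ≠ 0
  neg_mem : ∀ x ∈ U, g x < 0 → x ∈ E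
  pos_notMem : ∀ x ∈ U, 0 < g x → x ∉ E

/-- The boundary of `E` in the open set `W` is a smooth embedded hypersurface, with `E` locally on
one side of it. -/
def HasSmoothBoundaryIn {m : ℕ} (E W : Set (Euc m)) : Prop :=
  ∀ p ∈ frontier E ∩ W, ∃ (U : Set (Euc m)) (g : Euc m → ℝ),
    p ∈ U ∧ IsDefiningFunctionOn g E U

/-! ### The Wulff shape and its support function -/

/-- A (nonempty) bounded convex set with smooth boundary which is uniformly convex: the second
fundamental form `D²g(τ, τ) / |∇g|` of the boundary with respect to the inner normal is bounded
below by a positive constant `κ` (here `g` is a defining function, `τ` a tangent vector; the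
quotient does not depend on `g`). -/
structure IsWulffShape {m : ℕ} (K : Set (Euc m)) : Prop where
  nonempty : K.Nonempty
  bounded : Bornology.IsBounded K
  convex : Convex ℝ K
  smooth_uniformly_convex : ∃ κ : ℝ, 0 < κ ∧ ∀ p ∈ frontier K,
    ∃ (U : Set (Euc m)) (g : Euc m → ℝ), p ∈ U ∧ IsDefiningFunctionOn g K U ∧
      ∀ τ : Euc m, fderiv ℝ g p τ = 0 →
        κ * ‖fderiv ℝ g p‖ * ‖τ‖ ^ 2 ≤ fderiv ℝ (fderiv ℝ g) p τ τ

/-- The support function of `K`. -/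
noncomputable def supportFn {m : ℕ} (K : Set (Euc m)) (x : Euc m) : ℝ :=
  sSup ((fun y => inner ℝ y x) '' K)

/-! ### Anisotropic area and its critical points -/

/-- The normal vector `∂₁F × ⋯ × ∂ₙF` of a parametrized hypersurface `F`, i.e. the vector `N` with
`N · v = det (∂₁F, …, ∂ₙF, v)`. Its length is the surface element `√det(∂ᵢF · ∂ⱼF)`; for a graph
`F u = (u, w u)` it is `(-∇w, 1)`. -/
noncomputable def crossNormal {n : ℕ} (F : Euc n → Euc (n + 1)) (u : Euc n) : Euc (n + 1) :=
  WithLp.toLp 2 fun i : Fin (n + 1) =>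
    Matrix.det (Matrix.of (Fin.snoc (α := fun _ => Fin (n + 1) → ℝ)
      (fun (j : Fin n) (k : Fin (n + 1)) => fderiv ℝ F u (EuclideanSpace.single j (1 : ℝ)) k)
      (Pi.single i (1 : ℝ))))

/-- The anisotropic area `∫ Φ(ν) dℋⁿ` of the piece of the hypersurface parametrized by `F` on the
set `A` of parameters, with unit normal `ν = N / |N|` and surface element `dℋⁿ = |N| du`, where `N`
is the normal vector of `F`. -/
noncomputable def anisotropicArea {n : ℕ} (Φ : Euc (n + 1) → ℝ) (F : Euc n → Euc (n + 1))
    (A : Set (Euc n)) : ℝ :=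
  ∫ u in A, Φ (‖crossNormal F u‖⁻¹ • crossNormal F u) * ‖crossNormal F u‖

/-- At the boundary point `p` of `E`, the vector `v` points out of `E` (and `-v` into `E`). -/
def PointsOutOf {m : ℕ} (E : Set (Euc m)) (p v : Euc m) : Prop :=
  ∀ᶠ t : ℝ in 𝓝[>] 0, p + t • v ∉ E ∧ p - t • v ∈ E

/-- `F` is a smooth regular parametrization on the open set `U` of a piece of the boundary of `E` in
`W`, whose normal vector is the outer one of `E`. -/
structure IsOuterParametrization {n : ℕ} (F : Euc n → Euc (n + 1)) (U : Set (Euc n))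
    (E W : Set (Euc (n + 1))) : Prop where
  isOpen : IsOpen U
  smooth : ContDiffOn ℝ ∞ F U
  mem : ∀ u ∈ U, F u ∈ frontier E ∩ W
  regular : ∀ u ∈ U, crossNormal F u ≠ 0
  outer : ∀ u ∈ U, PointsOutOf E (F u) (crossNormal F u)

/-- The boundary of `E` in `W`, with the outer unit normal of `E`, is a critical point of the
functional `∫ Φ(ν) dℋⁿ`: the first variation vanishes for all smooth variations `F + s η` with
`η` compactly supported in the domain of a parametrization `F` of a piece of the boundary. -/
def IsOuterCritical {n : ℕ} (Φ : Euc (n + 1) → ℝ) (E W : Set (Euc (n + 1))) : Prop :=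
  ∀ (U : Set (Euc n)) (F : Euc n → Euc (n + 1)), IsOuterParametrization F U E W →
    ∀ η : Euc n → Euc (n + 1), ContDiff ℝ ∞ η → HasCompactSupport η → tsupport η ⊆ U →
      HasDerivAt (fun s : ℝ => anisotropicArea Φ (fun u => F u + s • η u) (tsupport η)) 0 0

/-- The boundary of `E` in `W` is a critical point of `∫ Φ(ν) dℋⁿ` for one of its two orientations:
`ν` is the outer unit normal of `E`, or `ν` is the inner unit normal of `E` (that is, the outer unit
normal of the complement). -/
def IsCriticalBoundary {n : ℕ} (Φ : Euc (n + 1) → ℝ) (E W : Set (Euc (n + 1))) : Prop :=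
  IsOuterCritical Φ E W ∨ IsOuterCritical Φ Eᶜ W

/-! The proof slides barriers up from the bottom of the cylinder until they touch `S`, and then runs
an Aleksandrov–Bakelman–Pucci (ABP) argument with translates of the Wulff shape in place of
paraboloids.

Near its highest point `∂K` is the graph of a strictly concave function. Normalised to have maximum
`0` at the origin, this function is `k`. Its Legendre transform is essentially `H(p) = Φ(-p, 1)`,
and `V`, which is `∇H` up to a constant, satisfies `V(∇k(y)) = -y` (`IsWulffShape.exists_legendre`).
A critical graph solves `div V(∇w) = 0`, that is `tr(DV D²w) = 0`, whereas the Wulff cap has `DV D²k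
= -I`. For the opposite orientation of `S`, `K` is replaced by `-K`.

If a smooth function with small gradient touches `S` from below, then `S` is not vertical at the
contact point. The lowest sheet is therefore a smooth graph there, with the same gradient and a
larger Hessian, and it solves the equation (`IsCriticalAboveBottom.exists_graph`). This is used with
two families of functions.

Gaussian barriers on annuli: since `S` has a very low point over the origin, the strict maximum
principle forces a point of height less than `δ²` within horizontal distance `δ` of every `z` in
`B_{1/3}` (`IsLegendrePair.exists_low_point`).

Wulff caps `k(· - z) + c`: because of that low point the cap touches `S` at some `x` with `|x - z| <
Lδ`, where the height is `O(δ²)` and the slope `O(δ)`. There `T(x) = x + V(∇w(x))` equals `z`, and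
`DT = DV (D²w - D²k)` is a product of two positive semidefinite maps with trace `n`, so AM-GM gives
`det DT ≤ 1` (`IsLegendrePair.exists_contact`). Thus `T` maps the part of the flat set `G` where its
Jacobian is at most one onto `B_{1/3 - Lδ}`, and the area formula gives `|G| ≥ |B_{1/3 - Lδ}|`
(`volume_le_of_surjOn`). -/

/-! ### Coordinates -/

section Coordinates

variable {n : ℕ}

@[simp] lemma vpoint_last (x : Euc n) (t : ℝ) : vpoint x t (Fin.last n) = t := by
  simp [vpoint]

@[simp] lemma vpoint_castSucc (x : Euc n) (t : ℝ) (i : Fin n) : vpoint x t i.castSucc = x i := by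
  simp [vpoint]

@[simp] lemma horiz_vpoint (x : Euc n) (t : ℝ) : horiz (vpoint x t) = x := by
  ext i; simp [horiz]

@[simp] lemma vpoint_horiz (p : Euc (n + 1)) : vpoint (horiz p) (p (Fin.last n)) = p := by
  ext i
  refine Fin.lastCases ?_ (fun j => ?_) i <;> simp [horiz]

/-- The identification of `ℝⁿ × ℝ` with `ℝⁿ⁺¹`. -/
noncomputable def vpointL (n : ℕ) : (Euc n × ℝ) ≃L[ℝ] Euc (n + 1) :=
  LinearEquiv.toContinuousLinearEquiv
    { toFun := fun p => vpoint p.1 p.2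
      invFun := fun q => (horiz q, q (Fin.last n))
      map_add' := fun p q => by
        ext i
        refine Fin.lastCases ?_ (fun j => ?_) i <;> simp
      map_smul' := fun c p => by
        ext i
        refine Fin.lastCases ?_ (fun j => ?_) i <;> simp
      left_inv := fun p => by simp
      right_inv := fun q => by simp }

@[simp] lemma vpointL_apply (p : Euc n × ℝ) : vpointL n p = vpoint p.1 p.2 := rfl

@[simp] lemma vpointL_symm_apply (q : Euc (n + 1)) :
    (vpointL n).symm q = (horiz q, q (Fin.last n)) := rfl

lemma vpoint_add (x y : Euc n) (s t : ℝ) : vpoint (x + y) (s + t) = vpoint x s + vpoint y t :=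
  (vpointL n).map_add (x, s) (y, t)

lemma vpoint_smul (c : ℝ) (x : Euc n) (s : ℝ) : vpoint (c • x) (c * s) = c • vpoint x s :=
  (vpointL n).map_smul c (x, s)

lemma inner_vpoint (x y : Euc n) (s t : ℝ) :
    inner ℝ (vpoint x s) (vpoint y t) = inner ℝ x y + s * t := by
  simp [PiLp.inner_apply, Fin.sum_univ_castSucc, mul_comm]

lemma continuous_vpoint : Continuous (fun p : Euc n × ℝ => vpoint p.1 p.2) :=
  (vpointL n).continuous

lemma vpoint_mem_solidCylinder {x y : Euc n} {r s t u : ℝ} :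
    vpoint y u ∈ solidCylinder x r s t ↔ y ∈ Metric.ball x r ∧ u ∈ Ioo s t := by
  simp [solidCylinder]

lemma isOpen_solidCylinder (x : Euc n) (r s t : ℝ) : IsOpen (solidCylinder x r s t) := by
  have : solidCylinder x r s t =
      (vpointL n).symm ⁻¹' (Metric.ball x r ×ˢ Ioo s t) := by
    ext p; simp [solidCylinder]
  rw [this]
  exact (Metric.isOpen_ball.prod isOpen_Ioo).preimage (vpointL n).symm.continuous

end Coordinates

/-! ### Level sets as graphs -/

section LocalGraph

variable {E : Type*} [NormedAddCommGroup E] [NormedSpace ℝ E]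

lemma isInvertible_comp_inr {L : E × ℝ →L[ℝ] ℝ} (h : L (0, 1) ≠ 0) :
    (L ∘L ContinuousLinearMap.inr ℝ E ℝ).IsInvertible := by
  refine ⟨ContinuousLinearEquiv.unitsEquivAut ℝ (Units.mk0 _ h), ?_⟩
  ext
  simp

/-- A function increasing in the last variable vanishes, near one of its zeros, on the graph of a
smooth function. -/
lemma exists_local_graph [CompleteSpace E] {g : E × ℝ → ℝ} {U : Set (E × ℝ)} (hU : IsOpen U)
    (hg : ContDiffOn ℝ ∞ g U) {x₀ : E} {t₀ : ℝ} (hp : (x₀, t₀) ∈ U) (h0 : g (x₀, t₀) = 0)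
    (hd : 0 < fderiv ℝ g (x₀, t₀) (0, 1)) :
    ∃ r > 0, ∃ h > 0, ∃ w : E → ℝ,
      Metric.ball x₀ r ×ˢ Ioo (t₀ - h) (t₀ + h) ⊆ U ∧ ContDiffOn ℝ ∞ w (Metric.ball x₀ r) ∧
      w x₀ = t₀ ∧ ∀ x ∈ Metric.ball x₀ r, w x ∈ Ioo (t₀ - h) (t₀ + h) ∧ g (x, w x) = 0 ∧
        ∀ t ∈ Ioo (t₀ - h) (t₀ + h), (t < w x → g (x, t) < 0) ∧ (w x < t → 0 < g (x, t)) := by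
  have hat : ∀ p ∈ U, ContDiffAt ℝ ∞ g p := fun p hp => hg.contDiffAt (hU.mem_nhds hp)
  have hcont : ContinuousOn (fun p => fderiv ℝ g p (0, 1)) U :=
    (hg.continuousOn_fderiv_of_isOpen hU (by simp)).clm_apply continuousOn_const
  have hev : ∀ᶠ p in 𝓝 (x₀, t₀), p ∈ U ∧ 0 < fderiv ℝ g p (0, 1) :=
    (hU.eventually_mem hp).and ((hcont.continuousAt (hU.mem_nhds hp)).eventually (lt_mem_nhds hd))
  rw [Metric.eventually_nhds_iff_ball] at hev
  obtain ⟨h, hh, hball⟩ := hev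
  rw [← ball_prod_same] at hball
  simp only [Real.ball_eq_Ioo] at hball
  have hmono : ∀ x ∈ Metric.ball x₀ h,
      StrictMonoOn (fun t => g (x, t)) (Ioo (t₀ - h) (t₀ + h)) := by
    intro x hx
    have hder : ∀ t ∈ Ioo (t₀ - h) (t₀ + h),
        HasDerivAt (fun t => g (x, t)) (fderiv ℝ g (x, t) (0, 1)) t := by
      intro t ht
      have h1 := ((hat _ (hball (x, t) ⟨hx, ht⟩).1).differentiableAt (by simp)).hasFDerivAt
      exact h1.comp_hasDerivAt t ((hasDerivAt_const t x).prodMk (hasDerivAt_id t))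
    refine strictMonoOn_of_deriv_pos (convex_Ioo _ _)
      (fun t ht => (hder t ht).continuousAt.continuousWithinAt) fun t ht => ?_
    rw [interior_Ioo] at ht
    rw [(hder t ht).deriv]
    exact (hball (x, t) ⟨hx, ht⟩).2
  have hpt : ∀ x ∈ Metric.ball x₀ h, ∀ t ∈ Ioo (t₀ - h) (t₀ + h), g (x, t) = 0 →
      ∃ ψ : E → ℝ, ContDiffAt ℝ ∞ ψ x ∧ ψ x = t ∧
        ∀ᶠ y in 𝓝 x, ψ y ∈ Ioo (t₀ - h) (t₀ + h) ∧ g (y, ψ y) = 0 := by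
    intro x hx t ht hgt
    have cdf := hat _ (hball (x, t) ⟨hx, ht⟩).1
    have hinv := isInvertible_comp_inr (hball (x, t) ⟨hx, ht⟩).2.ne'
    have hs := cdf.contDiffAt_implicitFunction (by simp) hinv
    have hself := cdf.implicitFunction_apply_self (by simp) hinv
    refine ⟨cdf.implicitFunction (by simp) hinv, hs, hself, ?_⟩
    refine (hs.continuousAt.eventually ?_).and ?_
    · simp only at hself
      simp only [hself]
      exact isOpen_Ioo.mem_nhds ht
    · simpa [hgt] using cdf.eventually_apply_implicitFunction (by simp) hinv
  obtain ⟨w, -, hw0, hwev⟩ := hpt x₀ (Metric.mem_ball_self hh) t₀ ⟨by linarith, by linarith⟩ h0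
  obtain ⟨r₁, hr₁, hwr⟩ := Metric.eventually_nhds_iff_ball.1 hwev
  have hsub : Metric.ball x₀ (min r₁ h) ⊆ Metric.ball x₀ h := Metric.ball_subset_ball (min_le_right _ _)
  have hsub1 : Metric.ball x₀ (min r₁ h) ⊆ Metric.ball x₀ r₁ :=
    Metric.ball_subset_ball (min_le_left _ _)
  refine ⟨min r₁ h, lt_min hr₁ hh, h, hh, w, fun p hp => (hball p ⟨hsub hp.1, hp.2⟩).1, ?_, hw0,
    fun x hx => ⟨(hwr x (hsub1 hx)).1, (hwr x (hsub1 hx)).2, fun t ht => ⟨fun hlt => ?_,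
      fun hlt => ?_⟩⟩⟩
  · intro x hx
    -- The implicit function at `x₀` is only known to be smooth at `x₀`. At another point the local
    -- solution `ψ` is smooth, and strict monotonicity in the last variable identifies it with `w`.
    obtain ⟨ψ, hψ, -, hψev⟩ := hpt x (hsub hx) (w x) (hwr x (hsub1 hx)).1 (hwr x (hsub1 hx)).2
    refine (hψ.congr_of_eventuallyEq ?_).contDiffWithinAt
    filter_upwards [hψev, Metric.isOpen_ball.mem_nhds hx] with y hy hyr
    exact (hmono y (hsub hyr)).injOn (hwr y (hsub1 hyr)).1 hy.1
      ((hwr y (hsub1 hyr)).2.trans hy.2.symm)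
  · have := hmono x (hsub hx) ht (hwr x (hsub1 hx)).1 hlt
    simpa [(hwr x (hsub1 hx)).2] using this
  · have := hmono x (hsub hx) (hwr x (hsub1 hx)).1 ht hlt
    simpa [(hwr x (hsub1 hx)).2] using this

end LocalGraph

/-! ### Gradients and second derivatives -/

section Gradient

variable {E : Type*} [NormedAddCommGroup E] [InnerProductSpace ℝ E]

lemma hasDerivAt_inner_comp_line {P : E → E} {a v : E} {τ : ℝ}
    (hP : DifferentiableAt ℝ P (a + τ • v)) :
    HasDerivAt (fun s : ℝ => inner ℝ (P (a + s • v)) v)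
      (inner ℝ (fderiv ℝ P (a + τ • v) v) v) τ := by
  have h1 : HasDerivAt (fun s : ℝ => a + s • v) v τ := by
    simpa using ((hasDerivAt_id τ).smul_const v).const_add a
  simpa using (hP.hasFDerivAt.comp_hasDerivAt τ h1).inner ℝ (hasDerivAt_const τ v)

variable [CompleteSpace E]

lemma ContDiffOn.gradient_of_isOpen {f : E → ℝ} {U : Set E} (hf : ContDiffOn ℝ ∞ f U)
    (hU : IsOpen U) : ContDiffOn ℝ ∞ (gradient f) U :=
  (InnerProductSpace.toDual ℝ E).symm.toContinuousLinearEquiv.contDiff.comp_contDiffOn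
    (hf.fderiv_of_isOpen hU (by simp))

/-- Hessians are used below as the operators `fderiv ℝ (gradient f) x`, so that they can be composed
with `fderiv ℝ V`. This link to the bilinear form provides their symmetry. -/
lemma inner_fderiv_gradient {f : E → ℝ} {U : Set E} (hf : ContDiffOn ℝ ∞ f U)
    (hU : IsOpen U) {x : E} (hx : x ∈ U) (ξ η : E) :
    inner ℝ (fderiv ℝ (gradient f) x ξ) η = fderiv ℝ (fderiv ℝ f) x ξ η := by
  have h1 : HasFDerivAt (fderiv ℝ f) (fderiv ℝ (fderiv ℝ f) x) x :=
    (((hf.fderiv_of_isOpen hU (m := ∞) (by simp)).contDiffAt (hU.mem_nhds hx)).differentiableAt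
      (by simp)).hasFDerivAt
  have h2 : HasFDerivAt (gradient f)
      ((InnerProductSpace.toDual ℝ E).symm.toContinuousLinearEquiv.toContinuousLinearMap ∘L
        (fderiv ℝ (fderiv ℝ f) x)) x :=
    (InnerProductSpace.toDual ℝ E).symm.toContinuousLinearEquiv.hasFDerivAt.comp x h1
  rw [h2.fderiv]
  simp

lemma inner_fderiv_gradient_comm {f : E → ℝ} {U : Set E} (hf : ContDiffOn ℝ ∞ f U)
    (hU : IsOpen U) {x : E} (hx : x ∈ U) (ξ η : E) :
    inner ℝ (fderiv ℝ (gradient f) x ξ) η = inner ℝ (fderiv ℝ (gradient f) x η) ξ := by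
  rw [inner_fderiv_gradient hf hU hx, inner_fderiv_gradient hf hU hx]
  exact ((hf.contDiffAt (hU.mem_nhds hx)).isSymmSndFDerivAt (by
    simp only [minSmoothness_of_isRCLikeNormedField]; exact WithTop.coe_le_coe.2 le_top)).eq ξ η

lemma hasDerivAt_comp_line {f : E → ℝ} {a v : E} {τ : ℝ} (hf : DifferentiableAt ℝ f (a + τ • v)) :
    HasDerivAt (fun s : ℝ => f (a + s • v)) (inner ℝ (gradient f (a + τ • v)) v) τ := by
  have h1 : HasDerivAt (fun s : ℝ => a + s • v) v τ := by
    simpa using ((hasDerivAt_id τ).smul_const v).const_add a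
  rw [inner_gradient_left]
  exact hf.hasFDerivAt.comp_hasDerivAt τ h1

/-- The second order necessary condition at a local minimum. -/
lemma IsLocalMin.inner_fderiv_gradient_nonneg {f : E → ℝ} {U : Set E} (hf : ContDiffOn ℝ ∞ f U)
    (hU : IsOpen U) {x : E} (hx : x ∈ U) (hmin : IsLocalMin f x) (ξ : E) :
    0 ≤ inner ℝ (fderiv ℝ (gradient f) x ξ) ξ := by
  by_contra! hneg
  set φ : ℝ → ℝ := fun s => f (x + s • ξ) with hφ
  have hline : ContinuousAt (fun s : ℝ => x + s • ξ) 0 := by fun_prop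
  have hev : ∀ᶠ s : ℝ in 𝓝 0, x + s • ξ ∈ U :=
    hline.eventually_mem (by simpa using hU.mem_nhds hx)
  have hd : deriv φ =ᶠ[𝓝 0] fun s => inner ℝ (gradient f (x + s • ξ)) ξ := by
    filter_upwards [hev] with s hs
    exact (hasDerivAt_comp_line
      ((hf.contDiffAt (hU.mem_nhds hs)).differentiableAt (by simp))).deriv
  have hdd : deriv (deriv φ) 0 = inner ℝ (fderiv ℝ (gradient f) x ξ) ξ := by
    rw [hd.deriv_eq]
    have := hasDerivAt_inner_comp_line (P := gradient f) (a := x) (v := ξ) (τ := 0)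
      (by simpa using (((hf.gradient_of_isOpen hU).contDiffAt
        (hU.mem_nhds hx)).differentiableAt (by simp)))
    simpa using this.deriv
  have hφmin : IsLocalMin φ 0 := by
    have : Tendsto (fun s : ℝ => x + s • ξ) (𝓝 0) (𝓝 x) := by
      simpa using hline.tendsto
    have h2 := this.eventually hmin
    simpa [IsLocalMin, IsMinFilter, hφ] using h2
  -- A negative second derivative would make `0` a local maximum as well, hence `φ` locally constant
  -- with zero second derivative.
  have hφmax : IsLocalMax φ 0 :=
    isLocalMax_of_deriv_deriv_neg (by rwa [hdd]) hφmin.deriv_eq_zero (by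
      have := (hf.contDiffAt (hU.mem_nhds hx)).continuousAt
      refine ContinuousAt.comp (g := f) ?_ hline
      simpa using this)
  have hconst : φ =ᶠ[𝓝 0] fun _ => φ 0 := by
    filter_upwards [hφmin, hφmax] with s h1 h2 using le_antisymm h2 h1
  have : deriv (deriv φ) 0 = 0 := by
    rw [hconst.deriv.deriv_eq]; simp
  rw [hdd] at this
  exact hneg.ne this

/-- A lower bound of the second derivative gives a quadratic lower bound. -/
lemma quadratic_lower_bound {f : E → ℝ} {U : Set E} (hf : ContDiffOn ℝ ∞ f U)
    (hU : IsOpen U) (hc : Convex ℝ U) {m : ℝ}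
    (hm : ∀ x ∈ U, ∀ ξ, m * ‖ξ‖ ^ 2 ≤ inner ℝ (fderiv ℝ (gradient f) x ξ) ξ)
    {a y : E} (ha : a ∈ U) (hy : y ∈ U) :
    f a + inner ℝ (gradient f a) (y - a) + m / 2 * ‖y - a‖ ^ 2 ≤ f y := by
  set v := y - a with hv
  have hmem : ∀ τ ∈ Icc (0 : ℝ) 1, a + τ • v ∈ U := fun τ hτ => by
    have := hc.add_smul_sub_mem ha hy hτ
    exact this
  have hG : ∀ τ ∈ Icc (0 : ℝ) 1,
      HasDerivAt (fun s : ℝ => inner ℝ (gradient f (a + s • v)) v - m * s * ‖v‖ ^ 2)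
        (inner ℝ (fderiv ℝ (gradient f) (a + τ • v) v) v - m * 1 * ‖v‖ ^ 2) τ := fun τ hτ =>
    (hasDerivAt_inner_comp_line (((hf.gradient_of_isOpen hU).contDiffAt
        (hU.mem_nhds (hmem τ hτ))).differentiableAt (by simp))).sub
      (((hasDerivAt_id τ).const_mul m).mul_const _)
  have hGmono : MonotoneOn (fun s : ℝ => inner ℝ (gradient f (a + s • v)) v - m * s * ‖v‖ ^ 2)
      (Icc 0 1) := by
    refine monotoneOn_of_deriv_nonneg (convex_Icc _ _)
      (fun τ hτ => (hG τ hτ).continuousAt.continuousWithinAt)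
      (fun τ hτ => (hG τ (interior_subset hτ)).differentiableAt.differentiableWithinAt)
      fun τ hτ => ?_
    rw [(hG τ (interior_subset hτ)).deriv]
    have := hm _ (hmem τ (interior_subset hτ)) v
    linarith
  have hF : ∀ τ ∈ Icc (0 : ℝ) 1,
      HasDerivAt (fun s : ℝ => f (a + s • v) - s * inner ℝ (gradient f a) v
          - m / 2 * s ^ 2 * ‖v‖ ^ 2)
        (inner ℝ (gradient f (a + τ • v)) v - 1 * inner ℝ (gradient f a) v
          - m / 2 * (2 * τ) * ‖v‖ ^ 2) τ := fun τ hτ => by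
    refine ((hasDerivAt_comp_line ((hf.contDiffAt
        (hU.mem_nhds (hmem τ hτ))).differentiableAt (by simp))).sub
      ((hasDerivAt_id τ).mul_const _)).sub (((?_ : HasDerivAt (fun s : ℝ => s ^ 2) (2 * τ) τ).const_mul
        (m / 2)).mul_const _)
    simpa using hasDerivAt_pow 2 τ
  have hFmono : MonotoneOn (fun s : ℝ => f (a + s • v) - s * inner ℝ (gradient f a) v
          - m / 2 * s ^ 2 * ‖v‖ ^ 2) (Icc 0 1) := by
    refine monotoneOn_of_deriv_nonneg (convex_Icc _ _)
      (fun τ hτ => (hF τ hτ).continuousAt.continuousWithinAt)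
      (fun τ hτ => (hF τ (interior_subset hτ)).differentiableAt.differentiableWithinAt)
      fun τ hτ => ?_
    rw [(hF τ (interior_subset hτ)).deriv]
    have hτ' := interior_subset hτ
    have := hGmono (left_mem_Icc.2 zero_le_one) hτ' hτ'.1
    simp only [zero_smul, add_zero, mul_zero, zero_mul, sub_zero] at this
    linarith
  have := hFmono (left_mem_Icc.2 zero_le_one) (right_mem_Icc.2 zero_le_one) zero_le_one
  simp only [zero_smul, add_zero, zero_mul, sub_zero, one_smul, one_mul, one_pow, mul_one,
    ne_eq, OfNat.ofNat_ne_zero, not_false_eq_true, zero_pow, mul_zero] at this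
  have hya : a + v = y := by simp [hv]
  rw [hya] at this
  linarith

end Gradient

/-! ### Products of positive semidefinite maps -/

section PosSemidef

/-- AM-GM applied to the eigenvalues. -/
lemma Matrix.PosSemidef.det_le_trace_pow {n : ℕ} (hn : 0 < n) {A : Matrix (Fin n) (Fin n) ℝ}
    (hA : A.PosSemidef) : A.det ≤ (A.trace / n) ^ n := by
  have hn' : (0 : ℝ) < n := by exact_mod_cast hn
  rw [hA.isHermitian.det_eq_prod_eigenvalues, hA.isHermitian.trace_eq_sum_eigenvalues]
  have key := Real.geom_mean_le_arith_mean_weighted Finset.univ (fun _ : Fin n => (1 / n : ℝ))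
    hA.isHermitian.eigenvalues (fun _ _ => by positivity) (by simp [hn'.ne'])
    (fun i _ => hA.eigenvalues_nonneg i)
  have hprod : (∏ i, hA.isHermitian.eigenvalues i)
      = (∏ i, hA.isHermitian.eigenvalues i ^ (1 / n : ℝ)) ^ n := by
    rw [← Finset.prod_pow]
    refine Finset.prod_congr rfl fun i _ => ?_
    rw [← Real.rpow_natCast, ← Real.rpow_mul (hA.eigenvalues_nonneg i)]
    simp [hn'.ne']
  change ∏ i, hA.isHermitian.eigenvalues i ≤ ((∑ i, hA.isHermitian.eigenvalues i) / n) ^ n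
  rw [hprod]
  refine pow_le_pow_left₀ (Finset.prod_nonneg fun i _ =>
    Real.rpow_nonneg (hA.eigenvalues_nonneg i) _) (key.trans_eq ?_) n
  rw [← Finset.mul_sum]
  ring

-- `A * B` need not be symmetric. With `A = Dᴴ D`, however, it has the trace and determinant of the
-- positive semidefinite matrix `D B Dᴴ`.
open scoped Matrix MatrixOrder in
lemma Matrix.PosSemidef.mul_trace_det {n : ℕ} {A B : Matrix (Fin n) (Fin n) ℝ}
    (hA : A.PosSemidef) (hB : B.PosSemidef) :
    ∃ C : Matrix (Fin n) (Fin n) ℝ, C.PosSemidef ∧ C.trace = (A * B).trace ∧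
      C.det = (A * B).det := by
  obtain ⟨D, rfl⟩ := CStarAlgebra.nonneg_iff_eq_star_mul_self.1 hA.nonneg
  rw [Matrix.star_eq_conjTranspose]
  refine ⟨D * B * Dᴴ, hB.mul_mul_conjTranspose_same D, ?_, ?_⟩
  · rw [Matrix.trace_mul_comm, ← mul_assoc]
  · simp only [Matrix.det_mul]; ring

variable {n : ℕ}

lemma posSemidef_toMatrix {M : Euc n →L[ℝ] Euc n}
    (hs : ∀ ξ η, inner ℝ (M ξ) η = inner ℝ (M η) ξ) (hp : ∀ ξ, 0 ≤ inner ℝ (M ξ) ξ) :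
    (LinearMap.toMatrix (EuclideanSpace.basisFun (Fin n) ℝ).toBasis
      (EuclideanSpace.basisFun (Fin n) ℝ).toBasis (M : Euc n →ₗ[ℝ] Euc n)).PosSemidef := by
  have : (M : Euc n →ₗ[ℝ] Euc n).IsPositive := by
    refine ⟨fun ξ η => ?_, fun ξ => ?_⟩
    · simpa [real_inner_comm] using hs ξ η
    · simpa using hp ξ
  exact (LinearMap.posSemidef_toMatrix_iff _).2 this

lemma exists_posSemidef_comp {M P : Euc n →L[ℝ] Euc n}
    (hMs : ∀ ξ η, inner ℝ (M ξ) η = inner ℝ (M η) ξ) (hMp : ∀ ξ, 0 ≤ inner ℝ (M ξ) ξ)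
    (hPs : ∀ ξ η, inner ℝ (P ξ) η = inner ℝ (P η) ξ) (hPp : ∀ ξ, 0 ≤ inner ℝ (P ξ) ξ) :
    ∃ C : Matrix (Fin n) (Fin n) ℝ, C.PosSemidef ∧
      C.trace = LinearMap.trace ℝ _ (M ∘L P : Euc n →L[ℝ] Euc n).toLinearMap ∧
      C.det = (M ∘L P).det := by
  obtain ⟨C, hC, ht, hd⟩ := (posSemidef_toMatrix hMs hMp).mul_trace_det (posSemidef_toMatrix hPs hPp)
  refine ⟨C, hC, ?_, ?_⟩
  · rw [ht, ← LinearMap.toMatrix_comp, LinearMap.trace_eq_matrix_trace ℝ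
      (EuclideanSpace.basisFun (Fin n) ℝ).toBasis]
    rfl
  · rw [hd, ← LinearMap.toMatrix_comp, LinearMap.det_toMatrix]
    rfl

/-- The maximum principle at a contact point: here `M` will be `DV` and `P` the difference of two
Hessians. -/
lemma trace_comp_nonneg {M P : Euc n →L[ℝ] Euc n}
    (hMs : ∀ ξ η, inner ℝ (M ξ) η = inner ℝ (M η) ξ) (hMp : ∀ ξ, 0 ≤ inner ℝ (M ξ) ξ)
    (hPs : ∀ ξ η, inner ℝ (P ξ) η = inner ℝ (P η) ξ) (hPp : ∀ ξ, 0 ≤ inner ℝ (P ξ) ξ) :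
    0 ≤ LinearMap.trace ℝ _ (M ∘L P : Euc n →L[ℝ] Euc n).toLinearMap := by
  obtain ⟨C, hC, ht, -⟩ := exists_posSemidef_comp hMs hMp hPs hPp
  exact ht ▸ hC.trace_nonneg

/-- The Jacobian bound of the ABP argument: the equation fixes the trace of `DT` at `n`, and AM-GM
does the rest. -/
lemma abs_det_comp_le_one (hn : 0 < n) {M P : Euc n →L[ℝ] Euc n}
    (hMs : ∀ ξ η, inner ℝ (M ξ) η = inner ℝ (M η) ξ) (hMp : ∀ ξ, 0 ≤ inner ℝ (M ξ) ξ)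
    (hPs : ∀ ξ η, inner ℝ (P ξ) η = inner ℝ (P η) ξ) (hPp : ∀ ξ, 0 ≤ inner ℝ (P ξ) ξ)
    (htr : LinearMap.trace ℝ _ (M ∘L P : Euc n →L[ℝ] Euc n).toLinearMap = n) :
    |(M ∘L P).det| ≤ 1 := by
  obtain ⟨C, hC, ht, hd⟩ := exists_posSemidef_comp hMs hMp hPs hPp
  rw [← hd, abs_of_nonneg hC.det_nonneg]
  refine (hC.det_le_trace_pow hn).trans_eq ?_
  rw [ht, htr, div_self (by exact_mod_cast hn.ne'), one_pow]

end PosSemidef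

/-! ### Defining functions -/

section DefiningFunction

lemma IsDefiningFunctionOn.eq_zero {m : ℕ} {g : Euc m → ℝ} {E U : Set (Euc m)}
    (h : IsDefiningFunctionOn g E U) {p : Euc m} (hp : p ∈ U) (hf : p ∈ frontier E) : g p = 0 := by
  have hc : ContinuousAt g p := (h.smooth.contDiffAt (h.isOpen.mem_nhds hp)).continuousAt
  rcases lt_trichotomy (g p) 0 with hlt | heq | hgt
  · refine absurd (mem_interior_iff_mem_nhds.2 ?_) hf.2
    filter_upwards [h.isOpen.mem_nhds hp, hc.eventually (gt_mem_nhds hlt)] with q hq hq'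
      using h.neg_mem q hq hq'
  · exact heq
  · refine absurd hf.1 (mem_compl_iff _ _ |>.1 ?_)
    rw [← interior_compl, mem_interior_iff_mem_nhds]
    filter_upwards [h.isOpen.mem_nhds hp, hc.eventually (lt_mem_nhds hgt)] with q hq hq'
      using h.pos_notMem q hq hq'

lemma IsDefiningFunctionOn.mono {m : ℕ} {g : Euc m → ℝ} {E U V : Set (Euc m)}
    (h : IsDefiningFunctionOn g E U) (hV : IsOpen V) (hVU : V ⊆ U) :
    IsDefiningFunctionOn g E V :=
  ⟨hV, h.smooth.mono hVU, fun x hx => h.regular x (hVU hx), fun x hx => h.neg_mem x (hVU hx),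
    fun x hx => h.pos_notMem x (hVU hx)⟩

lemma fderiv_neg_fun {m : ℕ} (g : Euc m → ℝ) :
    fderiv ℝ (fun x => -g x) = fun x => -fderiv ℝ g x := by
  funext x; exact fderiv_fun_neg

lemma IsDefiningFunctionOn.compl {m : ℕ} {g : Euc m → ℝ} {E U : Set (Euc m)}
    (h : IsDefiningFunctionOn g E U) : IsDefiningFunctionOn (fun x => -g x) Eᶜ U :=
  ⟨h.isOpen, h.smooth.neg, fun x hx => by simpa [fderiv_neg_fun] using h.regular x hx,
    fun x hx hg => h.pos_notMem x hx (by linarith),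
    fun x hx hg hE => hE (h.neg_mem x hx (by linarith))⟩

lemma HasSmoothBoundaryIn.compl {m : ℕ} {E W : Set (Euc m)} (h : HasSmoothBoundaryIn E W) :
    HasSmoothBoundaryIn Eᶜ W := fun p hp => by
  rw [frontier_compl] at hp
  obtain ⟨U, g, hpU, hg⟩ := h p hp
  exact ⟨U, _, hpU, hg.compl⟩

variable {n : ℕ}

lemma IsDefiningFunctionOn.exists_graph {g : Euc (n + 1) → ℝ} {E U : Set (Euc (n + 1))}
    (hg : IsDefiningFunctionOn g E U) {x₀ : Euc n} {t₀ : ℝ} (hp : vpoint x₀ t₀ ∈ U)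
    (h0 : g (vpoint x₀ t₀) = 0) (hd : 0 < fderiv ℝ g (vpoint x₀ t₀) (vpoint 0 1)) :
    ∃ r > 0, ∃ h > 0, ∃ w : Euc n → ℝ,
      (∀ x ∈ Metric.ball x₀ r, ∀ t ∈ Ioo (t₀ - h) (t₀ + h), vpoint x t ∈ U) ∧
      ContDiffOn ℝ ∞ w (Metric.ball x₀ r) ∧ w x₀ = t₀ ∧
      ∀ x ∈ Metric.ball x₀ r, w x ∈ Ioo (t₀ - h) (t₀ + h) ∧ g (vpoint x (w x)) = 0 ∧
        ∀ t ∈ Ioo (t₀ - h) (t₀ + h), (t < w x → g (vpoint x t) < 0) ∧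
          (w x < t → 0 < g (vpoint x t)) := by
  have hder : HasFDerivAt (fun p : Euc n × ℝ => g (vpoint p.1 p.2))
      (fderiv ℝ g (vpoint x₀ t₀) ∘L (vpointL n).toContinuousLinearMap) (x₀, t₀) := by
    have h1 : HasFDerivAt g (fderiv ℝ g (vpoint x₀ t₀)) (vpointL n (x₀, t₀)) :=
      ((hg.smooth.contDiffAt (hg.isOpen.mem_nhds hp)).differentiableAt (by simp)).hasFDerivAt
    exact h1.comp (x₀, t₀) (vpointL n).hasFDerivAt
  obtain ⟨r, hr, h, hh, w, hU, hw, hw0, hgr⟩ := exists_local_graph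
    (g := fun p : Euc n × ℝ => g (vpoint p.1 p.2)) (U := vpointL n ⁻¹' U)
    (hg.isOpen.preimage (vpointL n).continuous)
    (hg.smooth.comp (vpointL n).contDiff.contDiffOn fun p hp => hp) (x₀ := x₀) (t₀ := t₀)
    hp h0 (by rw [hder.fderiv]; simpa using hd)
  have hU' : ∀ x ∈ Metric.ball x₀ r, ∀ t ∈ Ioo (t₀ - h) (t₀ + h), vpoint x t ∈ U :=
    fun x hx t ht => hU (mk_mem_prod hx ht)
  exact ⟨r, hr, h, hh, w, hU', hw, hw0, hgr⟩

lemma nonpos_of_hasDerivAt_of_nonpos {f : ℝ → ℝ} {f' : ℝ} (hf : HasDerivAt f f' 0) (h0 : f 0 = 0)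
    (hev : ∀ᶠ τ in 𝓝[>] (0 : ℝ), f τ ≤ 0) : f' ≤ 0 := by
  have h1 := (hasDerivAt_iff_tendsto_slope.1 hf).mono_left
    (nhdsWithin_mono (0 : ℝ) (fun x hx => (ne_of_gt hx : x ≠ 0)) : 𝓝[>] (0 : ℝ) ≤ 𝓝[≠] 0)
  refine le_of_tendsto h1 ?_
  filter_upwards [hev, self_mem_nhdsWithin] with τ hτ hτ0
  rw [slope_def_field, h0, sub_zero, sub_zero]
  exact div_nonpos_of_nonpos_of_nonneg hτ (le_of_lt hτ0)

/-- For the differential `L` of a defining function, the hypothesis records that directions below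
the graph of `a` do not leave the set to first order. Scaling `ξ` by large factors of either sign
shows that `L` vanishes on that graph. As `L ≠ 0`, it is then positive on the upward vertical, so
the hypersurface is not vertical. -/
lemma pos_and_eq_zero_of_forall_nonpos {L : Euc (n + 1) →L[ℝ] ℝ} (hL : L ≠ 0) {a : Euc n →L[ℝ] ℝ}
    (h : ∀ ξ, L (vpoint ξ (a ξ - 1)) ≤ 0) :
    0 < L (vpoint 0 1) ∧ ∀ ξ, L (vpoint ξ (a ξ)) = 0 := by
  have hsplit : ∀ ξ s, L (vpoint ξ (a ξ + s)) = L (vpoint ξ (a ξ)) + s * L (vpoint 0 1) := by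
    intro ξ s
    have := vpoint_add ξ 0 (a ξ) s
    rw [add_zero] at this
    rw [this, map_add]
    have h2 := vpoint_smul s (0 : Euc n) 1
    rw [smul_zero, mul_one] at h2
    rw [h2, map_smul, smul_eq_mul]
  have hscale : ∀ (c : ℝ) ξ, L (vpoint (c • ξ) (a (c • ξ))) = c * L (vpoint ξ (a ξ)) := by
    intro c ξ
    rw [map_smul, smul_eq_mul, vpoint_smul, map_smul, smul_eq_mul]
  have hle : ∀ ξ, L (vpoint ξ (a ξ)) ≤ L (vpoint 0 1) := by
    intro ξ
    have := h ξ
    rw [sub_eq_add_neg, hsplit] at this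
    linarith
  have hzero : ∀ ξ, L (vpoint ξ (a ξ)) = 0 := by
    intro ξ
    by_contra hne
    have := hle (((L (vpoint 0 1) + 1) / L (vpoint ξ (a ξ))) • ξ)
    rw [hscale, div_mul_cancel₀ _ hne] at this
    linarith
  refine ⟨lt_of_le_of_ne ((hzero 0).symm.le.trans (hle 0)) fun h0 => hL ?_, hzero⟩
  ext v
  have := hsplit (horiz v) (v (Fin.last n) - a (horiz v))
  rw [hzero, ← h0, add_sub_cancel, vpoint_horiz] at this
  simpa using this

end DefiningFunction

/-! ### The Wulff shape near its highest point -/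

section Wulff

variable {n : ℕ} {K : Set (Euc (n + 1))}

lemma norm_vpoint_zero_one : ‖vpoint (0 : Euc n) 1‖ = 1 := by
  have := inner_vpoint (0 : Euc n) 0 1 1
  rw [real_inner_self_eq_norm_sq, inner_zero_left, zero_add, mul_one] at this
  exact (pow_eq_one_iff_of_nonneg (norm_nonneg _) two_ne_zero).1 this

lemma norm_vpoint_zero_right (x : Euc n) : ‖vpoint x 0‖ = ‖x‖ := by
  have := inner_vpoint x x 0 0
  rw [real_inner_self_eq_norm_sq, real_inner_self_eq_norm_sq, mul_zero, add_zero] at this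
  exact (pow_left_inj₀ (norm_nonneg _) (norm_nonneg _) two_ne_zero).1 this

/-- Near its highest point, a Wulff shape is the subgraph of a strictly concave function. -/
lemma IsWulffShape.exists_top (hK : IsWulffShape K) :
    ∃ (Y₀ : Euc n) (r h κ : ℝ) (k : Euc n → ℝ), 0 < r ∧ 0 < κ ∧
      ContDiffOn ℝ ∞ k (Metric.ball Y₀ r) ∧
      (∀ x ∈ Metric.ball Y₀ r, k x ∈ Ioo (k Y₀ - h) (k Y₀ + h) ∧
        ∀ t ∈ Ioo (k Y₀ - h) (k Y₀ + h), (t < k x → vpoint x t ∈ K) ∧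
          (k x < t → vpoint x t ∉ closure K)) ∧
      gradient k Y₀ = 0 ∧
      ∀ ξ, inner ℝ (fderiv ℝ (gradient k) Y₀ ξ) ξ ≤ -κ * ‖ξ‖ ^ 2 := by
  have hcpt : IsCompact (closure K) := hK.bounded.isCompact_closure
  obtain ⟨y, hyK, hymax⟩ := hcpt.exists_isMaxOn hK.nonempty.closure
    (f := fun z : Euc (n + 1) => z (Fin.last n)) (by fun_prop)
  obtain ⟨Y₀, T₀, rfl⟩ : ∃ Y₀ T₀, y = vpoint Y₀ T₀ := ⟨_, _, (vpoint_horiz y).symm⟩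
  have habove : ∀ x t, T₀ < t → vpoint x t ∉ closure K := by
    intro x t ht hmem
    have h1 := hymax hmem
    simp only [mem_ofPred_eq, vpoint_last] at h1
    linarith
  have hfr : vpoint Y₀ T₀ ∈ frontier K := by
    refine ⟨hyK, fun hint => ?_⟩
    have hc : ContinuousAt (fun s : ℝ => vpoint Y₀ (T₀ + s)) 0 :=
      (continuous_vpoint.comp (by fun_prop : Continuous fun s : ℝ => (Y₀, T₀ + s))).continuousAt
    have hev : ∀ᶠ s : ℝ in 𝓝 0, vpoint Y₀ (T₀ + s) ∈ K :=
      hc.eventually_mem (by simpa using mem_interior_iff_mem_nhds.1 hint)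
    obtain ⟨s, hs, hs0⟩ := ((hev.filter_mono nhdsWithin_le_nhds).and
      (self_mem_nhdsWithin : Ioi (0 : ℝ) ∈ 𝓝[>] 0)).exists
    exact habove Y₀ (T₀ + s) (by simpa using hs0) (subset_closure hs)
  obtain ⟨κ, hκ, hall⟩ := hK.smooth_uniformly_convex
  obtain ⟨U, g, hpU, hg, hcurv⟩ := hall _ hfr
  have hg0 : g (vpoint Y₀ T₀) = 0 := hg.eq_zero hpU hfr
  have hgd : ∀ p ∈ U, HasFDerivAt g (fderiv ℝ g p) p := fun p hp =>
    ((hg.smooth.contDiffAt (hg.isOpen.mem_nhds hp)).differentiableAt (by simp)).hasFDerivAt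
  -- From the highest point, moving by small multiples of `(-ξ, 1)` leaves `K`, so `g ≥ 0` there.
  -- With `a = 0` this makes the tangent plane horizontal.
  obtain ⟨hpos, hhor⟩ := pos_and_eq_zero_of_forall_nonpos (hg.regular _ hpU)
    (a := (0 : Euc n →L[ℝ] ℝ)) (fun ξ => by
      have hline : HasDerivAt (fun τ : ℝ => vpoint Y₀ T₀ + τ • -vpoint ξ (0 - 1))
          (-vpoint ξ (0 - 1)) 0 := by
        simpa using ((hasDerivAt_id (0 : ℝ)).smul_const (-vpoint ξ (0 - 1))).const_add (vpoint Y₀ T₀)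
      have hcomp : HasDerivAt (fun τ : ℝ => -g (vpoint Y₀ T₀ + τ • -vpoint ξ (0 - 1)))
          (fderiv ℝ g (vpoint Y₀ T₀) (vpoint ξ (0 - 1))) 0 := by
        have h1 := hgd _ hpU
        have := ((by simpa using h1 : HasFDerivAt g (fderiv ℝ g (vpoint Y₀ T₀))
          (vpoint Y₀ T₀ + (0 : ℝ) • -vpoint ξ (0 - 1))).comp_hasDerivAt (0 : ℝ) hline).neg
        rw [map_neg, neg_neg] at this
        exact this
      refine nonpos_of_hasDerivAt_of_nonpos hcomp (by simpa using hg0) ?_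
      have hmem : ∀ᶠ τ : ℝ in 𝓝[>] 0, vpoint Y₀ T₀ + τ • -vpoint ξ (0 - 1) ∈ U :=
        (hline.continuousAt.eventually_mem
          (by simpa using hg.isOpen.mem_nhds hpU)).filter_mono nhdsWithin_le_nhds
      filter_upwards [hmem, self_mem_nhdsWithin] with τ hτ hτ0
      have heq : vpoint Y₀ T₀ + τ • -vpoint ξ (0 - 1) = vpoint (Y₀ + (-τ) • ξ) (T₀ + τ) := by
        rw [smul_neg, ← neg_smul, ← vpoint_smul, ← vpoint_add]
        congr 1; ring
      by_contra! hneg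
      refine habove (Y₀ + (-τ) • ξ) (T₀ + τ) (by simpa using hτ0) ?_
      rw [← heq]
      exact subset_closure (hg.neg_mem _ hτ (by linarith)))
  obtain ⟨r, hr, h, -, k, hbox, hk, hk0, hgr⟩ := hg.exists_graph hpU hg0 hpos
  have hY₀ : Y₀ ∈ Metric.ball Y₀ r := Metric.mem_ball_self hr
  have hkd : ∀ x ∈ Metric.ball Y₀ r, DifferentiableAt ℝ k x := fun x hx =>
    (hk.contDiffAt (Metric.isOpen_ball.mem_nhds hx)).differentiableAt (by simp)
  have hmax : IsLocalMax k Y₀ := by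
    filter_upwards [Metric.isOpen_ball.mem_nhds hY₀] with x hx
    by_contra! hlt
    rw [hk0] at hlt
    have hkx := (hgr x hx).1
    refine habove x ((k x + T₀) / 2) (by linarith) (subset_closure ?_)
    have hlo := ((hgr Y₀ hY₀).1).1
    rw [hk0] at hlo
    have ht : (k x + T₀) / 2 ∈ Ioo (T₀ - h) (T₀ + h) := ⟨by linarith, by linarith [hkx.2]⟩
    exact hg.neg_mem _ (hbox x hx _ ht) (((hgr x hx).2.2 _ ht).1 (by linarith))
  have hgrad : gradient k Y₀ = 0 := by
    rw [gradient, hmax.fderiv_eq_zero, map_zero]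
  refine ⟨Y₀, r, h, κ, k, hr, hκ, hk, ?_, hgrad, ?_⟩
  · intro x hx
    rw [hk0]
    refine ⟨(hgr x hx).1, fun t ht => ⟨fun hlt => hg.neg_mem _ (hbox x hx t ht)
      (((hgr x hx).2.2 t ht).1 hlt), fun hlt hmem => ?_⟩⟩
    have hgpos := ((hgr x hx).2.2 t ht).2 hlt
    have hU := hbox x hx t ht
    have hc : ContinuousAt g (vpoint x t) := (hgd _ hU).continuousAt
    obtain ⟨z, ⟨hzU, hzg⟩, hzK⟩ := mem_closure_iff_nhds.1 hmem _
      (inter_mem (hg.isOpen.mem_nhds hU) (hc.eventually (lt_mem_nhds hgpos)))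
    exact hg.pos_notMem z hzU hzg hzK
  · intro ξ
    have hkc : HasDerivAt (fun τ : ℝ => inner ℝ (gradient k (Y₀ + τ • ξ)) ξ)
        (inner ℝ (fderiv ℝ (gradient k) Y₀ ξ) ξ) 0 := by
      have := hasDerivAt_inner_comp_line (P := gradient k) (a := Y₀) (v := ξ) (τ := 0)
        (by simpa using ((hk.gradient_of_isOpen Metric.isOpen_ball).contDiffAt
          (Metric.isOpen_ball.mem_nhds hY₀)).differentiableAt (by simp))
      simpa using this
    set D := inner ℝ (fderiv ℝ (gradient k) Y₀ ξ) ξ with hD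
    have hev : ∀ᶠ τ : ℝ in 𝓝 0, Y₀ + τ • ξ ∈ Metric.ball Y₀ r := by
      have : ContinuousAt (fun τ : ℝ => Y₀ + τ • ξ) 0 := by fun_prop
      exact this.eventually_mem (by simpa using Metric.isOpen_ball.mem_nhds hY₀)
    have hγ : ∀ τ : ℝ, Y₀ + τ • ξ ∈ Metric.ball Y₀ r →
        HasDerivAt (fun τ : ℝ => vpoint (Y₀ + τ • ξ) (k (Y₀ + τ • ξ)))
          (vpoint ξ (inner ℝ (gradient k (Y₀ + τ • ξ)) ξ)) τ := by
      intro τ hτ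
      have h1 : HasDerivAt (fun s : ℝ => Y₀ + s • ξ) ξ τ := by
        simpa using ((hasDerivAt_id τ).smul_const ξ).const_add Y₀
      exact (vpointL n).hasFDerivAt.comp_hasDerivAt τ (h1.prodMk (hasDerivAt_comp_line (hkd _ hτ)))
    have hγ0 := hγ 0 (by simpa using hr)
    -- Differentiating `g(x, k(x)) = 0` twice along a line gives `D²g(ξ, ξ) + D ∂ₜg = 0` at the top,
    -- where `∇k = 0`. Since `∂ₜg ≤ |∇g|`, the curvature bound passes to `k` with the same `κ`.
    have hzero : (fun τ : ℝ => fderiv ℝ g (vpoint (Y₀ + τ • ξ) (k (Y₀ + τ • ξ)))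
        (vpoint ξ (inner ℝ (gradient k (Y₀ + τ • ξ)) ξ))) =ᶠ[𝓝 0] fun _ => 0 := by
      filter_upwards [hev.eventually_nhds] with τ hτ
      have hmem := hτ.self_of_nhds
      have hU := hbox _ hmem _ (hgr _ hmem).1
      have h1 := (hgd _ hU).comp_hasDerivAt τ (hγ τ hmem)
      refine h1.unique ((hasDerivAt_const τ (0 : ℝ)).congr_of_eventuallyEq ?_)
      filter_upwards [hτ] with s hs using (hgr _ hs).2.1
    have hgg : HasFDerivAt (fderiv ℝ g) (fderiv ℝ (fderiv ℝ g) (vpoint Y₀ T₀)) (vpoint Y₀ T₀) :=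
      (((hg.smooth.fderiv_of_isOpen hg.isOpen (m := ∞) (by simp)).contDiffAt
        (hg.isOpen.mem_nhds hpU)).differentiableAt (by simp)).hasFDerivAt
    have hA : HasDerivAt (fun τ : ℝ => fderiv ℝ g (vpoint (Y₀ + τ • ξ) (k (Y₀ + τ • ξ))))
        (fderiv ℝ (fderiv ℝ g) (vpoint Y₀ T₀) (vpoint ξ 0)) 0 := by
      have := HasFDerivAt.comp_hasDerivAt (0 : ℝ) (l := fderiv ℝ g)
        (f := fun τ : ℝ => vpoint (Y₀ + τ • ξ) (k (Y₀ + τ • ξ)))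
        (l' := fderiv ℝ (fderiv ℝ g) (vpoint Y₀ T₀)) (by simpa [hk0] using hgg) hγ0
      simp only [zero_smul, add_zero, hgrad, inner_zero_left] at this
      exact this
    have hB : HasDerivAt (fun τ : ℝ => vpoint ξ (inner ℝ (gradient k (Y₀ + τ • ξ)) ξ))
        (vpoint 0 D) 0 :=
      (vpointL n).hasFDerivAt.comp_hasDerivAt (0 : ℝ) ((hasDerivAt_const (0 : ℝ) ξ).prodMk hkc)
    have hAB := (hA.clm_apply hB).unique ((hasDerivAt_const (0 : ℝ) (0 : ℝ)).congr_of_eventuallyEq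
      hzero)
    simp only [zero_smul, add_zero, hgrad, hk0, inner_zero_left] at hAB
    have hDsplit : fderiv ℝ g (vpoint Y₀ T₀) (vpoint 0 D)
        = D * fderiv ℝ g (vpoint Y₀ T₀) (vpoint 0 1) := by
      have h2 := vpoint_smul D (0 : Euc n) 1
      rw [smul_zero, mul_one] at h2
      rw [h2, map_smul, smul_eq_mul]
    rw [hDsplit] at hAB
    have hc := hcurv (vpoint ξ 0) (by simpa using hhor ξ)
    rw [norm_vpoint_zero_right] at hc
    have hle : fderiv ℝ g (vpoint Y₀ T₀) (vpoint 0 1) ≤ ‖fderiv ℝ g (vpoint Y₀ T₀)‖ := by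
      have := (fderiv ℝ g (vpoint Y₀ T₀)).le_opNorm (vpoint 0 1)
      rw [norm_vpoint_zero_one, mul_one] at this
      exact (le_abs_self _).trans this
    have h3 : κ * fderiv ℝ g (vpoint Y₀ T₀) (vpoint 0 1) * ‖ξ‖ ^ 2
        ≤ κ * ‖fderiv ℝ g (vpoint Y₀ T₀)‖ * ‖ξ‖ ^ 2 := by gcongr
    refine le_of_mul_le_mul_right ?_ hpos
    linarith

end Wulff

/-! ### The Legendre transform -/

section Legendre

variable {n : ℕ}

lemma exists_equiv_of_neg {A : Euc n →L[ℝ] Euc n} {m : ℝ} (hm : 0 < m)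
    (hA : ∀ ξ, inner ℝ (A ξ) ξ ≤ -m * ‖ξ‖ ^ 2) :
    ∃ e : Euc n ≃L[ℝ] Euc n, (e : Euc n →L[ℝ] Euc n) = A := by
  have hinj : Function.Injective (A : Euc n →ₗ[ℝ] Euc n) := by
    rw [injective_iff_map_eq_zero]
    intro ξ hξ
    have h1 := hA ξ
    have h2 : A ξ = 0 := hξ
    rw [h2, inner_zero_left] at h1
    have h3 : ‖ξ‖ ^ 2 ≤ 0 := by nlinarith
    simpa using le_antisymm h3 (sq_nonneg _)
  exact ⟨(LinearEquiv.ofInjectiveEndo _ hinj).toContinuousLinearEquiv, by ext; rfl⟩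

/-- The gradient of a strictly concave function is locally invertible. -/
lemma exists_inverse_gradient {k : Euc n → ℝ} {r κ : ℝ} (hr : 0 < r) (hκ : 0 < κ)
    (hk : ContDiffOn ℝ ∞ k (Metric.ball 0 r)) (hgrad : gradient k 0 = 0)
    (hneg : ∀ ξ, inner ℝ (fderiv ℝ (gradient k) 0 ξ) ξ ≤ -κ * ‖ξ‖ ^ 2) :
    ∃ (Y : Euc n → Euc n) (r₂ r₃ ρ m C : ℝ), 0 < r₂ ∧ r₂ ≤ r ∧ 0 < r₃ ∧ r₃ ≤ r₂ ∧ 0 < ρ ∧ 0 < m ∧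
      0 < C ∧
      (∀ y ∈ Metric.ball 0 r₂, ∀ ξ, inner ℝ (fderiv ℝ (gradient k) y ξ) ξ ≤ -m * ‖ξ‖ ^ 2) ∧
      (∀ y ∈ Metric.ball 0 r₂, ‖fderiv ℝ (gradient k) y‖ ≤ C) ∧
      ContDiffOn ℝ ∞ Y (Metric.ball 0 ρ) ∧
      (∀ p ∈ Metric.ball 0 ρ, Y p ∈ Metric.ball 0 r₂ ∧ gradient k (Y p) = p ∧
        ∀ ξ, fderiv ℝ Y p (fderiv ℝ (gradient k) (Y p) ξ) = ξ ∧
          fderiv ℝ (gradient k) (Y p) (fderiv ℝ Y p ξ) = ξ) ∧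
      ∀ y ∈ Metric.ball 0 r₃, gradient k y ∈ Metric.ball 0 ρ ∧ Y (gradient k y) = y := by
  have h0r : (0 : Euc n) ∈ Metric.ball 0 r := Metric.mem_ball_self hr
  have hP := hk.gradient_of_isOpen Metric.isOpen_ball
  have hPat : ∀ y ∈ Metric.ball (0 : Euc n) r, ContDiffAt ℝ ∞ (gradient k) y := fun y hy =>
    hP.contDiffAt (Metric.isOpen_ball.mem_nhds hy)
  have hPd : ∀ y ∈ Metric.ball (0 : Euc n) r,
      HasFDerivAt (gradient k) (fderiv ℝ (gradient k) y) y := fun y hy =>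
    ((hPat y hy).differentiableAt (by simp)).hasFDerivAt
  have hAc : ContinuousAt (fderiv ℝ (gradient k)) 0 :=
    (hP.continuousOn_fderiv_of_isOpen Metric.isOpen_ball (by simp)).continuousAt
      (Metric.isOpen_ball.mem_nhds h0r)
  have hev : ∀ᶠ y in 𝓝 (0 : Euc n), y ∈ Metric.ball (0 : Euc n) r ∧
      fderiv ℝ (gradient k) y ∈ Metric.ball (fderiv ℝ (gradient k) 0) (κ / 2) :=
    (Metric.isOpen_ball.eventually_mem h0r).and
      (hAc.eventually_mem (Metric.ball_mem_nhds _ (half_pos hκ)))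
  obtain ⟨r₀, hr₀, hball⟩ := Metric.eventually_nhds_iff_ball.1 hev
  have hneg' : ∀ y ∈ Metric.ball (0 : Euc n) r₀, ∀ ξ,
      inner ℝ (fderiv ℝ (gradient k) y ξ) ξ ≤ -(κ / 2) * ‖ξ‖ ^ 2 := by
    intro y hy ξ
    have h1 := (hball y hy).2
    rw [mem_ball_iff_norm] at h1
    have h2 : inner ℝ ((fderiv ℝ (gradient k) y - fderiv ℝ (gradient k) 0) ξ) ξ
        ≤ κ / 2 * ‖ξ‖ * ‖ξ‖ := by
      refine (real_inner_le_norm _ _).trans ?_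
      gcongr
      exact (ContinuousLinearMap.le_opNorm _ _).trans (by gcongr)
    rw [sub_apply, inner_sub_left] at h2
    nlinarith [hneg ξ]
  have hnorm : ∀ y ∈ Metric.ball (0 : Euc n) r₀,
      ‖fderiv ℝ (gradient k) y‖ ≤ ‖fderiv ℝ (gradient k) 0‖ + κ / 2 := by
    intro y hy
    have h1 := (hball y hy).2
    rw [mem_ball_iff_norm] at h1
    have := norm_le_norm_add_norm_sub' (fderiv ℝ (gradient k) y) (fderiv ℝ (gradient k) 0)
    linarith
  obtain ⟨e₀, he₀⟩ := exists_equiv_of_neg hκ hneg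
  have hd0 : HasFDerivAt (gradient k) (e₀ : Euc n →L[ℝ] Euc n) 0 := by
    rw [he₀]; exact hPd 0 h0r
  set oh := (hPat 0 h0r).toOpenPartialHomeomorph (gradient k) hd0 (by simp) with hoh
  have hcoe : (oh : Euc n → Euc n) = gradient k := rfl
  have hsrc : (0 : Euc n) ∈ oh.source :=
    (hPat 0 h0r).mem_toOpenPartialHomeomorph_source hd0 (by simp)
  have htgt : (0 : Euc n) ∈ oh.target := by
    have := oh.map_source hsrc
    rwa [hcoe, hgrad] at this
  have hsymm0 : oh.symm 0 = 0 := by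
    have := oh.left_inv hsrc
    rwa [hcoe, hgrad] at this
  have hevρ : ∀ᶠ p in 𝓝 (0 : Euc n), p ∈ oh.target ∧ oh.symm p ∈ Metric.ball (0 : Euc n) r₀ :=
    (oh.open_target.eventually_mem htgt).and ((oh.symm.continuousAt htgt).eventually_mem
      (by rw [hsymm0]; exact Metric.ball_mem_nhds _ hr₀))
  obtain ⟨ρ, hρ, hρball⟩ := Metric.eventually_nhds_iff_ball.1 hevρ
  have hev3 : ∀ᶠ y in 𝓝 (0 : Euc n), y ∈ oh.source ∧ gradient k y ∈ Metric.ball (0 : Euc n) ρ :=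
    (oh.open_source.eventually_mem hsrc).and ((hPat 0 h0r).continuousAt.eventually_mem
      (by rw [hgrad]; exact Metric.ball_mem_nhds _ hρ))
  obtain ⟨r₃, hr₃, hr₃ball⟩ := Metric.eventually_nhds_iff_ball.1 hev3
  have hr₀r : min r₀ r ≤ r₀ := min_le_left _ _
  have hderiv : ∀ p ∈ Metric.ball (0 : Euc n) ρ, ∃ e : Euc n ≃L[ℝ] Euc n,
      (e : Euc n →L[ℝ] Euc n) = fderiv ℝ (gradient k) (oh.symm p) ∧
      HasFDerivAt oh (e : Euc n →L[ℝ] Euc n) (oh.symm p) := by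
    intro p hp
    obtain ⟨e, he⟩ := exists_equiv_of_neg (half_pos hκ) (hneg' _ (hρball p hp).2)
    refine ⟨e, he, ?_⟩
    rw [he]
    exact hPd _ (hball _ (hρball p hp).2).1
  refine ⟨oh.symm, min r₀ r, min r₃ (min r₀ r), ρ, κ / 2, ‖fderiv ℝ (gradient k) 0‖ + κ / 2,
    lt_min hr₀ hr, min_le_right _ _, lt_min hr₃ (lt_min hr₀ hr), min_le_right _ _, ?_, half_pos hκ,
    by positivity, fun y hy => hneg' y (Metric.ball_subset_ball hr₀r hy),
    fun y hy => hnorm y (Metric.ball_subset_ball hr₀r hy), ?_, ?_, ?_⟩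
  · exact hρ
  · intro p hp
    obtain ⟨e, he, hed⟩ := hderiv p hp
    exact (oh.contDiffAt_symm (hρball p hp).1 hed
      (hPat _ (hball _ (hρball p hp).2).1)).contDiffWithinAt
  · intro p hp
    obtain ⟨e, he, hed⟩ := hderiv p hp
    have h1 := (hρball p hp).2
    refine ⟨?_, oh.right_inv (hρball p hp).1, fun ξ => ?_⟩
    · have h2 := (hball _ h1).1
      rw [Metric.mem_ball] at h1 h2 ⊢
      exact lt_min h1 h2
    · rw [(oh.hasFDerivAt_symm (hρball p hp).1 hed).fderiv, ← he]
      simp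
  · intro y hy
    have := hr₃ball y (Metric.ball_subset_ball (min_le_left _ _) hy)
    exact ⟨this.2, oh.left_inv this.1⟩

/-- `V` is the gradient of `H` up to a constant and `k` the Legendre transform of `H`, in the sense
that `∇k` and `-V` are inverse to each other; both are uniformly elliptic near the origin. -/
structure IsLegendrePair (H : Euc n → ℝ) (V : Euc n → Euc n) (k : Euc n → ℝ) (Y₀ : Euc n)
    (ρ r lo hi : ℝ) : Prop where
  ρ_pos : 0 < ρ
  r_pos : 0 < r
  lo_pos : 0 < lo
  hi_pos : 0 < hi
  smooth_V : ContDiffOn ℝ ∞ V (Metric.ball 0 ρ)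
  grad_H : ∀ p ∈ Metric.ball 0 ρ, HasGradientAt H (V p - Y₀) p
  symm_V : ∀ p ∈ Metric.ball 0 ρ, ∀ ξ η, inner ℝ (fderiv ℝ V p ξ) η = inner ℝ (fderiv ℝ V p η) ξ
  lo_V : ∀ p ∈ Metric.ball 0 ρ, ∀ ξ, lo * ‖ξ‖ ^ 2 ≤ inner ℝ (fderiv ℝ V p ξ) ξ
  hi_V : ∀ p ∈ Metric.ball 0 ρ, ∀ ξ, inner ℝ (fderiv ℝ V p ξ) ξ ≤ hi * ‖ξ‖ ^ 2
  smooth_k : ContDiffOn ℝ ∞ k (Metric.ball 0 r)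
  grad_mem : ∀ y ∈ Metric.ball 0 r, gradient k y ∈ Metric.ball 0 ρ
  V_grad : ∀ y ∈ Metric.ball 0 r, V (gradient k y) = -y
  lo_k : ∀ y ∈ Metric.ball 0 r, lo * ‖y‖ ^ 2 ≤ -k y
  hi_k : ∀ y ∈ Metric.ball 0 r, -k y ≤ hi * ‖y‖ ^ 2
  norm_grad_k : ∀ y ∈ Metric.ball 0 r, ‖gradient k y‖ ≤ hi * ‖y‖

variable {K : Set (Euc (n + 1))}

lemma gradient_comp_add_left (f : Euc n → ℝ) (a : Euc n) (c : ℝ) :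
    gradient (fun x => f (a + x) - c) = fun x => gradient f (a + x) := by
  funext x
  rw [gradient, gradient, fderiv_sub_const, fderiv_comp_add_left]

/-- The value of the support function at the normal of a graph in the boundary. -/
lemma supportFn_eq_of_graph (hconv : Convex ℝ K) {Y₀ : Euc n} {r h : ℝ} {k : Euc n → ℝ}
    (hgr : ∀ x ∈ Metric.ball Y₀ r, k x ∈ Ioo (k Y₀ - h) (k Y₀ + h) ∧
        ∀ t ∈ Ioo (k Y₀ - h) (k Y₀ + h), (t < k x → vpoint x t ∈ K) ∧
          (k x < t → vpoint x t ∉ closure K))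
    {y p : Euc n} (hy : y ∈ Metric.ball Y₀ r) (hmax : ∀ x ∈ Metric.ball Y₀ r,
      k x ≤ k y + inner ℝ p (x - y)) :
    supportFn K (vpoint (-p) 1) = k y - inner ℝ y p := by
  have hℓ : ∀ x t, inner ℝ (vpoint x t) (vpoint (-p) 1) = t - inner ℝ x p := by
    intro x t
    rw [inner_vpoint, inner_neg_right]; ring
  have hmem : ∀ s, 0 < s → s < k y - (k Y₀ - h) → vpoint y (k y - s) ∈ K := fun s hs hs' =>
    ((hgr y hy).2 (k y - s) ⟨by linarith, by linarith [(hgr y hy).1.2]⟩).1 (by linarith)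
  have hpos : 0 < k y - (k Y₀ - h) := by linarith [(hgr y hy).1.1]
  have hcl : vpoint y (k y) ∈ closure K := by
    have hc : Tendsto (fun s : ℝ => vpoint y (k y - s)) (𝓝[>] 0) (𝓝 (vpoint y (k y))) := by
      have : ContinuousAt (fun s : ℝ => vpoint y (k y - s)) 0 :=
        (continuous_vpoint.comp (by fun_prop : Continuous fun s : ℝ => (y, k y - s))).continuousAt
      simpa using this.tendsto.mono_left nhdsWithin_le_nhds
    refine mem_closure_of_tendsto hc ?_
    filter_upwards [Ioo_mem_nhdsGT hpos] with s hs using hmem s hs.1 hs.2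
  have hloc : IsLocalMaxOn (fun z : Euc (n + 1) => inner ℝ z (vpoint (-p) 1)) (closure K)
      (vpoint y (k y)) := by
    have hopen : IsOpen ((vpointL n).symm ⁻¹' (Metric.ball Y₀ r ×ˢ Ioo (k Y₀ - h) (k Y₀ + h))) :=
      (Metric.isOpen_ball.prod isOpen_Ioo).preimage (vpointL n).symm.continuous
    have hev : ∀ᶠ z in 𝓝[closure K] (vpoint y (k y)),
        z ∈ (vpointL n).symm ⁻¹' (Metric.ball Y₀ r ×ˢ Ioo (k Y₀ - h) (k Y₀ + h)) :=
      (hopen.eventually_mem (by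
        simp only [mem_preimage, vpointL_symm_apply, horiz_vpoint, vpoint_last]
        exact ⟨hy, (hgr y hy).1⟩)).filter_mono nhdsWithin_le_nhds
    filter_upwards [hev, self_mem_nhdsWithin] with z hz hzK
    rw [← vpoint_horiz z] at hzK ⊢
    simp only [mem_preimage, vpointL_symm_apply] at hz
    rw [hℓ, hℓ]
    have h1 : z (Fin.last n) ≤ k (horiz z) := by
      by_contra! hlt
      exact ((hgr _ hz.1).2 _ hz.2).2 hlt hzK
    have h2 := hmax _ hz.1
    rw [inner_sub_right, real_inner_comm, real_inner_comm y p] at h2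
    linarith
  -- The graph describes `K` only locally, but a local maximum of a linear function on a convex set
  -- is global.
  have hmaxOn := IsMaxOn.of_isLocalMaxOn_of_concaveOn hcl hloc
    ⟨hconv.closure, fun a _ b _ s t _ _ _ => by
      simp only [inner_add_left, inner_smul_left, smul_eq_mul, conj_trivial]; rfl⟩
  rw [← hℓ]
  refine IsLUB.csSup_eq ⟨?_, fun b hb => ?_⟩ ⟨_, mem_image_of_mem _ (hmem _ (half_pos hpos)
    (half_lt_self hpos))⟩
  · rintro _ ⟨z, hz, rfl⟩
    exact hmaxOn (subset_closure hz)
  -- The maximiser may lie only in the closure of `K`, so the supremum is approached by points of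
  -- `K` just below it.
  · refine le_of_forall_pos_lt_add fun s hs => ?_
    have hs' : 0 < min (s / 2) ((k y - (k Y₀ - h)) / 2) := lt_min (half_pos hs) (half_pos hpos)
    have := hb (mem_image_of_mem (fun z => inner ℝ z (vpoint (-p) 1)) (hmem _ hs'
      ((min_le_right _ _).trans_lt (half_lt_self hpos))))
    simp only [hℓ] at this ⊢
    have := min_le_left (s / 2) ((k y - (k Y₀ - h)) / 2)
    linarith

/-- The support function of a Wulff shape is smooth and elliptic near the vertical direction. -/
lemma IsWulffShape.exists_legendre (hK : IsWulffShape K) :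
    ∃ (V : Euc n → Euc n) (k : Euc n → ℝ) (Y₀ : Euc n) (ρ r lo hi : ℝ),
      IsLegendrePair (fun p => supportFn K (vpoint (-p) 1)) V k Y₀ ρ r lo hi := by
  obtain ⟨Y₀, r₁, h, κ, k', hr₁, hκ, hk', hgr, hgrad', hneg'⟩ := hK.exists_top
  set k : Euc n → ℝ := fun y => k' (Y₀ + y) - k' Y₀ with hkdef
  have hgk : gradient k = fun y => gradient k' (Y₀ + y) := gradient_comp_add_left k' Y₀ _
  have hmem : ∀ y, y ∈ Metric.ball (0 : Euc n) r₁ → Y₀ + y ∈ Metric.ball Y₀ r₁ := by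
    intro y hy; simpa using hy
  have hk : ContDiffOn ℝ ∞ k (Metric.ball 0 r₁) :=
    (hk'.comp (contDiff_const.add contDiff_id).contDiffOn hmem).sub contDiffOn_const
  obtain ⟨Y, r₂, r₃, ρ, m, C, hr₂, hr₂₁, hr₃, hr₃₂, hρ, hm, hC, hlow, hnorm, hY, hYp, hYk⟩ :=
    exists_inverse_gradient hr₁ hκ hk (by rw [hgk]; simpa using hgrad') (by
      intro ξ
      rw [hgk, fderiv_comp_add_left, add_zero]
      exact hneg' ξ)
  have hk2 : ContDiffOn ℝ ∞ k (Metric.ball 0 r₂) := hk.mono (Metric.ball_subset_ball hr₂₁)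
  have hb0 : (0 : Euc n) ∈ Metric.ball (0 : Euc n) r₂ := Metric.mem_ball_self hr₂
  have hk0 : k 0 = 0 := by simp [hkdef]
  have hgk0 : gradient k 0 = 0 := by rw [hgk]; simpa using hgrad'
  have hkd : ∀ y ∈ Metric.ball (0 : Euc n) r₂, HasFDerivAt k (fderiv ℝ k y) y := fun y hy =>
    ((hk2.contDiffAt (Metric.isOpen_ball.mem_nhds hy)).differentiableAt (by simp)).hasFDerivAt
  have hupper : ∀ a ∈ Metric.ball (0 : Euc n) r₂, ∀ y ∈ Metric.ball (0 : Euc n) r₂,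
      k y ≤ k a + inner ℝ (gradient k a) (y - a) - m / 2 * ‖y - a‖ ^ 2 := by
    intro a ha y hy
    have hgneg : gradient (fun y => -k y) = fun y => -gradient k y := by
      funext x; rw [gradient, gradient, fderiv_fun_neg, map_neg]
    have := quadratic_lower_bound (f := fun y => -k y) (m := m) hk2.neg Metric.isOpen_ball
      (convex_ball _ _) (fun x hx ξ => by
        rw [hgneg, fderiv_fun_neg, neg_apply, inner_neg_left]
        linarith [hlow x hx ξ]) ha hy
    rw [hgneg] at this
    simp only [inner_neg_left] at this
    linarith
  have hlower : ∀ y ∈ Metric.ball (0 : Euc n) r₂, -k y ≤ C / 2 * ‖y‖ ^ 2 := by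
    intro y hy
    have := quadratic_lower_bound (m := -C) hk2 Metric.isOpen_ball
      (convex_ball _ _) (fun x hx ξ => by
        have h1 : |inner ℝ (fderiv ℝ (gradient k) x ξ) ξ| ≤ C * ‖ξ‖ * ‖ξ‖ :=
          (abs_real_inner_le_norm _ _).trans (by
            gcongr; exact (ContinuousLinearMap.le_opNorm _ _).trans
              (by gcongr; exact hnorm x hx))
        have h2 := (abs_le.1 h1).1
        nlinarith) hb0 hy
    rw [hgk0, hk0] at this
    simp only [inner_zero_left, sub_zero] at this
    linarith
  -- Concavity makes `Y p`, the point where `∇k = p`, the maximiser that defines the support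
  -- function in the direction `(-p, 1)`.
  have hH : ∀ p ∈ Metric.ball (0 : Euc n) ρ, supportFn K (vpoint (-p) 1) =
      k (Y p) + k' Y₀ - inner ℝ (Y₀ + Y p) p := by
    intro p hp
    obtain ⟨hYb, hYg, -⟩ := hYp p hp
    have hsub : Metric.ball Y₀ r₂ ⊆ Metric.ball Y₀ r₁ := Metric.ball_subset_ball hr₂₁
    have := supportFn_eq_of_graph hK.convex (fun x hx => hgr x (hsub hx))
      (y := Y₀ + Y p) (p := p) (by simpa using hYb) (fun x hx => by
        have h1 := hupper (Y p) hYb (x - Y₀) (by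
          rw [mem_ball_iff_norm] at hx; simpa using hx)
        rw [hYg] at h1
        have h2 : 0 ≤ m / 2 * ‖x - Y₀ - Y p‖ ^ 2 := by positivity
        simp only [hkdef, add_sub_cancel] at h1
        rw [← sub_sub]
        linarith)
    rw [this]
    simp [hkdef]
  have hYd : ∀ p ∈ Metric.ball (0 : Euc n) ρ, HasFDerivAt Y (fderiv ℝ Y p) p := fun p hp =>
    ((hY.contDiffAt (Metric.isOpen_ball.mem_nhds hp)).differentiableAt (by simp)).hasFDerivAt
  have hfV : ∀ p, fderiv ℝ (fun p => -Y p) p = -fderiv ℝ Y p := fun p => fderiv_fun_neg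
  -- Here `-D²k ≥ m` and `|D²k| ≤ C`. Integrating twice gives `m/2` and `C/2` for `-k`. Inverting
  -- gives `m/C²` and `1/m` for `DV = -(D²k)⁻¹`.
  refine ⟨fun p => -Y p, k, Y₀, ρ, r₃, min (m / 2) (m / C ^ 2), max C (1 / m), hρ, hr₃,
    lt_min (half_pos hm) (by positivity), lt_max_of_lt_left hC, hY.neg, ?_, ?_, ?_, ?_,
    hk2.mono (Metric.ball_subset_ball hr₃₂), fun y hy => (hYk y hy).1,
    fun y hy => by rw [(hYk y hy).2], ?_, ?_, ?_⟩
  · intro p hp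
    obtain ⟨hYb, hYg, -⟩ := hYp p hp
    rw [hasGradientAt_iff_hasFDerivAt]
    have h1 : HasFDerivAt (fun p => k (Y p) + k' Y₀ - inner ℝ (Y₀ + Y p) p) _ p :=
      (((hkd _ hYb).comp p (hYd p hp)).add_const (k' Y₀)).sub
      (((hYd p hp).const_add Y₀).inner ℝ (hasFDerivAt_id p))
    have h2 := h1.congr_of_eventuallyEq (f₁ := fun p => supportFn K (vpoint (-p) 1)) (by
      filter_upwards [Metric.isOpen_ball.mem_nhds hp] with q hq using hH q hq)
    -- The terms containing `DY` cancel because `∇k(Y p) = p`, which leaves `-(Y₀ + Y p)`.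
    refine h2.congr_fderiv ?_
    ext ξ
    simp only [sub_apply, ContinuousLinearMap.comp_apply,
      InnerProductSpace.toDual_apply_apply, ContinuousLinearMap.prod_apply,
      fderivInnerCLM_apply, ContinuousLinearMap.id_apply]
    rw [← inner_gradient_left, hYg, inner_sub_left, inner_neg_left, inner_add_left,
      real_inner_comm p]
    ring
  · intro p hp ξ η
    obtain ⟨hYb, -, hinv⟩ := hYp p hp
    have hs := inner_fderiv_gradient_comm hk2 Metric.isOpen_ball hYb (fderiv ℝ Y p ξ)
      (fderiv ℝ Y p η)
    rw [(hinv ξ).2, (hinv η).2] at hs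
    rw [hfV, neg_apply, neg_apply, inner_neg_left, inner_neg_left,
      real_inner_comm, real_inner_comm ξ, hs]
  · intro p hp ξ
    obtain ⟨hYb, -, hinv⟩ := hYp p hp
    rw [hfV, neg_apply, inner_neg_left]
    set a := fderiv ℝ Y p ξ with ha
    have h1 := hlow _ hYb a
    have hξ : fderiv ℝ (gradient k) (Y p) a = ξ := (hinv ξ).2
    rw [hξ, real_inner_comm] at h1
    have h2 : ‖ξ‖ ≤ C * ‖a‖ := by
      rw [← hξ]
      exact (ContinuousLinearMap.le_opNorm _ _).trans (by gcongr; exact hnorm _ hYb)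
    have h3 : ‖ξ‖ ^ 2 ≤ C ^ 2 * ‖a‖ ^ 2 := by
      rw [← mul_pow]; gcongr
    calc min (m / 2) (m / C ^ 2) * ‖ξ‖ ^ 2 ≤ m / C ^ 2 * ‖ξ‖ ^ 2 := by
          gcongr; exact min_le_right _ _
      _ ≤ m / C ^ 2 * (C ^ 2 * ‖a‖ ^ 2) := by gcongr
      _ = m * ‖a‖ ^ 2 := by field_simp
      _ ≤ _ := by linarith
  · intro p hp ξ
    obtain ⟨hYb, -, hinv⟩ := hYp p hp
    rw [hfV, neg_apply, inner_neg_left]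
    set a := fderiv ℝ Y p ξ with ha
    have h1 := hlow _ hYb a
    have hξ : fderiv ℝ (gradient k) (Y p) a = ξ := (hinv ξ).2
    rw [hξ, real_inner_comm] at h1
    have h2 : -inner ℝ a ξ ≤ ‖a‖ * ‖ξ‖ := (neg_le_abs _).trans (abs_real_inner_le_norm _ _)
    have h3 : ‖a‖ ≤ 1 / m * ‖ξ‖ := by
      rcases eq_or_lt_of_le (norm_nonneg a) with h0 | h0
      · rw [← h0]; positivity
      · rw [one_div, ← div_eq_inv_mul, le_div_iff₀ hm]
        refine le_of_mul_le_mul_left ?_ h0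
        nlinarith
    calc -inner ℝ a ξ ≤ ‖a‖ * ‖ξ‖ := h2
      _ ≤ 1 / m * ‖ξ‖ * ‖ξ‖ := by gcongr
      _ = 1 / m * ‖ξ‖ ^ 2 := by ring
      _ ≤ _ := by gcongr; exact le_max_right _ _
  · intro y hy
    have h1 := hupper 0 hb0 y (Metric.ball_subset_ball hr₃₂ hy)
    rw [hgk0, hk0] at h1
    simp only [inner_zero_left, sub_zero] at h1
    have : min (m / 2) (m / C ^ 2) * ‖y‖ ^ 2 ≤ m / 2 * ‖y‖ ^ 2 := by
      gcongr; exact min_le_left _ _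
    linarith
  · intro y hy
    refine (hlower y (Metric.ball_subset_ball hr₃₂ hy)).trans ?_
    gcongr
    exact (half_le_self hC.le).trans (le_max_left _ _)
  · intro y hy
    have h1 := (convex_ball (0 : Euc n) r₂).norm_image_sub_le_of_norm_fderiv_le (𝕜 := ℝ)
      (f := gradient k) (C := C) (fun x hx => ((hk2.gradient_of_isOpen Metric.isOpen_ball).contDiffAt
        (Metric.isOpen_ball.mem_nhds hx)).differentiableAt (by simp)) hnorm hb0
      (Metric.ball_subset_ball hr₃₂ hy)
    rw [hgk0, sub_zero, sub_zero] at h1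
    refine h1.trans ?_
    gcongr
    exact le_max_left _ _

end Legendre

/-! ### The reflected Wulff shape -/

section Reflection

lemma fderiv_comp_neg_eq {V F : Type*} [NormedAddCommGroup V] [NormedSpace ℝ V]
    [NormedAddCommGroup F] [NormedSpace ℝ F] (f : V → F) (x : V) :
    fderiv ℝ (fun y => f (-y)) x = -fderiv ℝ f (-x) := by
  have h := (ContinuousLinearEquiv.neg ℝ (M := V)).comp_right_fderiv (f := f) (x := x)
  ext v
  have h2 := congrArg (fun L : V →L[ℝ] F => L v) h
  refine Eq.trans h2 ?_
  simp

lemma IsDefiningFunctionOn.preimage_neg {m : ℕ} {g : Euc m → ℝ} {E U : Set (Euc m)}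
    (h : IsDefiningFunctionOn g E U) :
    IsDefiningFunctionOn (fun x => g (-x)) ((fun x => -x) ⁻¹' E) ((fun x => -x) ⁻¹' U) :=
  ⟨h.isOpen.preimage continuous_neg, h.smooth.comp contDiff_neg.contDiffOn fun _ hx => hx,
    fun x hx h0 => h.regular (-x) hx (by
      rw [fderiv_comp_neg_eq] at h0
      exact neg_eq_zero.1 h0),
    fun x hx hg => h.neg_mem _ hx hg, fun x hx hg => h.pos_notMem _ hx hg⟩

/-- Reversing the normal of `S` replaces `Φ(v)` by `Φ(-v)`, the support function of `-K`. Both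
orientations thus reduce to an upward normal. -/
lemma IsWulffShape.preimage_neg {m : ℕ} {K : Set (Euc m)} (hK : IsWulffShape K) :
    IsWulffShape ((fun x => -x) ⁻¹' K) := by
  refine ⟨hK.nonempty.preimage neg_surjective, ?_, ?_, ?_⟩
  · have : (fun x : Euc m => -x) ⁻¹' K = (fun x => -x) '' K := by
      rw [image_eq_preimage_of_inverse neg_neg neg_neg]
    rw [this]
    exact ((LinearIsometryEquiv.neg ℝ (E := Euc m)).lipschitz.isBounded_image hK.bounded)
  · exact hK.convex.linear_preimage (-LinearMap.id : Euc m →ₗ[ℝ] Euc m)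
  · obtain ⟨κ, hκ, hall⟩ := hK.smooth_uniformly_convex
    refine ⟨κ, hκ, fun p hp => ?_⟩
    have hp' : -p ∈ frontier K := by
      have := (Homeomorph.neg (Euc m)).preimage_frontier K
      exact this.symm.subset hp
    obtain ⟨U, g, hpU, hg, hcurv⟩ := hall (-p) hp'
    refine ⟨_, _, hpU, hg.preimage_neg, fun τ hτ => ?_⟩
    have h1 : fderiv ℝ (fun x => g (-x)) = fun x => -fderiv ℝ g (-x) := by
      funext x; exact fderiv_comp_neg_eq g x
    have h2 : fderiv ℝ (fderiv ℝ (fun x => g (-x))) p = fderiv ℝ (fderiv ℝ g) (-p) := by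
      rw [h1, fderiv_fun_neg, fderiv_comp_neg_eq (fderiv ℝ g), neg_neg]
    rw [h2, h1]
    simp only [norm_neg]
    refine hcurv τ ?_
    rw [h1] at hτ
    simpa using hτ

lemma supportFn_preimage_neg {m : ℕ} (K : Set (Euc m)) (x : Euc m) :
    supportFn ((fun x => -x) ⁻¹' K) x = supportFn K (-x) := by
  unfold supportFn
  congr 1
  ext s
  constructor
  · rintro ⟨y, hy, rfl⟩
    exact ⟨-y, hy, by simp⟩
  · rintro ⟨y, hy, rfl⟩
    exact ⟨-y, by simpa using hy, by simp⟩

end Reflection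

/-! ### The lowest sheet of a hypersurface in the unit cylinder -/

section Sheet

variable {n : ℕ}

/-- The cylinder `B₁ × (0, 1)`. -/
abbrev unitCylinder (n : ℕ) : Set (Euc (n + 1)) := solidCylinder (0 : Euc n) 1 0 1

/-- The height of the lowest point of `S` over `x`. -/
noncomputable def lowestHeight (S : Set (Euc (n + 1))) (x : Euc n) : ℝ :=
  sInf {t | vpoint x t ∈ S}

lemma lowestHeight_eq {S : Set (Euc (n + 1))} {x : Euc n} {t : ℝ} (ht : vpoint x t ∈ S)
    (hle : ∀ s, vpoint x s ∈ S → t ≤ s) : lowestHeight S x = t :=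
  IsLeast.csInf_eq ⟨ht, fun s hs => hle s hs⟩

/-- Points of the cylinder with no point of the boundary of `E` below them belong to `E`. -/
def BottomIn (E : Set (Euc (n + 1))) : Prop :=
  ∀ x ∈ Metric.ball (0 : Euc n) 1, ∀ t ≤ 1,
    (∀ s ∈ Ioo 0 t, vpoint x s ∉ frontier E ∩ unitCylinder n) → ∀ s ∈ Ioo 0 t, vpoint x s ∈ E

variable {E : Set (Euc (n + 1))}

/-- A closed set that avoids `C × {0}` with `C` compact avoids a slab around it. -/
lemma bottom_gap {S : Set (Euc (n + 1))}
    (hbot : ∀ x ∈ Metric.ball (0 : Euc n) 1, vpoint x 0 ∉ closure S) {C : Set (Euc n)}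
    (hC : IsCompact C) (hC1 : C ⊆ Metric.ball 0 1) :
    ∃ η > 0, ∀ x ∈ C, ∀ t, |t| < η → vpoint x t ∉ closure S := by
  have : ∀ᶠ t in 𝓝 (0 : ℝ), ∀ x ∈ C, vpoint x t ∉ closure S := by
    refine hC.eventually_forall_of_forall_eventually fun x hx => ?_
    have hc : ContinuousAt (fun p : ℝ × Euc n => vpoint p.2 p.1) (0, x) :=
      (continuous_vpoint.comp continuous_swap).continuousAt
    exact hc.eventually_mem (isClosed_closure.isOpen_compl.mem_nhds (hbot x (hC1 hx)))
  obtain ⟨η, hη, h⟩ := Metric.eventually_nhds_iff.1 this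
  exact ⟨η, hη, fun x hx t ht => h (by simpa using ht) x hx⟩

lemma mem_boundary_of_mem_closure {p : Euc (n + 1)}
    (hp : p ∈ closure (frontier E ∩ unitCylinder n)) (hQ : p ∈ unitCylinder n) :
    p ∈ frontier E ∩ unitCylinder n :=
  ⟨isClosed_frontier.closure_subset_iff.2 inter_subset_left hp, hQ⟩

lemma subset_of_isPreconnected_of_disjoint_frontier {X : Type*} [TopologicalSpace X] {s A : Set X}
    (hs : IsPreconnected s) (hd : ∀ x ∈ s, x ∉ frontier A) {x y : X} (hx : x ∈ s) (hy : y ∈ s)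
    (hxA : x ∈ A) : y ∈ A := by
  have hcov : s ⊆ interior A ∪ (closure A)ᶜ := fun z hz => by
    by_cases h : z ∈ closure A
    · exact Or.inl (by_contra fun hi => hd z hz ⟨h, hi⟩)
    · exact Or.inr h
  have hsub := hs.subset_left_of_subset_union isOpen_interior isClosed_closure.isOpen_compl
    (disjoint_left.2 fun z hz hz' => hz' (subset_closure (interior_subset hz))) hcov
    ⟨x, hx, by_contra fun hi => hd x hx ⟨subset_closure hxA, hi⟩⟩
  exact interior_subset (hsub hy)

/-- The two points are joined by going down vertically, across at a height `b` inside the gap above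
the bottom, and up again. This path never meets the boundary of `E`, so membership in `E` is
constant along it. -/
lemma mem_iff_mem_of_below
    (hbot : ∀ x ∈ Metric.ball (0 : Euc n) 1,
      vpoint x 0 ∉ closure (frontier E ∩ unitCylinder n))
    {x y : Euc n} (hx : x ∈ Metric.ball (0 : Euc n) 1) (hy : y ∈ Metric.ball (0 : Euc n) 1)
    {t u : ℝ} (ht : t ≤ 1) (hu : u ≤ 1)
    (htS : ∀ s ∈ Ioo 0 t, vpoint x s ∉ frontier E ∩ unitCylinder n)
    (huS : ∀ s ∈ Ioo 0 u, vpoint y s ∉ frontier E ∩ unitCylinder n)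
    {s v : ℝ} (hs : s ∈ Ioo 0 t) (hv : v ∈ Ioo 0 u) (hE : vpoint x s ∈ E) : vpoint y v ∈ E := by
  have hsub : segment ℝ x y ⊆ Metric.ball 0 1 := (convex_ball _ _).segment_subset hx hy
  obtain ⟨η, hη, hgap⟩ := bottom_gap hbot
    (by rw [segment_eq_image]; exact isCompact_Icc.image (by fun_prop) : IsCompact (segment ℝ x y))
    hsub
  have htpos : 0 < t := hs.1.trans hs.2
  have hupos : 0 < u := hv.1.trans hv.2
  obtain ⟨b, hb0, hb⟩ : ∃ b, 0 < b ∧ b < min η (min t u) :=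
    exists_between (lt_min hη (lt_min htpos hupos))
  simp only [lt_min_iff] at hb
  have hcv : ∀ z : Euc n, Continuous fun s : ℝ => vpoint z s := fun z =>
    continuous_vpoint.comp (by fun_prop : Continuous fun s : ℝ => (z, s))
  have hch : Continuous fun z : Euc n => vpoint z b :=
    continuous_vpoint.comp (by fun_prop : Continuous fun z : Euc n => (z, b))
  have h1 : IsPreconnected ((fun s => vpoint x s) '' Ioo 0 t) :=
    isPreconnected_Ioo.image _ (hcv x).continuousOn
  have h2 : IsPreconnected ((fun z => vpoint z b) '' segment ℝ x y) :=
    (convex_segment x y).isPreconnected.image _ hch.continuousOn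
  have h3 : IsPreconnected ((fun s => vpoint y s) '' Ioo 0 u) :=
    isPreconnected_Ioo.image _ (hcv y).continuousOn
  have hd1 : ∀ p ∈ (fun s => vpoint x s) '' Ioo 0 t, p ∉ frontier E := by
    rintro _ ⟨s, hs, rfl⟩ hf
    exact htS s hs ⟨hf, vpoint_mem_solidCylinder.2 ⟨hx, hs.1, hs.2.trans_le ht⟩⟩
  have hd3 : ∀ p ∈ (fun s => vpoint y s) '' Ioo 0 u, p ∉ frontier E := by
    rintro _ ⟨s, hs, rfl⟩ hf
    exact huS s hs ⟨hf, vpoint_mem_solidCylinder.2 ⟨hy, hs.1, hs.2.trans_le hu⟩⟩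
  have hd2 : ∀ p ∈ (fun z => vpoint z b) '' segment ℝ x y, p ∉ frontier E := by
    rintro _ ⟨z, hz, rfl⟩ hf
    exact hgap z hz b (by rw [abs_of_pos hb0]; exact hb.1) (subset_closure
      ⟨hf, vpoint_mem_solidCylinder.2 ⟨hsub hz, hb0, hb.2.1.trans_le ht⟩⟩)
  have e1 : vpoint x b ∈ E := subset_of_isPreconnected_of_disjoint_frontier h1 hd1
    (mem_image_of_mem _ hs) (mem_image_of_mem _ ⟨hb0, hb.2.1⟩) hE
  have e2 : vpoint y b ∈ E := subset_of_isPreconnected_of_disjoint_frontier h2 hd2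
    (mem_image_of_mem (fun z => vpoint z b) (left_mem_segment ℝ x y))
    (mem_image_of_mem (fun z => vpoint z b) (right_mem_segment ℝ x y)) e1
  exact subset_of_isPreconnected_of_disjoint_frontier h3 hd3
    (mem_image_of_mem _ ⟨hb0, hb.2.2⟩) (mem_image_of_mem (fun s => vpoint y s) hv) e2

/-- This allows `E` to be exchanged with its complement, after which `E` may be assumed to lie below
the lowest sheet. -/
lemma bottomIn_or_bottomIn_compl
    (hbot : ∀ x ∈ Metric.ball (0 : Euc n) 1,
      vpoint x 0 ∉ closure (frontier E ∩ unitCylinder n)) :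
    BottomIn E ∨ BottomIn Eᶜ := by
  by_cases h : BottomIn E
  · exact Or.inl h
  · right
    simp only [BottomIn, not_forall] at h
    obtain ⟨x, hx, t, ht, htS, s, hs, hsE⟩ := h
    intro y hy u hu huS v hv hvE
    rw [frontier_compl] at huS
    exact hsE (mem_iff_mem_of_below hbot hy hx hu ht huS htS hv hs hvE)

/-- Sliding a function up until it touches `S`. -/
lemma exists_lowest_contact
    (hbot : ∀ x ∈ Metric.ball (0 : Euc n) 1,
      vpoint x 0 ∉ closure (frontier E ∩ unitCylinder n))
    {D : Set (Euc n)} (hD : IsCompact D) (hD1 : D ⊆ Metric.ball 0 1) {q : Euc n → ℝ}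
    (hq : ContinuousOn q D) {x₁ : Euc n} {t₁ b : ℝ} (hx₁ : x₁ ∈ D)
    (h₁ : vpoint x₁ t₁ ∈ frontier E ∩ unitCylinder n) (hb : b < 1)
    (hqb : ∀ x ∈ D, t₁ - q x₁ + q x ≤ b) :
    ∃ x₀ ∈ D, ∃ t₀, vpoint x₀ t₀ ∈ frontier E ∩ unitCylinder n ∧
      ∀ x ∈ D, ∀ t, vpoint x t ∈ frontier E ∩ unitCylinder n → t₀ - q x₀ ≤ t - q x := by
  set S := frontier E ∩ unitCylinder n with hS
  have hmemQ : ∀ {x : Euc n} {t : ℝ}, vpoint x t ∈ S → 0 < t ∧ t < 1 := fun h =>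
    (vpoint_mem_solidCylinder.1 h.2).2
  -- Cutting at height `b < 1` keeps away from the top of the cylinder and restores compactness. By
  -- `hqb`, points above `b` cannot beat the competitor `(x₁, t₁)`.
  set T : Set (Euc n × ℝ) := (D ×ˢ Icc 0 b) ∩ {p | vpoint p.1 p.2 ∈ closure S} with hT
  have hTc : IsCompact T :=
    (hD.prod isCompact_Icc).inter_right (isClosed_closure.preimage continuous_vpoint)
  have hTS : ∀ p ∈ T, vpoint p.1 p.2 ∈ S := by
    rintro ⟨x, t⟩ ⟨⟨hx, ht⟩, hcl⟩
    refine mem_boundary_of_mem_closure hcl (vpoint_mem_solidCylinder.2 ⟨hD1 hx, ?_,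
      ht.2.trans_lt hb⟩)
    refine lt_of_le_of_ne ht.1 fun h0 => hbot x (hD1 hx) ?_
    simp only at h0
    rw [h0]; exact hcl
  have hT1 : (x₁, t₁) ∈ T := by
    refine ⟨⟨hx₁, (hmemQ h₁).1.le, ?_⟩, subset_closure h₁⟩
    have := hqb x₁ hx₁
    simp only
    linarith
  obtain ⟨⟨x₀, t₀⟩, h0T, h0min⟩ := hTc.exists_isMinOn ⟨_, hT1⟩
    (f := fun p : Euc n × ℝ => p.2 - q p.1)
    (continuousOn_snd.sub (hq.comp continuousOn_fst fun p hp => hp.1.1))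
  refine ⟨x₀, h0T.1.1, t₀, hTS _ h0T, fun x hx t ht => ?_⟩
  by_cases htb : t ≤ b
  · exact h0min (a := (x, t)) ⟨⟨hx, (hmemQ ht).1.le, htb⟩, subset_closure ht⟩
  · have h1 : t₀ - q x₀ ≤ t₁ - q x₁ := h0min hT1
    have := hqb x hx
    push Not at htb
    linarith

/-- Where a function touches `S` from below, the lowest sheet of `S` is a smooth graph. -/
lemma exists_graph_of_touching (hE : HasSmoothBoundaryIn E (unitCylinder n))
    (hbot : ∀ x ∈ Metric.ball (0 : Euc n) 1,
      vpoint x 0 ∉ closure (frontier E ∩ unitCylinder n)) (hlow : BottomIn E)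
    {q : Euc n → ℝ} {x₀ : Euc n} (hp : vpoint x₀ (q x₀) ∈ frontier E ∩ unitCylinder n)
    {O : Set (Euc n)} (hO : O ∈ 𝓝 x₀) (hq : DifferentiableAt ℝ q x₀)
    (htouch : ∀ x ∈ O, ∀ t, vpoint x t ∈ frontier E ∩ unitCylinder n → q x ≤ t) :
    ∃ r > 0, ∃ h, Metric.ball x₀ r ⊆ O ∧
      ContDiffOn ℝ ∞ (lowestHeight (frontier E ∩ unitCylinder n)) (Metric.ball x₀ r) ∧
      lowestHeight (frontier E ∩ unitCylinder n) x₀ = q x₀ ∧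
      ∀ x ∈ Metric.ball x₀ r,
        vpoint x (lowestHeight (frontier E ∩ unitCylinder n) x) ∈ frontier E ∩ unitCylinder n ∧
        (∀ t, vpoint x t ∈ frontier E ∩ unitCylinder n →
          lowestHeight (frontier E ∩ unitCylinder n) x ≤ t) ∧
        lowestHeight (frontier E ∩ unitCylinder n) x ∈ Ioo (q x₀ - h) (q x₀ + h) ∧
        ∀ t ∈ Ioo (q x₀ - h) (q x₀ + h),
          (t < lowestHeight (frontier E ∩ unitCylinder n) x → vpoint x t ∈ E) ∧
          (lowestHeight (frontier E ∩ unitCylinder n) x < t → vpoint x t ∉ E) := by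
  set S := frontier E ∩ unitCylinder n with hS
  obtain ⟨U', g, hpU', hg'⟩ := hE _ hp
  have hQ := vpoint_mem_solidCylinder.1 hp.2
  have hUo : IsOpen (U' ∩ unitCylinder n) := hg'.isOpen.inter (isOpen_solidCylinder _ _ _ _)
  have hg := hg'.mono hUo inter_subset_left
  have hpU : vpoint x₀ (q x₀) ∈ U' ∩ unitCylinder n := ⟨hpU', hp.2⟩
  set U := U' ∩ unitCylinder n with hU
  have hg0 := hg.eq_zero hpU hp.1
  have hgd : HasFDerivAt g (fderiv ℝ g (vpoint x₀ (q x₀))) (vpoint x₀ (q x₀)) :=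
    ((hg.smooth.contDiffAt (hg.isOpen.mem_nhds hpU)).differentiableAt (by simp)).hasFDerivAt
  -- Points just below the graph of `q` have no boundary point beneath them, so `BottomIn` places
  -- them in `E`, where `g ≤ 0`. Hence `∂ₜg > 0` at the contact point.
  obtain ⟨hpos, -⟩ := pos_and_eq_zero_of_forall_nonpos (hg.regular _ hpU)
    (a := fderiv ℝ q x₀) (fun ξ => by
      have h1 : HasDerivAt (fun s : ℝ => x₀ + s • ξ) ξ 0 := by
        simpa using ((hasDerivAt_id (0 : ℝ)).smul_const ξ).const_add x₀
      have h2 : HasDerivAt (fun s : ℝ => q (x₀ + s • ξ) - s) (fderiv ℝ q x₀ ξ - 1) 0 :=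
        ((by simpa using hq.hasFDerivAt : HasFDerivAt q (fderiv ℝ q x₀)
          (x₀ + (0 : ℝ) • ξ)).comp_hasDerivAt (0 : ℝ) h1).sub (hasDerivAt_id 0)
      have hγ : HasDerivAt (fun s : ℝ => vpoint (x₀ + s • ξ) (q (x₀ + s • ξ) - s))
          (vpoint ξ (fderiv ℝ q x₀ ξ - 1)) 0 :=
        (vpointL n).hasFDerivAt.comp_hasDerivAt (0 : ℝ) (h1.prodMk h2)
      have hcomp := (by simpa using hgd : HasFDerivAt g (fderiv ℝ g (vpoint x₀ (q x₀)))
        (vpoint (x₀ + (0 : ℝ) • ξ) (q (x₀ + (0 : ℝ) • ξ) - 0))).comp_hasDerivAt (0 : ℝ) hγ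
      refine nonpos_of_hasDerivAt_of_nonpos hcomp (by simpa using hg0) ?_
      have ev1 : ∀ᶠ s : ℝ in 𝓝 0, vpoint (x₀ + s • ξ) (q (x₀ + s • ξ) - s) ∈ U :=
        hγ.continuousAt.eventually_mem (by simpa using hUo.mem_nhds hpU)
      have ev2 : ∀ᶠ s : ℝ in 𝓝 0, x₀ + s • ξ ∈ O :=
        h1.continuousAt.eventually_mem (by simpa using hO)
      have ev3 : ∀ᶠ s : ℝ in 𝓝 0, q (x₀ + s • ξ) - s + s < 1 :=
        (h2.continuousAt.add continuousAt_id).eventually (gt_mem_nhds (by simpa using hQ.2.2))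
      filter_upwards [ev1.filter_mono nhdsWithin_le_nhds, ev2.filter_mono nhdsWithin_le_nhds,
        ev3.filter_mono nhdsWithin_le_nhds, self_mem_nhdsWithin] with s hs1 hs2 hs3 hs0
      have hsQ := vpoint_mem_solidCylinder.1 hs1.2
      by_contra! hgpos
      refine hg.pos_notMem _ hs1 hgpos (hlow _ hsQ.1 (q (x₀ + s • ξ)) (by linarith) ?_ _
        ⟨hsQ.2.1, ?_⟩)
      · intro v hv hvS
        exact absurd (htouch _ hs2 v hvS) (not_le.2 hv.2)
      · have : (0 : ℝ) < s := hs0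
        linarith)
  obtain ⟨r₁, hr₁, h, hh, w, hbox, hw, hw0, hgr⟩ := hg.exists_graph hpU hg0 hpos
  -- No other sheet passes under the local graph: over `x₀` there is none because `q` touches from
  -- below, and compactness of the height interval extends this to nearby `x`.
  have hev : ∀ᶠ x in 𝓝 x₀, ∀ t ∈ Icc 0 (q x₀ - h), vpoint x t ∉ closure S := by
    refine isCompact_Icc.eventually_forall_of_forall_eventually fun t ht => ?_
    have hc : ContinuousAt (fun p : Euc n × ℝ => vpoint p.1 p.2) (x₀, t) :=
      continuous_vpoint.continuousAt
    refine hc.eventually_mem (isClosed_closure.isOpen_compl.mem_nhds fun hcl => ?_)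
    rcases eq_or_lt_of_le ht.1 with h0 | h0
    · exact hbot x₀ hQ.1 (by rw [h0]; exact hcl)
    · have hmem := mem_boundary_of_mem_closure hcl (vpoint_mem_solidCylinder.2
        ⟨hQ.1, h0, by linarith [ht.2, hQ.2.2]⟩)
      linarith [htouch x₀ (mem_of_mem_nhds hO) t hmem, ht.2]
  obtain ⟨r₂, hr₂, hr₂ball⟩ := Metric.eventually_nhds_iff_ball.1
    (hev.and (eventually_mem_set.2 hO))
  have hs1 : Metric.ball x₀ (min r₁ r₂) ⊆ Metric.ball x₀ r₁ :=
    Metric.ball_subset_ball (min_le_left _ _)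
  have hs2 : Metric.ball x₀ (min r₁ r₂) ⊆ Metric.ball x₀ r₂ :=
    Metric.ball_subset_ball (min_le_right _ _)
  have hwS : ∀ x ∈ Metric.ball x₀ r₁, vpoint x (w x) ∈ S := by
    intro x hx
    have hwx := (hgr x hx).1
    have hc : ContinuousAt (fun s : ℝ => vpoint x s) (w x) :=
      (continuous_vpoint.comp (by fun_prop : Continuous fun s : ℝ => (x, s))).continuousAt
    refine ⟨?_, (hbox x hx _ hwx).2⟩
    rw [frontier_eq_closure_inter_closure]
    constructor
    · refine mem_closure_of_tendsto (hc.tendsto.mono_left (nhdsWithin_le_nhds (s := Iio (w x)))) ?_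
      filter_upwards [Ioo_mem_nhdsLT hwx.1] with s hs
      have hs' : s ∈ Ioo (q x₀ - h) (q x₀ + h) := ⟨hs.1, hs.2.trans hwx.2⟩
      exact hg.neg_mem _ (hbox x hx s hs') (((hgr x hx).2.2 s hs').1 hs.2)
    · refine mem_closure_of_tendsto (hc.tendsto.mono_left (nhdsWithin_le_nhds (s := Ioi (w x)))) ?_
      filter_upwards [Ioo_mem_nhdsGT hwx.2] with s hs
      have hs' : s ∈ Ioo (q x₀ - h) (q x₀ + h) := ⟨hwx.1.trans hs.1, hs.2⟩
      exact hg.pos_notMem _ (hbox x hx s hs') (((hgr x hx).2.2 s hs').2 hs.1)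
  have hmin : ∀ x ∈ Metric.ball x₀ (min r₁ r₂), ∀ t, vpoint x t ∈ S → w x ≤ t := by
    intro x hx t ht
    by_contra! hlt
    have hwx := (hgr x (hs1 hx)).1
    by_cases hth : t ≤ q x₀ - h
    · exact (hr₂ball x (hs2 hx)).1 t ⟨(vpoint_mem_solidCylinder.1 ht.2).2.1.le, hth⟩
        (subset_closure ht)
    · have ht' : t ∈ Ioo (q x₀ - h) (q x₀ + h) := ⟨not_le.1 hth, hlt.trans hwx.2⟩
      have h1 := ((hgr x (hs1 hx)).2.2 t ht').1 hlt
      exact h1.ne (hg.eq_zero (hbox x (hs1 hx) t ht') ht.1)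
  have heq : ∀ x ∈ Metric.ball x₀ (min r₁ r₂), lowestHeight S x = w x := fun x hx =>
    lowestHeight_eq (hwS x (hs1 hx)) (hmin x hx)
  refine ⟨min r₁ r₂, lt_min hr₁ hr₂, h, fun x hx => (hr₂ball x (hs2 hx)).2,
    (hw.mono hs1).congr heq, (heq _ (Metric.mem_ball_self (lt_min hr₁ hr₂))).trans hw0,
    fun x hx => ?_⟩
  rw [heq x hx]
  exact ⟨hwS x (hs1 hx), hmin x hx, (hgr x (hs1 hx)).1, fun t ht =>
    ⟨fun hlt => hg.neg_mem _ (hbox x (hs1 hx) t ht) (((hgr x (hs1 hx)).2.2 t ht).1 hlt),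
      fun hlt => hg.pos_notMem _ (hbox x (hs1 hx) t ht) (((hgr x (hs1 hx)).2.2 t ht).2 hlt)⟩⟩

end Sheet

/-! ### Normal vectors of graphs -/

section CrossNormal

variable {n : ℕ}

/-- Each tangent row of the determinant is scaled by `s j`, and the last row is untouched. This
serves to reverse the normal of a parametrization. -/
lemma crossNormal_comp_linearIsometryEquiv (F : Euc n → Euc (n + 1)) (R : Euc n ≃ₗᵢ[ℝ] Euc n)
    {s : Fin n → ℝ} (hR : ∀ j, R (EuclideanSpace.single j 1) = s j • EuclideanSpace.single j 1)
    (u : Euc n) : crossNormal (fun v => F (R v)) u = (∏ j, s j) • crossNormal F (R u) := by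
  have hfd : fderiv ℝ (fun v => F (R v)) u
      = (fderiv ℝ F (R u)).comp (R.toContinuousLinearEquiv : Euc n →L[ℝ] Euc n) :=
    R.toContinuousLinearEquiv.comp_right_fderiv
  ext i
  simp only [crossNormal, PiLp.smul_apply, smul_eq_mul]
  have hprod : (∏ j, s j) = ∏ j, (Fin.snoc (α := fun _ => ℝ) s 1 : Fin (n + 1) → ℝ) j := by
    simp [Fin.prod_univ_castSucc]
  rw [hprod, ← Matrix.det_mul_column]
  congr 1
  ext a b
  refine Fin.lastCases ?_ (fun j => ?_) a
  · simp
  · simp [hfd, hR]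

/-- As a function `φ` of its last row, the determinant vanishes on the tangent rows and is `1` on
`eₙ₊₁`. The formula follows from `eⱼ = rows j - ∂ⱼf eₙ₊₁`. -/
lemma crossNormal_graph {f : Euc n → ℝ} {u : Euc n} (hf : DifferentiableAt ℝ f u) :
    crossNormal (fun x => vpoint x (f x)) u = vpoint (-gradient f u) 1 := by
  have hfd : ∀ v, fderiv ℝ (fun x => vpoint x (f x)) u v = vpoint v (fderiv ℝ f u v) := by
    intro v
    have : HasFDerivAt (fun x => vpoint x (f x)) _ u :=
      (vpointL n).hasFDerivAt.comp u ((hasFDerivAt_id u).prodMk hf.hasFDerivAt)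
    rw [this.fderiv]
    rfl
  set rows : Fin n → Fin (n + 1) → ℝ := fun j k =>
    fderiv ℝ (fun x => vpoint x (f x)) u (EuclideanSpace.single j (1 : ℝ)) k with hrows
  set φ : (Fin (n + 1) → ℝ) →ₗ[ℝ] ℝ :=
    (Matrix.detRowAlternating (n := Fin (n + 1)) (R := ℝ)).toMultilinearMap.toLinearMap
      (Fin.snoc (α := fun _ => Fin (n + 1) → ℝ) rows 0) (Fin.last n) with hφ
  have hφv : ∀ v, φ v = Matrix.det (Matrix.of (Fin.snoc (α := fun _ => Fin (n + 1) → ℝ) rows v)) := by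
    intro v
    rw [hφ, MultilinearMap.toLinearMap_apply, Fin.update_snoc_last]
    rfl
  have hlast : φ (Pi.single (Fin.last n) 1) = 1 := by
    rw [hφv, Matrix.det_of_isUpperTriangular]
    · rw [Fin.prod_univ_castSucc]
      simp [hrows, hfd]
    · intro a b hab
      revert hab
      refine Fin.lastCases (fun hab => ?_) (fun j hab => ?_) a
      · have hab' : b < Fin.last n := hab
        simp [hab'.ne]
      · have hab' : b < j.castSucc := hab
        obtain ⟨c, rfl⟩ : ∃ c : Fin n, b = c.castSucc :=
          ⟨b.castPred (hab'.trans (Fin.castSucc_lt_last j)).ne, by simp⟩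
        have hcj : c < j := by simpa using hab'
        simp [hrows, hfd, hcj.ne]
  have hrow : ∀ j, φ (rows j) = 0 := by
    intro j
    rw [hφv]
    refine Matrix.det_zero_of_row_eq (i := j.castSucc) (j := Fin.last n)
      (Fin.castSucc_lt_last j).ne ?_
    change Fin.snoc (α := fun _ => Fin (n + 1) → ℝ) rows (rows j) j.castSucc
      = Fin.snoc (α := fun _ => Fin (n + 1) → ℝ) rows (rows j) (Fin.last n)
    rw [Fin.snoc_castSucc, Fin.snoc_last]
  have hsplit : ∀ j : Fin n, (Pi.single j.castSucc 1 : Fin (n + 1) → ℝ)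
      = rows j - (gradient f u j) • Pi.single (Fin.last n) 1 := by
    intro j
    have hg : fderiv ℝ f u (EuclideanSpace.single j 1) = gradient f u j := by
      rw [← inner_gradient_left, EuclideanSpace.inner_single_right]
      simp
    funext k
    refine Fin.lastCases ?_ (fun c => ?_) k
    · simp [hrows, hfd, hg]
    · simp [hrows, hfd, Pi.single_apply]
  have hN : ∀ i, crossNormal (fun x => vpoint x (f x)) u i = φ (Pi.single i 1) := fun i => by
    rw [hφv]; rfl
  ext i
  rw [hN]
  refine Fin.lastCases ?_ (fun j => ?_) i
  · simp [hlast]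
  · rw [hsplit j, map_sub, map_smul, hrow, hlast]
    simp

/-- For `σ = -1` the first coordinate is reflected, which is where `n ≥ 1` is needed. -/
lemma exists_diagonal_isometry (hn : 1 ≤ n) {σ : ℝ} (hσ : σ = 1 ∨ σ = -1) :
    ∃ (R : Euc n ≃ₗᵢ[ℝ] Euc n) (s : Fin n → ℝ),
      (∀ j, R (EuclideanSpace.single j 1) = s j • EuclideanSpace.single j 1) ∧ ∏ j, s j = σ := by
  rcases hσ with rfl | rfl
  · exact ⟨LinearIsometryEquiv.refl ℝ _, fun _ => 1, fun j => by simp, by simp⟩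
  · let i₀ : Fin n := ⟨0, hn⟩
    refine ⟨LinearIsometryEquiv.piLpCongrRight 2 (fun j => if j = i₀ then
      LinearIsometryEquiv.neg ℝ (E := ℝ) else LinearIsometryEquiv.refl ℝ ℝ),
      fun j => if j = i₀ then -1 else 1, fun j => ?_, ?_⟩
    · ext k
      by_cases hj : k = i₀
      · subst hj
        by_cases hk : j = i₀
        · subst hk; simp
        · simp [hk, Ne.symm hk]
      · by_cases hk : j = i₀
        · subst hk; simp [hj]
        · simp [hk]
    · rw [Finset.prod_ite_eq' Finset.univ i₀ (fun _ => (-1 : ℝ))]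
      simp

lemma supportFn_smul {m : ℕ} (K : Set (Euc m)) {c : ℝ} (hc : 0 ≤ c) (x : Euc m) :
    supportFn K (c • x) = c * supportFn K x := by
  unfold supportFn
  rw [← smul_eq_mul, ← Real.sSup_smul_of_nonneg hc, ← image_smul, image_image]
  simp only [inner_smul_right, smul_eq_mul]

lemma supportFn_normalize {m : ℕ} (K : Set (Euc m)) {x : Euc m} (hx : x ≠ 0) :
    supportFn K (‖x‖⁻¹ • x) * ‖x‖ = supportFn K x := by
  rw [supportFn_smul K (inv_nonneg.2 (norm_nonneg x)), mul_comm, ← mul_assoc,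
    mul_inv_cancel₀ (norm_ne_zero_iff.2 hx), one_mul]

lemma smul_vpoint_one_ne_zero {σ : ℝ} (hσ : σ ≠ 0) (p : Euc n) : σ • vpoint p 1 ≠ 0 := by
  intro h
  have := congrArg (fun v : Euc (n + 1) => v (Fin.last n)) h
  simp [hσ] at this

end CrossNormal

/-! ### The first variation of graphs -/

section FirstVariation

variable {n : ℕ}

lemma eventually_pos_of_hasDerivAt {f : ℝ → ℝ} {f' : ℝ} (hf : HasDerivAt f f' 0) (h0 : f 0 = 0)
    (hpos : 0 < f') : ∀ᶠ τ in 𝓝[>] (0 : ℝ), 0 < f τ := by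
  have h1 := (hasDerivAt_iff_tendsto_slope.1 hf).mono_left
    (nhdsWithin_mono (0 : ℝ) (fun x hx => (ne_of_gt hx : x ≠ 0)) : 𝓝[>] (0 : ℝ) ≤ 𝓝[≠] 0)
  filter_upwards [h1.eventually (lt_mem_nhds hpos), self_mem_nhdsWithin] with τ hτ hτ0
  rw [slope_def_field, h0, sub_zero, sub_zero] at hτ
  have hτ0' : (0 : ℝ) < τ := hτ0
  exact (div_pos_iff_of_pos_right hτ0').1 hτ

/-- In `B`, the set `E` is bounded from above by the graph of `w`, which lies in the boundary of `E`
in `W`. -/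
structure IsLocalSubgraph (E W : Set (Euc (n + 1))) (B : Set (Euc n)) (w : Euc n → ℝ) (a b : ℝ) :
    Prop where
  isOpen : IsOpen B
  smooth : ContDiffOn ℝ ∞ w B
  mem : ∀ x ∈ B, vpoint x (w x) ∈ frontier E ∩ W
  mem_Ioo : ∀ x ∈ B, w x ∈ Ioo a b
  mem_of_lt : ∀ x ∈ B, ∀ t ∈ Ioo a b, t < w x → vpoint x t ∈ E
  notMem_of_lt : ∀ x ∈ B, ∀ t ∈ Ioo a b, w x < t → vpoint x t ∉ E

variable {E W : Set (Euc (n + 1))} {B : Set (Euc n)} {w : Euc n → ℝ} {a b : ℝ}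

lemma IsLocalSubgraph.differentiableAt (h : IsLocalSubgraph E W B w a b) {x : Euc n} (hx : x ∈ B) :
    DifferentiableAt ℝ w x :=
  (h.smooth.contDiffAt (h.isOpen.mem_nhds hx)).differentiableAt (by simp)

lemma IsLocalSubgraph.pointsOutOf (h : IsLocalSubgraph E W B w a b) {x : Euc n} (hx : x ∈ B) :
    PointsOutOf E (vpoint x (w x)) (vpoint (-gradient w x) 1) := by
  have hd := h.differentiableAt hx
  set v := gradient w x with hv
  have hN : ∀ t : ℝ, vpoint x (w x) + t • vpoint (-v) 1 = vpoint (x + t • -v) (w x + t) := by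
    intro t
    rw [← vpoint_smul, ← vpoint_add, mul_one]
  have hN' : ∀ t : ℝ, vpoint x (w x) - t • vpoint (-v) 1 = vpoint (x + t • v) (w x - t) := by
    intro t
    rw [sub_eq_add_neg, ← neg_smul, hN]
    congr 1; simp
  have hline : ∀ u : Euc n, HasDerivAt (fun s : ℝ => w (x + s • u)) (inner ℝ v u) 0 := by
    intro u
    have := hasDerivAt_comp_line (f := w) (a := x) (v := u) (τ := 0) (by simpa using hd)
    rwa [zero_smul, add_zero] at this
  have hev : ∀ u : Euc n, ∀ᶠ s : ℝ in 𝓝[>] 0, x + s • u ∈ B := by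
    intro u
    have : ContinuousAt (fun s : ℝ => x + s • u) 0 := by fun_prop
    exact (this.eventually_mem (by simpa using h.isOpen.mem_nhds hx)).filter_mono nhdsWithin_le_nhds
  have hI : Ioo a b ∈ 𝓝 (w x) := isOpen_Ioo.mem_nhds (h.mem_Ioo x hx)
  have hI1 : ∀ᶠ s : ℝ in 𝓝[>] 0, w x + s ∈ Ioo a b := by
    have : ContinuousAt (fun s : ℝ => w x + s) 0 := by fun_prop
    exact (this.eventually_mem (by simpa using hI)).filter_mono nhdsWithin_le_nhds
  have hI2 : ∀ᶠ s : ℝ in 𝓝[>] 0, w x - s ∈ Ioo a b := by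
    have : ContinuousAt (fun s : ℝ => w x - s) 0 := by fun_prop
    exact (this.eventually_mem (by simpa using hI)).filter_mono nhdsWithin_le_nhds
  have hsq : 0 ≤ inner ℝ v v := real_inner_self_nonneg
  -- Along `±(-∇w, 1)` the signed height above the graph changes at rate `±(1 + |∇w|²)`, so the side
  -- is decided to first order.
  have h1 := eventually_pos_of_hasDerivAt (((hasDerivAt_id (0 : ℝ)).const_add (w x)).sub
    (hline (-v))) (by simp) (by rw [inner_neg_right]; linarith)
  have h2 := eventually_pos_of_hasDerivAt ((hline v).sub ((hasDerivAt_id (0 : ℝ)).const_sub (w x)))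
    (by simp) (by linarith)
  filter_upwards [h1, h2, hev v, hev (-v), hI1, hI2] with t h1 h2 h3 h4 h5 h6
  rw [hN, hN']
  simp only [Pi.sub_apply, id, sub_pos] at h1 h2
  exact ⟨h.notMem_of_lt _ h4 _ h5 h1, h.mem_of_lt _ h3 _ h6 h2⟩

lemma PointsOutOf.compl_neg {m : ℕ} {A : Set (Euc m)} {p v : Euc m} (h : PointsOutOf A p v) :
    PointsOutOf Aᶜ p (-v) := by
  filter_upwards [h] with t ht
  rw [smul_neg, ← sub_eq_add_neg, sub_neg_eq_add]
  exact ⟨fun hc => hc ht.2, ht.1⟩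

/-- The normal of a subgraph is the outer normal of `E` and, up to sign, of its complement. -/
lemma IsLocalSubgraph.isOuterParametrization (h : IsLocalSubgraph E W B w a b) {σ : ℝ}
    {A : Set (Euc (n + 1))} (hA : (σ = 1 ∧ A = E) ∨ (σ = -1 ∧ A = Eᶜ))
    {R : Euc n ≃ₗᵢ[ℝ] Euc n} {s : Fin n → ℝ}
    (hR : ∀ j, R (EuclideanSpace.single j 1) = s j • EuclideanSpace.single j 1)
    (hs : ∏ j, s j = σ) :
    IsOuterParametrization (fun u => vpoint (R u) (w (R u))) (R ⁻¹' B) A W := by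
  have hcross : ∀ u ∈ R ⁻¹' B, crossNormal (fun u => vpoint (R u) (w (R u))) u
      = σ • vpoint (-gradient w (R u)) 1 := fun u hu => by
    rw [crossNormal_comp_linearIsometryEquiv (fun x => vpoint x (w x)) R hR, hs,
      crossNormal_graph (h.differentiableAt hu)]
  have hσ : σ ≠ 0 := by rcases hA with ⟨rfl, -⟩ | ⟨rfl, -⟩ <;> norm_num
  refine ⟨h.isOpen.preimage R.continuous, ?_, fun u hu => ?_, fun u hu => ?_, fun u hu => ?_⟩
  · have h1 : ContDiffOn ℝ ∞ (fun x => vpoint x (w x)) B :=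
      (vpointL n).contDiff.comp_contDiffOn (contDiffOn_id.prodMk h.smooth)
    exact h1.comp R.contDiff.contDiffOn fun u hu => hu
  · have := h.mem _ hu
    rcases hA with ⟨-, rfl⟩ | ⟨-, rfl⟩
    · exact this
    · rwa [frontier_compl]
  · rw [hcross u hu]
    exact smul_vpoint_one_ne_zero hσ _
  · rw [hcross u hu]
    have := h.pointsOutOf hu
    rcases hA with ⟨rfl, rfl⟩ | ⟨rfl, rfl⟩
    · rwa [one_smul]
    · rw [neg_smul, one_smul]
      exact this.compl_neg

/-- The first variation of a critical graph under vertical variations vanishes. -/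
lemma IsLocalSubgraph.hasDerivAt_integral (hn : 1 ≤ n) (h : IsLocalSubgraph E W B w a b)
    {K : Set (Euc (n + 1))} {σ : ℝ} {A : Set (Euc (n + 1))}
    (hA : (σ = 1 ∧ A = E) ∨ (σ = -1 ∧ A = Eᶜ)) (hcrit : IsOuterCritical (supportFn K) A W)
    {φ : Euc n → ℝ} (hφ : ContDiff ℝ ∞ φ) (hφc : HasCompactSupport φ) (hφB : tsupport φ ⊆ B) :
    HasDerivAt (fun t : ℝ => ∫ x in tsupport φ,
      supportFn K (σ • vpoint (-(gradient w x + t • gradient φ x)) 1)) 0 0 := by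
  obtain ⟨R, s, hR, hs⟩ := exists_diagonal_isometry hn (σ := σ)
    (hA.imp And.left And.left)
  have hσ : σ ≠ 0 := by rcases hA with ⟨rfl, -⟩ | ⟨rfl, -⟩ <;> norm_num
  set η : Euc n → Euc (n + 1) := fun u => φ (R u) • vpoint 0 1 with hη
  have hts : tsupport η = R ⁻¹' tsupport φ := by
    have h1 : Function.support η = Function.support (φ ∘ R.toHomeomorph) := by
      ext u
      have : vpoint (0 : Euc n) 1 ≠ 0 := by
        have := smul_vpoint_one_ne_zero (n := n) one_ne_zero 0
        rwa [one_smul] at this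
      simp [hη, this]
    have h2 := tsupport_comp_eq_preimage φ R.toHomeomorph
    rw [tsupport, h1]
    exact h2
  have hηc : HasCompactSupport η := by
    rw [HasCompactSupport, hts]
    exact R.toHomeomorph.isCompact_preimage.2 hφc
  have hηs : ContDiff ℝ ∞ η := (hφ.comp R.contDiff).smul contDiff_const
  have key := hcrit _ _ (h.isOuterParametrization hA hR hs) η hηs hηc
    (by rw [hts]; exact preimage_mono hφB)
  refine key.congr_of_eventuallyEq (Eventually.of_forall fun t => ?_)
  simp only [anisotropicArea]
  have hF : (fun u => vpoint (R u) (w (R u)) + t • η u)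
      = fun u => (fun x => vpoint x (w x + t * φ x)) (R u) := by
    funext u
    have h2 : t • η u = vpoint 0 (t * φ (R u)) := by
      have h3 := vpoint_smul (t * φ (R u)) (0 : Euc n) 1
      rw [smul_zero, mul_one] at h3
      rw [h3, hη, smul_smul]
    rw [h2, ← vpoint_add, add_zero]
  have hR' : MeasurePreserving R (volume : Measure (Euc n)) volume := R.measurePreserving
  rw [hF, hts, ← hR'.setIntegral_preimage_emb R.toHomeomorph.measurableEmbedding]
  refine setIntegral_congr_fun ((isClosed_tsupport φ).preimage R.continuous).measurableSet
    fun u hu => ?_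
  have hd := h.differentiableAt (hφB hu)
  have hdφ : DifferentiableAt ℝ φ (R u) := hφ.differentiable (by simp) _
  have hgrad : gradient (fun x => w x + t * φ x) (R u) = gradient w (R u) + t • gradient φ (R u) := by
    have h1 := hd.hasFDerivAt.add (hdφ.hasFDerivAt.const_mul t)
    have h2 : fderiv ℝ (fun x => w x + t * φ x) (R u) = _ := h1.fderiv
    rw [gradient, h2, map_add, map_smul]
    rfl
  have hcross : crossNormal (fun u => (fun x => vpoint x (w x + t * φ x)) (R u)) u
      = σ • vpoint (-(gradient w (R u) + t • gradient φ (R u))) 1 := by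
    rw [crossNormal_comp_linearIsometryEquiv (fun x => vpoint x (w x + t * φ x)) R hR, hs,
      crossNormal_graph (f := fun x => w x + t * φ x) (hd.add (hdφ.const_mul t)), hgrad]
  simp only [hcross]
  rw [supportFn_normalize K (smul_vpoint_one_ne_zero hσ _)]

end FirstVariation

/-! ### The Euler-Lagrange equation -/

section EulerLagrange

variable {n : ℕ}

/-- A function `f` which is continuous on the compact support of `φ` gives integrable products with
functions supported there. -/
lemma integrable_of_continuousOn_tsupport {φ f : Euc n → ℝ} (hφc : HasCompactSupport φ)
    (hf : ContinuousOn f (tsupport φ)) (h0 : ∀ x ∉ tsupport φ, f x = 0) : Integrable f :=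
  (integrableOn_iff_integrable_of_support_subset (s := tsupport φ) fun x hx => by
    by_contra hx'; exact hx (h0 x hx')).1 (hf.integrableOn_compact hφc)

lemma gradient_eq_zero_of_notMem_tsupport {φ : Euc n → ℝ} {x : Euc n} (hx : x ∉ tsupport φ) :
    gradient φ x = 0 := by
  have : fderiv ℝ φ x = 0 := by
    by_contra hne
    exact hx (support_fderiv_subset ℝ hne)
  rw [gradient, this, map_zero]

variable {H : Euc n → ℝ} {V : Euc n → Euc n} {Y₀ : Euc n} {ρ : ℝ} {w : Euc n → ℝ} {B : Set (Euc n)}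

/-- Differentiation under the integral. Compactness of the support keeps the perturbed gradients in
the ball where `H` is differentiable, for small `t`, and bounds the derivative uniformly. -/
lemma hasDerivAt_integral_gradient (hV : ContDiffOn ℝ ∞ V (Metric.ball 0 ρ))
    (hH : ∀ p ∈ Metric.ball 0 ρ, HasGradientAt H (V p - Y₀) p) (hB : IsOpen B)
    (hw : ContDiffOn ℝ ∞ w B) (hgr : ∀ x ∈ B, gradient w x ∈ Metric.ball 0 ρ)
    {φ : Euc n → ℝ} (hφ : ContDiff ℝ ∞ φ) (hφc : HasCompactSupport φ) (hφB : tsupport φ ⊆ B) :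
    HasDerivAt (fun t : ℝ => ∫ x in tsupport φ, H (gradient w x + t • gradient φ x))
      (∫ x in tsupport φ, inner ℝ (V (gradient w x) - Y₀) (gradient φ x)) 0 := by
  have hgw : ContinuousOn (gradient w) B := (hw.gradient_of_isOpen hB).continuousOn
  have hgφ : Continuous (gradient φ) :=
    continuousOn_univ.1 ((contDiffOn_univ.2 hφ).gradient_of_isOpen isOpen_univ).continuousOn
  have hHc : ContinuousOn H (Metric.ball 0 ρ) := fun p hp =>
    (hH p hp).continuousAt.continuousWithinAt
  have hmaps : ∀ t : ℝ, ContinuousOn (fun x => gradient w x + t • gradient φ x) (tsupport φ) :=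
    fun t => (hgw.mono hφB).add (hgφ.const_smul t).continuousOn
  have hev : ∀ᶠ t in 𝓝 (0 : ℝ), ∀ x ∈ tsupport φ,
      gradient w x + t • gradient φ x ∈ Metric.ball (0 : Euc n) ρ := by
    refine IsCompact.eventually_forall_of_forall_eventually hφc fun x hx => ?_
    have hc : ContinuousAt (fun p : ℝ × Euc n => gradient w p.2 + p.1 • gradient φ p.2) (0, x) := by
      refine ContinuousAt.add ?_ (continuous_fst.smul (hgφ.comp continuous_snd)).continuousAt
      exact ContinuousAt.comp (g := gradient w) (hgw.continuousAt (hB.mem_nhds (hφB hx)))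
        continuousAt_snd
    exact hc.eventually_mem (by simpa using Metric.isOpen_ball.mem_nhds (hgr x (hφB hx)))
  obtain ⟨ε, hε, hball⟩ := Metric.eventually_nhds_iff_ball.1 hev
  have hin : ∀ t ∈ Icc (-(ε / 2)) (ε / 2), ∀ x ∈ tsupport φ,
      gradient w x + t • gradient φ x ∈ Metric.ball (0 : Euc n) ρ := fun t ht => hball t (by
    rw [Real.ball_eq_Ioo]; constructor <;> linarith [ht.1, ht.2])
  have hjoint : ContinuousOn (fun p : ℝ × Euc n =>
      inner ℝ (V (gradient w p.2 + p.1 • gradient φ p.2) - Y₀) (gradient φ p.2))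
      (Icc (-(ε / 2)) (ε / 2) ×ˢ tsupport φ) := by
    refine ContinuousOn.inner (ContinuousOn.sub (hV.continuousOn.comp ?_ fun p hp =>
      hin p.1 hp.1 p.2 hp.2) continuousOn_const) (hgφ.comp continuous_snd).continuousOn
    exact ((hgw.mono hφB).comp continuousOn_snd fun p hp => hp.2).add
      (continuous_fst.smul (hgφ.comp continuous_snd)).continuousOn
  obtain ⟨C, hC⟩ := (isCompact_Icc.prod hφc).exists_bound_of_continuousOn hjoint
  have hmeas : MeasurableSet (tsupport φ) := (isClosed_tsupport φ).measurableSet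
  have hfin : volume (tsupport φ) < ⊤ := IsCompact.measure_lt_top hφc
  have hs : Icc (-(ε / 2)) (ε / 2) ∈ 𝓝 (0 : ℝ) := Icc_mem_nhds (by linarith) (by linarith)
  have h0 : (0 : ℝ) ∈ Icc (-(ε / 2)) (ε / 2) := mem_of_mem_nhds hs
  have hHt : ∀ t ∈ Icc (-(ε / 2)) (ε / 2),
      ContinuousOn (fun x => H (gradient w x + t • gradient φ x)) (tsupport φ) := fun t ht =>
    hHc.comp (hmaps t) (hin t ht)
  have key := hasDerivAt_integral_of_dominated_loc_of_deriv_le (μ := volume.restrict (tsupport φ))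
    (F := fun t x => H (gradient w x + t • gradient φ x))
    (F' := fun t x => inner ℝ (V (gradient w x + t • gradient φ x) - Y₀) (gradient φ x))
    (bound := fun _ => C) (x₀ := (0 : ℝ)) hs
    (Filter.eventually_of_mem hs fun t ht => (hHt t ht).aestronglyMeasurable hmeas)
    ((hHt 0 h0).integrableOn_compact hφc)
    ((hjoint.comp (by fun_prop : ContinuousOn (fun x : Euc n => ((0 : ℝ), x)) (tsupport φ))
      fun x hx => ⟨h0, hx⟩).aestronglyMeasurable hmeas)
    ((ae_restrict_iff' hmeas).2 (Eventually.of_forall fun x hx t ht => hC (t, x) ⟨ht, hx⟩))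
    (integrableOn_const hfin.ne)
    ((ae_restrict_iff' hmeas).2 (Eventually.of_forall fun x hx t ht => by
      have h1 := (hasGradientAt_iff_hasFDerivAt.1 (hH _ (hin t ht x hx)))
      have h2 : HasDerivAt (fun s : ℝ => gradient w x + s • gradient φ x) (gradient φ x) t := by
        simpa using ((hasDerivAt_id t).smul_const (gradient φ x)).const_add (gradient w x)
      exact h1.comp_hasDerivAt t h2))
  simpa using key.2

/-- Integration by parts turns the vanishing first variation into `∫ φ div V(∇w) = 0`, and the
constant `Y₀` drops out. The fundamental lemma gives the equation almost everywhere, and continuity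
gives it everywhere. -/
lemma trace_fderiv_comp_gradient_eq_zero (hV : ContDiffOn ℝ ∞ V (Metric.ball 0 ρ))
    (hH : ∀ p ∈ Metric.ball 0 ρ, HasGradientAt H (V p - Y₀) p) (hB : IsOpen B)
    (hw : ContDiffOn ℝ ∞ w B) (hgr : ∀ x ∈ B, gradient w x ∈ Metric.ball 0 ρ)
    (hcrit : ∀ φ : Euc n → ℝ, ContDiff ℝ ∞ φ → HasCompactSupport φ → tsupport φ ⊆ B →
      HasDerivAt (fun t : ℝ => ∫ x in tsupport φ, H (gradient w x + t • gradient φ x)) 0 0) :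
    ∀ x ∈ B, LinearMap.trace ℝ (Euc n) (fderiv ℝ (fun y => V (gradient w y)) x).toLinearMap = 0 := by
  have hZ : ContDiffOn ℝ ∞ (fun y => V (gradient w y)) B :=
    hV.comp (hw.gradient_of_isOpen hB) hgr
  have hZd : ∀ x ∈ B, DifferentiableAt ℝ (fun y => V (gradient w y)) x := fun x hx =>
    (hZ.contDiffAt (hB.mem_nhds hx)).differentiableAt (by simp)
  have hZ' : ContinuousOn (fderiv ℝ (fun y => V (gradient w y))) B :=
    hZ.continuousOn_fderiv_of_isOpen hB (by simp)
  set e : Fin n → Euc n := fun i => EuclideanSpace.single i 1 with he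
  set div : Euc n → ℝ := fun x => ∑ i, fderiv ℝ (fun y => V (gradient w y)) x (e i) i with hdiv
  have htrace : ∀ x, LinearMap.trace ℝ (Euc n)
      (fderiv ℝ (fun y => V (gradient w y)) x).toLinearMap = div x := by
    intro x
    rw [LinearMap.trace_eq_sum_inner _ (EuclideanSpace.basisFun (Fin n) ℝ), hdiv]
    refine Finset.sum_congr rfl fun i _ => ?_
    rw [EuclideanSpace.basisFun_apply, EuclideanSpace.inner_single_left]
    simp [he]
  have hdivc : ContinuousOn div B := by
    refine continuousOn_finsetSum _ fun i _ => ?_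
    exact (EuclideanSpace.proj i : Euc n →L[ℝ] ℝ).continuous.comp_continuousOn
      (hZ'.clm_apply continuousOn_const)
  have hint : ∀ φ : Euc n → ℝ, ContDiff ℝ ∞ φ → HasCompactSupport φ → tsupport φ ⊆ B →
      ∫ x, φ x • div x = 0 := by
    intro φ hφ hφc hφB
    have hφd : ∀ x, DifferentiableAt ℝ φ x := hφ.differentiable (by simp)
    have hφ' : Continuous (fderiv ℝ φ) := hφ.continuous_fderiv (by simp)
    have h0 := (hasDerivAt_integral_gradient hV hH hB hw hgr hφ hφc hφB).unique
      (hcrit φ hφ hφc hφB)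
    have hZi : ∀ i, ∀ x ∈ B, HasFDerivAt (fun y => V (gradient w y) i - Y₀ i)
        ((EuclideanSpace.proj i : Euc n →L[ℝ] ℝ) ∘L fderiv ℝ (fun y => V (gradient w y)) x) x :=
      fun i x hx => ((EuclideanSpace.proj i : Euc n →L[ℝ] ℝ).hasFDerivAt.comp x
        (hZd x hx).hasFDerivAt).sub_const _
    have hZic : ∀ i, ContinuousOn (fun y => V (gradient w y) i - Y₀ i) (tsupport φ) :=
      fun i x hx => (hZi i x (hφB hx)).continuousAt.continuousWithinAt
    have hφ0 : ∀ x ∉ tsupport φ, φ x = 0 := fun x hx => image_eq_zero_of_notMem_tsupport hx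
    have hφ0' : ∀ x ∉ tsupport φ, fderiv ℝ φ x = 0 := fun x hx => by
      by_contra hne
      exact hx (support_fderiv_subset ℝ hne)
    have hZ'c : ∀ i, ContinuousOn
        (fun x => fderiv ℝ (fun y => V (gradient w y) i - Y₀ i) x (e i)) (tsupport φ) := by
      intro i
      have h1 : ContinuousOn (fun x => fderiv ℝ (fun y => V (gradient w y)) x (e i) i)
          (tsupport φ) := (EuclideanSpace.proj i : Euc n →L[ℝ] ℝ).continuous.comp_continuousOn
        ((hZ'.mono hφB).clm_apply continuousOn_const)
      refine h1.congr fun x hx => ?_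
      rw [(hZi i x (hφB hx)).fderiv]
      rfl
    have hI1 : ∀ i, Integrable (fun x => (V (gradient w x) i - Y₀ i) * fderiv ℝ φ x (e i)) :=
      fun i => integrable_of_continuousOn_tsupport hφc
        ((hZic i).mul (hφ'.clm_apply continuous_const).continuousOn)
        fun x hx => by rw [hφ0' x hx]; simp
    have hI2 : ∀ i, Integrable
        (fun x => fderiv ℝ (fun y => V (gradient w y) i - Y₀ i) x (e i) * φ x) := fun i =>
      integrable_of_continuousOn_tsupport hφc ((hZ'c i).mul hφ.continuous.continuousOn)
        fun x hx => by rw [hφ0 x hx, mul_zero]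
    have hparts : ∀ i, ∫ x, (V (gradient w x) i - Y₀ i) * fderiv ℝ φ x (e i)
        = -∫ x, fderiv ℝ (fun y => V (gradient w y) i - Y₀ i) x (e i) * φ x := fun i =>
      integral_mul_fderiv_eq_neg_fderiv_mul_of_integrable (hI2 i) (hI1 i)
        (integrable_of_continuousOn_tsupport hφc ((hZic i).mul hφ.continuous.continuousOn)
          fun x hx => by rw [hφ0 x hx, mul_zero])
        (fun x hx => (hZi i x (hφB hx)).differentiableAt) fun x _ => hφd x
    have hL : ∫ x in tsupport φ, inner ℝ (V (gradient w x) - Y₀) (gradient φ x)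
        = ∑ i, ∫ x, (V (gradient w x) i - Y₀ i) * fderiv ℝ φ x (e i) := by
      rw [← integral_finsetSum _ fun i _ => hI1 i, setIntegral_eq_integral_of_forall_compl_eq_zero]
      · refine integral_congr_ae (Eventually.of_forall fun x => ?_)
        simp only [PiLp.inner_apply]
        refine Finset.sum_congr rfl fun i _ => ?_
        have : fderiv ℝ φ x (e i) = gradient φ x i := by
          rw [← inner_gradient_left, he, EuclideanSpace.inner_single_right]
          simp
        rw [this]
        simp [mul_comm]
      · intro x hx
        rw [gradient_eq_zero_of_notMem_tsupport hx, inner_zero_right]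
    have hR : ∫ x, φ x • div x
        = ∑ i, ∫ x, fderiv ℝ (fun y => V (gradient w y) i - Y₀ i) x (e i) * φ x := by
      rw [← integral_finsetSum _ fun i _ => hI2 i]
      refine integral_congr_ae (Eventually.of_forall fun x => ?_)
      simp only [smul_eq_mul, hdiv]
      rw [Finset.mul_sum]
      refine Finset.sum_congr rfl fun i _ => ?_
      by_cases hx : x ∈ tsupport φ
      · rw [(hZi i x (hφB hx)).fderiv, mul_comm]
        rfl
      · rw [hφ0 x hx]; simp
    rw [hL] at h0
    simp only [hparts] at h0
    rw [hR]
    rw [Finset.sum_neg_distrib] at h0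
    linarith
  have hae := hB.ae_eq_zero_of_integral_contDiff_smul_eq_zero
    (hdivc.locallyIntegrableOn hB.measurableSet) hint
  have heq := Measure.eqOn_open_of_ae_eq (f := div) (g := fun _ => 0) (μ := volume)
    ((ae_restrict_iff' hB.measurableSet).2 hae) hB hdivc continuousOn_const
  intro x hx
  rw [htrace]
  exact heq hx

/-- The Euler-Lagrange equation of a critical graph. -/
lemma IsLocalSubgraph.trace_eq_zero (hn : 1 ≤ n) {E W A : Set (Euc (n + 1))} {a b : ℝ}
    (h : IsLocalSubgraph E W B w a b) {K : Set (Euc (n + 1))} {σ : ℝ}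
    (hA : (σ = 1 ∧ A = E) ∨ (σ = -1 ∧ A = Eᶜ)) (hcrit : IsOuterCritical (supportFn K) A W)
    {k : Euc n → ℝ} {r lo hi : ℝ}
    (hL : IsLegendrePair (fun p => supportFn K (σ • vpoint (-p) 1)) V k Y₀ ρ r lo hi)
    (hgr : ∀ x ∈ B, gradient w x ∈ Metric.ball 0 ρ) :
    ∀ x ∈ B, LinearMap.trace ℝ (Euc n) (fderiv ℝ (fun y => V (gradient w y)) x).toLinearMap = 0 :=
  trace_fderiv_comp_gradient_eq_zero hL.smooth_V hL.grad_H h.isOpen h.smooth hgr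
    fun _ hφ hφc hφB => h.hasDerivAt_integral hn hA hcrit hφ hφc hφB

end EulerLagrange

/-! ### Touching a critical hypersurface from below -/

section Touching

variable {n : ℕ}

/-- The boundary of `E` in the unit cylinder is a smooth hypersurface away from the bottom, `E` lies
below its lowest sheet, and graphs with small gradient in it solve `div (V (∇w)) = 0`. -/
structure IsCriticalAboveBottom (E : Set (Euc (n + 1))) (V : Euc n → Euc n) (ρ : ℝ) : Prop where
  smooth : HasSmoothBoundaryIn E (unitCylinder n)
  bottom : ∀ x ∈ Metric.ball (0 : Euc n) 1, vpoint x 0 ∉ closure (frontier E ∩ unitCylinder n)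
  bottomIn : BottomIn E
  trace_eq_zero : ∀ (B : Set (Euc n)) (w : Euc n → ℝ) (a b : ℝ),
    IsLocalSubgraph E (unitCylinder n) B w a b → (∀ x ∈ B, gradient w x ∈ Metric.ball 0 ρ) →
    ∀ x ∈ B, LinearMap.trace ℝ (Euc n) (fderiv ℝ (fun y => V (gradient w y)) x).toLinearMap = 0

variable {E : Set (Euc (n + 1))} {V : Euc n → Euc n} {ρ : ℝ}

/-- The common engine of both sliding arguments. `w - q` has a local minimum at `x₀`, which yields
equal gradients and ordered Hessians. The gradient bound on `q` then holds for `w` nearby, so the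
Euler-Lagrange equation applies, here in nondivergence form. -/
lemma IsCriticalAboveBottom.exists_graph (h : IsCriticalAboveBottom E V ρ)
    (hV : ContDiffOn ℝ ∞ V (Metric.ball 0 ρ)) {q : Euc n → ℝ} {x₀ : Euc n}
    (hp : vpoint x₀ (q x₀) ∈ frontier E ∩ unitCylinder n) {O : Set (Euc n)} (hO : IsOpen O)
    (hx₀ : x₀ ∈ O) (hq : ContDiffOn ℝ ∞ q O) (hqρ : gradient q x₀ ∈ Metric.ball 0 ρ)
    (htouch : ∀ x ∈ O, ∀ t, vpoint x t ∈ frontier E ∩ unitCylinder n → q x ≤ t)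
    {w : Euc n → ℝ} (hw : w = lowestHeight (frontier E ∩ unitCylinder n)) :
    ∃ r > 0, Metric.ball x₀ r ⊆ O ∧ ContDiffOn ℝ ∞ w (Metric.ball x₀ r) ∧ w x₀ = q x₀ ∧
      gradient w x₀ = gradient q x₀ ∧
      (∀ x ∈ Metric.ball x₀ r, vpoint x (w x) ∈ frontier E ∩ unitCylinder n ∧
        ∀ t, vpoint x t ∈ frontier E ∩ unitCylinder n → w x ≤ t) ∧
      (∀ ξ η, inner ℝ ((fderiv ℝ (gradient w) x₀ - fderiv ℝ (gradient q) x₀) ξ) η =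
        inner ℝ ((fderiv ℝ (gradient w) x₀ - fderiv ℝ (gradient q) x₀) η) ξ) ∧
      (∀ ξ, 0 ≤ inner ℝ ((fderiv ℝ (gradient w) x₀ - fderiv ℝ (gradient q) x₀) ξ) ξ) ∧
      LinearMap.trace ℝ (Euc n) (fderiv ℝ V (gradient w x₀) ∘L
        fderiv ℝ (gradient w) x₀ : Euc n →L[ℝ] Euc n).toLinearMap = 0 := by
  have hqd : DifferentiableAt ℝ q x₀ :=
    (hq.contDiffAt (hO.mem_nhds hx₀)).differentiableAt (by simp)
  obtain ⟨r₁, hr₁, b, hsub, hws, hw0, hall⟩ := exists_graph_of_touching h.smooth h.bottom h.bottomIn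
    hp (hO.mem_nhds hx₀) hqd htouch
  rw [← hw] at hws hw0 hall
  have hx₁ : x₀ ∈ Metric.ball x₀ r₁ := Metric.mem_ball_self hr₁
  have hwd : DifferentiableAt ℝ w x₀ :=
    (hws.contDiffAt (Metric.isOpen_ball.mem_nhds hx₁)).differentiableAt (by simp)
  have hgw := hws.gradient_of_isOpen Metric.isOpen_ball
  have hdiff : ContDiffOn ℝ ∞ (fun x => w x - q x) (Metric.ball x₀ r₁) := hws.sub (hq.mono hsub)
  have hmin : IsLocalMin (fun x => w x - q x) x₀ := by
    filter_upwards [Metric.isOpen_ball.mem_nhds hx₁] with x hx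
    have := htouch x (hsub hx) _ (hall x hx).1
    rw [hw0]
    linarith
  have hgsub : ∀ x ∈ Metric.ball x₀ r₁,
      gradient (fun x => w x - q x) x = gradient w x - gradient q x := by
    intro x hx
    have h1 := (hws.contDiffAt (Metric.isOpen_ball.mem_nhds hx)).differentiableAt (by simp)
    have h2 := (hq.contDiffAt (hO.mem_nhds (hsub hx))).differentiableAt (by simp)
    rw [gradient, fderiv_fun_sub h1 h2, map_sub, gradient, gradient]
  have hgrad : gradient w x₀ = gradient q x₀ := by
    have h1 := hgsub x₀ hx₁
    rw [gradient, hmin.fderiv_eq_zero, map_zero] at h1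
    exact (sub_eq_zero.1 h1.symm)
  have hDw : DifferentiableAt ℝ (gradient w) x₀ :=
    (hgw.contDiffAt (Metric.isOpen_ball.mem_nhds hx₁)).differentiableAt (by simp)
  have hDq : DifferentiableAt ℝ (gradient q) x₀ :=
    ((hq.gradient_of_isOpen hO).contDiffAt (hO.mem_nhds hx₀)).differentiableAt (by simp)
  have hP : fderiv ℝ (gradient (fun x => w x - q x)) x₀
      = fderiv ℝ (gradient w) x₀ - fderiv ℝ (gradient q) x₀ := by
    rw [← fderiv_fun_sub hDw hDq]
    refine Filter.EventuallyEq.fderiv_eq ?_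
    filter_upwards [Metric.isOpen_ball.mem_nhds hx₁] with x hx using hgsub x hx
  have hev : ∀ᶠ x in 𝓝 x₀, x ∈ Metric.ball x₀ r₁ ∧ gradient w x ∈ Metric.ball (0 : Euc n) ρ :=
    (Metric.isOpen_ball.eventually_mem hx₁).and
      ((hgw.continuousOn.continuousAt (Metric.isOpen_ball.mem_nhds hx₁)).eventually_mem
        (by rw [hgrad]; exact Metric.isOpen_ball.mem_nhds hqρ))
  obtain ⟨r, hr, hball⟩ := Metric.eventually_nhds_iff_ball.1 hev
  have hsub1 : Metric.ball x₀ r ⊆ Metric.ball x₀ r₁ := fun x hx => (hball x hx).1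
  have hx₂ : x₀ ∈ Metric.ball x₀ r := Metric.mem_ball_self hr
  have hsg : IsLocalSubgraph E (unitCylinder n) (Metric.ball x₀ r) w (q x₀ - b) (q x₀ + b) :=
    ⟨Metric.isOpen_ball, hws.mono hsub1, fun x hx => (hall x (hsub1 hx)).1,
      fun x hx => (hall x (hsub1 hx)).2.2.1, fun x hx t ht => ((hall x (hsub1 hx)).2.2.2 t ht).1,
      fun x hx t ht => ((hall x (hsub1 hx)).2.2.2 t ht).2⟩
  have htr := h.trace_eq_zero _ _ _ _ hsg (fun x hx => (hball x hx).2) x₀ hx₂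
  have hVd : DifferentiableAt ℝ V (gradient w x₀) :=
    (hV.contDiffAt (Metric.isOpen_ball.mem_nhds (hball x₀ hx₂).2)).differentiableAt (by simp)
  have hchain : fderiv ℝ (fun y => V (gradient w y)) x₀
      = fderiv ℝ V (gradient w x₀) ∘L fderiv ℝ (gradient w) x₀ := fderiv_comp x₀ hVd hDw
  rw [hchain] at htr
  refine ⟨r, hr, hsub1.trans hsub, hws.mono hsub1, hw0, hgrad,
    fun x hx => ⟨(hall x (hsub1 hx)).1, (hall x (hsub1 hx)).2.1⟩, ?_, ?_, htr⟩
  · rw [← hP]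
    exact inner_fderiv_gradient_comm hdiff Metric.isOpen_ball hx₁
  · rw [← hP]
    exact hmin.inner_fderiv_gradient_nonneg hdiff Metric.isOpen_ball hx₁

end Touching

/-! ### The barrier -/

section Barrier

variable {n : ℕ}

lemma hasGradientAt_gaussian (a m c : ℝ) (z x : Euc n) :
    HasGradientAt (fun x : Euc n => a * Real.exp (-m * ‖x - z‖ ^ 2) + c)
      ((-2 * m * a * Real.exp (-m * ‖x - z‖ ^ 2)) • (x - z)) x := by
  rw [hasGradientAt_iff_hasFDerivAt]
  have h1 : HasFDerivAt (fun x : Euc n => ‖x - z‖ ^ 2) _ x :=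
    ((hasFDerivAt_id x).sub_const z).norm_sq
  have h2 := (((h1.const_mul (-m)).exp).const_mul a).add_const c
  refine h2.congr_fderiv ?_
  ext ξ
  simp
  ring

/-- The radial rank-one term carries an extra factor `m`, so for large `m` and away from `z` it
outweighs the negative multiple of the identity. This makes the Gaussian a strict subsolution. -/
lemma fderiv_gradient_gaussian (a m c : ℝ) (z x : Euc n) :
    fderiv ℝ (gradient (fun x : Euc n => a * Real.exp (-m * ‖x - z‖ ^ 2) + c)) x =
      (-2 * m * a * Real.exp (-m * ‖x - z‖ ^ 2)) • ContinuousLinearMap.id ℝ (Euc n) +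
      (4 * m ^ 2 * a * Real.exp (-m * ‖x - z‖ ^ 2)) •
        InnerProductSpace.rankOne ℝ (x - z) (x - z) := by
  have hg : gradient (fun x : Euc n => a * Real.exp (-m * ‖x - z‖ ^ 2) + c)
      = fun x => (-2 * m * a * Real.exp (-m * ‖x - z‖ ^ 2)) • (x - z) := by
    funext y
    exact (hasGradientAt_gaussian a m c z y).gradient
  rw [hg]
  have h1 : HasFDerivAt (fun x : Euc n => ‖x - z‖ ^ 2) _ x :=
    ((hasFDerivAt_id x).sub_const z).norm_sq
  have h2 := ((h1.const_mul (-m)).exp).const_mul (-2 * m * a)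
  have h3 := h2.smul ((hasFDerivAt_id x).sub_const z)
  have h4 : HasFDerivAt (fun x : Euc n => (-2 * m * a * Real.exp (-m * ‖x - z‖ ^ 2)) • (x - z)) _ x :=
    h3
  rw [h4.fderiv]
  ext1 ξ
  simp only [id, add_apply, smul_apply, ContinuousLinearMap.id_apply,
    ContinuousLinearMap.smulRight_apply, ContinuousLinearMap.comp_apply, innerSL_apply_apply,
    InnerProductSpace.rankOne_apply, smul_smul, smul_eq_mul, nsmul_eq_mul]
  congr 2
  push_cast
  ring

lemma trace_le_of_inner_le {M : Euc n →L[ℝ] Euc n} {hi : ℝ}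
    (hM : ∀ ξ, inner ℝ (M ξ) ξ ≤ hi * ‖ξ‖ ^ 2) :
    LinearMap.trace ℝ (Euc n) M.toLinearMap ≤ n * hi := by
  rw [LinearMap.trace_eq_sum_inner _ (EuclideanSpace.basisFun (Fin n) ℝ)]
  calc _ ≤ ∑ _i : Fin n, hi := by
        refine Finset.sum_le_sum fun i _ => ?_
        have := hM (EuclideanSpace.basisFun (Fin n) ℝ i)
        rw [real_inner_comm] at this
        simpa using this
    _ = n * hi := by simp

lemma trace_comp_id_add_rankOne (M : Euc n →L[ℝ] Euc n) (α β : ℝ) (y : Euc n) :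
    LinearMap.trace ℝ (Euc n) (M ∘L (α • ContinuousLinearMap.id ℝ (Euc n) +
      β • InnerProductSpace.rankOne ℝ y y) : Euc n →L[ℝ] Euc n).toLinearMap
      = α * LinearMap.trace ℝ (Euc n) M.toLinearMap + β * inner ℝ (M y) y := by
  have : (M ∘L (α • ContinuousLinearMap.id ℝ (Euc n) +
      β • InnerProductSpace.rankOne ℝ y y) : Euc n →L[ℝ] Euc n).toLinearMap
      = α • M.toLinearMap + β • (InnerProductSpace.rankOne ℝ (M y) y).toLinearMap := by
    ext1 ξ
    simp
  rw [this, map_add, map_smul, map_smul, InnerProductSpace.trace_rankOne, smul_eq_mul, smul_eq_mul,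
    real_inner_comm]

variable {H : Euc n → ℝ} {V : Euc n → Euc n} {k : Euc n → ℝ} {Y₀ : Euc n} {ρ r lo hi : ℝ}

/-- A critical hypersurface close to the bottom at the origin is close to the bottom in every small
ball. -/
lemma IsLegendrePair.exists_low_point (hL : IsLegendrePair H V k Y₀ ρ r lo hi) {δ ε' : ℝ}
    (hδ : 0 < δ) (hε' : 0 < ε') :
    ∃ ε₀ > 0, ∀ E : Set (Euc (n + 1)), IsCriticalAboveBottom E V ρ → ∀ ε < ε₀,
      vpoint (0 : Euc n) ε ∈ frontier E ∩ unitCylinder n →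
      ∀ z ∈ Metric.ball (0 : Euc n) (1 / 3), ∃ x t, dist x z ≤ δ ∧ t < ε' ∧
        vpoint x t ∈ frontier E ∩ unitCylinder n := by
  have hlo := hL.lo_pos
  have hhi := hL.hi_pos
  -- This gives `2 m lo δ² = 2(n+1) hi > n hi ≥ tr DV`, so the barrier is a strict subsolution
  -- wherever `|x - z| ≥ δ`.
  set m : ℝ := (n + 1) * hi / (lo * δ ^ 2) with hm
  have hmpos : 0 < m := by positivity
  have hmδ : m * (lo * δ ^ 2) = (n + 1) * hi := by rw [hm]; field_simp
  -- The three bounds keep the barrier below `ε'` on the inner sphere, the contact away from the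
  -- top, and the barrier's gradient less than `ρ`.
  obtain ⟨a, ha0, ha⟩ : ∃ a, 0 < a ∧ a < min ε' (min (1 / 2) (ρ / m)) :=
    exists_between (lt_min hε' (lt_min (by norm_num) (div_pos hL.ρ_pos hmpos)))
  simp only [lt_min_iff] at ha
  obtain ⟨haε, ha2, haρ⟩ := ha
  rw [lt_div_iff₀ hmpos] at haρ
  -- The barrier vanishes on the outer sphere `|x - z| = 1/2`. At the origin, where `|z| < 1/3`, it
  -- is at least the positive number `hgap`.
  set c₀ : ℝ := -(a * Real.exp (-m / 4)) with hc₀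
  set ψ : Euc n → Euc n → ℝ := fun z x => a * Real.exp (-m * ‖x - z‖ ^ 2) + c₀ with hψ
  have hψa : ∀ z x, ψ z x ≤ a := by
    intro z x
    have h1 : Real.exp (-m * ‖x - z‖ ^ 2) ≤ 1 := Real.exp_le_one_iff.2 (by
      have : 0 ≤ m * ‖x - z‖ ^ 2 := by positivity
      linarith)
    have h2 : 0 < a * Real.exp (-m / 4) := by positivity
    have h3 := mul_le_mul_of_nonneg_left h1 ha0.le
    simp only [hψ, hc₀]
    linarith
  have hgap : 0 < a * Real.exp (-m / 9) + c₀ := by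
    have : Real.exp (-m / 4) < Real.exp (-m / 9) := Real.exp_lt_exp.2 (by linarith)
    have := mul_lt_mul_of_pos_left this ha0
    rw [hc₀]; linarith
  refine ⟨min ε' (a * Real.exp (-m / 9) + c₀), lt_min hε' hgap, fun E hE ε hε h0 z hz => ?_⟩
  rw [lt_min_iff] at hε
  rw [mem_ball_zero_iff] at hz
  by_contra! hno
  -- Otherwise the given point over the origin is already the required low point.
  have hzδ : δ < ‖z‖ := by
    by_contra! hle
    exact hno 0 ε (by simpa using hle) hε.1 h0
  set D : Set (Euc n) := Metric.closedBall z (1 / 2) \ Metric.ball z δ with hD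
  have hDc : IsCompact D := (isCompact_closedBall z (1 / 2)).diff Metric.isOpen_ball
  have hDmem : ∀ x, x ∈ D ↔ ‖x - z‖ ≤ 1 / 2 ∧ δ ≤ ‖x - z‖ := by
    intro x
    simp [hD, dist_eq_norm]
  have hD1 : D ⊆ Metric.ball 0 1 := by
    intro x hx
    rw [mem_ball_zero_iff]
    have h1 := ((hDmem x).1 hx).1
    have h2 := norm_le_norm_add_norm_sub' x z
    linarith
  have h0D : (0 : Euc n) ∈ D := (hDmem 0).2 (by
    rw [zero_sub, norm_neg]; constructor <;> linarith)
  have hψs : ContDiff ℝ ∞ (ψ z) := by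
    have : ContDiff ℝ ∞ fun x : Euc n => ‖x - z‖ ^ 2 := (contDiff_id.sub contDiff_const).norm_sq ℝ
    exact (contDiff_const.mul (Real.contDiff_exp.comp (contDiff_const.mul this))).add contDiff_const
  have hψ0 : ε < ψ z 0 := by
    refine hε.2.trans_le ?_
    simp only [hψ, zero_sub, norm_neg]
    have h1 : Real.exp (-m / 9) ≤ Real.exp (-m * ‖z‖ ^ 2) := by
      refine Real.exp_le_exp.2 ?_
      have : ‖z‖ ^ 2 ≤ (1 / 3) ^ 2 := by gcongr
      nlinarith
    have := mul_le_mul_of_nonneg_left h1 ha0.le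
    linarith
  obtain ⟨x₀, hx₀D, t₀, hp, hmin⟩ := exists_lowest_contact hE.bottom hDc hD1
    hψs.continuous.continuousOn h0D h0 (b := 1 / 2) (by norm_num) (fun x _ => by
      have := hψa z x
      linarith)
  have hneg : t₀ - ψ z x₀ < 0 := (hmin 0 h0D ε h0).trans_lt (by linarith)
  have ht₀ : 0 < t₀ := (vpoint_mem_solidCylinder.1 hp.2).2.1
  have hx₀ := (hDmem x₀).1 hx₀D
  -- The barrier had to be lowered to touch. Contact on the outer sphere would have negative height,
  -- and contact on the inner sphere height below `a < ε'`, so it happens inside the annulus.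
  have hx₀1 : ‖x₀ - z‖ < 1 / 2 := by
    refine lt_of_le_of_ne hx₀.1 fun heq => ?_
    have : ψ z x₀ = 0 := by
      simp only [hψ, hc₀, heq]
      have : -m * (1 / 2 : ℝ) ^ 2 = -m / 4 := by ring
      rw [this]; ring
    linarith
  have hx₀2 : δ < ‖x₀ - z‖ := by
    refine lt_of_le_of_ne hx₀.2 fun heq => ?_
    by_cases hlt : t₀ < ε'
    · exact hno x₀ t₀ (by rw [dist_eq_norm, ← heq]) hlt hp
    · have := hψa z x₀
      linarith
  set c := c₀ + (t₀ - ψ z x₀) with hc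
  set q : Euc n → ℝ := fun x => a * Real.exp (-m * ‖x - z‖ ^ 2) + c with hq
  have hqψ : ∀ x, q x = ψ z x + (t₀ - ψ z x₀) := fun x => by
    simp only [hq, hψ, hc]; ring
  have hqx₀ : q x₀ = t₀ := by rw [hqψ]; ring
  set O : Set (Euc n) := Metric.ball z (1 / 2) \ Metric.closedBall z δ with hO
  have hOo : IsOpen O := Metric.isOpen_ball.sdiff Metric.isClosed_closedBall
  have hOD : O ⊆ D := fun x hx => ⟨Metric.ball_subset_closedBall hx.1,
    fun h => hx.2 (Metric.ball_subset_closedBall h)⟩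
  have hx₀O : x₀ ∈ O := ⟨by rwa [mem_ball_iff_norm], by
    rw [mem_closedBall_iff_norm, not_le]; exact hx₀2⟩
  have hqs : ContDiffOn ℝ ∞ q O := by
    have : q = fun x => ψ z x + (t₀ - ψ z x₀) := funext hqψ
    rw [this]
    exact (hψs.add contDiff_const).contDiffOn
  set e : ℝ := Real.exp (-m * ‖x₀ - z‖ ^ 2) with he
  have he0 : 0 < e := Real.exp_pos _
  have he1 : e ≤ 1 := Real.exp_le_one_iff.2 (by
    have : 0 ≤ m * ‖x₀ - z‖ ^ 2 := by positivity
    linarith)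
  have hgq : gradient q x₀ = (-2 * m * a * e) • (x₀ - z) :=
    (hasGradientAt_gaussian a m c z x₀).gradient
  have hgρ : gradient q x₀ ∈ Metric.ball (0 : Euc n) ρ := by
    rw [mem_ball_zero_iff, hgq, norm_smul, Real.norm_eq_abs,
      show -2 * m * a * e = -(2 * m * a * e) by ring, abs_neg, abs_of_pos (by positivity)]
    calc 2 * m * a * e * ‖x₀ - z‖ ≤ 2 * m * a * 1 * (1 / 2) := by gcongr
      _ = a * m := by ring
      _ < ρ := haρ
  obtain ⟨s, hs, -, -, -, hgrad, -, hPs, hPp, htr⟩ := hE.exists_graph hL.smooth_V (q := q)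
    (by rw [hqx₀]; exact hp) hOo hx₀O hqs hgρ (fun x hx t ht => by
      have := hmin x (hOD hx) t ht
      rw [hqψ]; linarith) rfl
  rw [hgrad] at htr
  set M := fderiv ℝ V (gradient q x₀) with hM
  -- As `tr(M D²w) = 0`, this says `tr(M D²q) ≤ 0`, contrary to the choice of `m`.
  have hMP := trace_comp_nonneg (hL.symm_V _ hgρ)
    (fun ξ => (by positivity : (0:ℝ) ≤ lo * ‖ξ‖ ^ 2).trans (hL.lo_V _ hgρ ξ)) hPs hPp
  rw [ContinuousLinearMap.comp_sub, ContinuousLinearMap.toLinearMap_sub, map_sub, htr,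
    fderiv_gradient_gaussian, trace_comp_id_add_rankOne, ← he] at hMP
  have h1 : LinearMap.trace ℝ (Euc n) M.toLinearMap ≤ n * hi :=
    trace_le_of_inner_le (hL.hi_V _ hgρ)
  have h2 : lo * δ ^ 2 ≤ inner ℝ (M (x₀ - z)) (x₀ - z) := by
    refine le_trans ?_ (hL.lo_V _ hgρ _)
    gcongr
  have h3 : 0 < 2 * m * a * e := by positivity
  have h4 : 2 * m * (lo * δ ^ 2) ≤ 2 * m * inner ℝ (M (x₀ - z)) (x₀ - z) := by gcongr
  have h5 : 0 < 2 * m * inner ℝ (M (x₀ - z)) (x₀ - z) - LinearMap.trace ℝ (Euc n) M.toLinearMap := by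
    have : 0 ≤ (n : ℝ) * hi := by positivity
    nlinarith
  have h6 := mul_pos h3 h5
  nlinarith

end Barrier

/-! ### The contact set -/

section ContactSet

variable {n : ℕ}

lemma measurableSet_inter_abs_le_one {G : Set (Euc n)} (hG : IsOpen G) {f : Euc n → ℝ}
    (hf : ContinuousOn f G) : MeasurableSet {x ∈ G | |f x| ≤ 1} := by
  have h1 : {x ∈ G | |f x| ≤ 1} = G \ (G ∩ (fun x => |f x|) ⁻¹' Ioi 1) := by
    ext x
    simp only [Set.mem_sdiff, mem_inter_iff, mem_preimage, mem_Ioi, mem_ofPred_eq]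
    constructor
    · rintro ⟨h1, h2⟩
      exact ⟨h1, fun h => absurd h.2 (not_lt.2 h2)⟩
    · rintro ⟨h1, h2⟩
      exact ⟨h1, not_lt.1 fun h => h2 ⟨h1, h⟩⟩
  rw [h1]
  exact hG.measurableSet.diff (hf.abs.isOpen_inter_preimage hG isOpen_Ioi).measurableSet

/-- A map with Jacobian at most one does not increase the volume. -/
lemma volume_le_of_surjOn {G Z : Set (Euc n)} (hG : IsOpen G) {T : Euc n → Euc n}
    (hT : ContDiffOn ℝ ∞ T G) (hZ : ∀ z ∈ Z, ∃ x ∈ G, T x = z ∧ |(fderiv ℝ T x).det| ≤ 1) :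
    volume Z ≤ volume G := by
  -- The Jacobian is controlled only at contact points. Restricting to `A` avoids needing a bound on
  -- all of `G`.
  set A := {x ∈ G | |(fderiv ℝ T x).det| ≤ 1} with hA
  have hAm : MeasurableSet A := measurableSet_inter_abs_le_one hG
    (ContinuousLinearMap.continuous_det.comp_continuousOn
      (hT.continuousOn_fderiv_of_isOpen hG (by simp)))
  calc volume Z ≤ volume (T '' A) := by
        refine measure_mono fun z hz => ?_
        obtain ⟨x, hx, hxz, hd⟩ := hZ z hz
        exact ⟨x, ⟨hx, hd⟩, hxz⟩
    _ ≤ ∫⁻ x in A, ENNReal.ofReal |(fderiv ℝ T x).det| :=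
        addHaar_image_le_lintegral_abs_det_fderiv volume hAm fun x hx =>
          ((hT.contDiffAt (hG.mem_nhds hx.1)).differentiableAt (by simp)).hasFDerivAt.hasFDerivWithinAt
    _ ≤ ∫⁻ _ in A, 1 := by
        refine setLIntegral_mono' hAm fun x hx => ?_
        rw [ENNReal.ofReal_le_one]
        exact hx.2
    _ = volume A := by simp
    _ ≤ volume G := measure_mono fun x hx => hx.1

/-- Bernoulli's inequality for `(1 - s/R)ⁿ`. -/
lemma volume_ball_sub_le {R s : ℝ} (hR : 0 < R) (hsR : s < R) :
    volume.real (Metric.ball (0 : Euc n) R) - volume.real (Metric.ball (0 : Euc n) (R - s))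
      ≤ n * (s / R) * volume.real (Metric.ball (0 : Euc n) R) := by
  have hball : ∀ t, 0 < t → volume.real (Metric.ball (0 : Euc n) t)
      = t ^ n * volume.real (Metric.ball (0 : Euc n) 1) := by
    intro t ht
    rw [measureReal_def, measureReal_def, Measure.addHaar_ball_of_pos _ _ ht, ENNReal.toReal_mul,
      ENNReal.toReal_ofReal (by positivity), finrank_euclideanSpace_fin]
  rw [hball R hR, hball (R - s) (by linarith)]
  have h1 : 1 + n * (-(s / R)) ≤ (1 + -(s / R)) ^ n := one_add_mul_le_pow (by
    have : s / R ≤ 1 := (div_le_one hR).2 hsR.le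
    linarith) n
  have h2 : R - s = R * (1 + -(s / R)) := by field_simp; ring
  rw [h2, mul_pow]
  have h3 : 0 ≤ R ^ n * volume.real (Metric.ball (0 : Euc n) 1) := by positivity
  nlinarith [mul_le_mul_of_nonneg_left h1 h3]

variable {H : Euc n → ℝ} {V : Euc n → Euc n} {k : Euc n → ℝ} {Y₀ : Euc n} {ρ r lo hi : ℝ}

/-- Differentiating `V(∇k(y)) = -y`: the Wulff shape has constant anisotropic mean curvature. -/
lemma IsLegendrePair.fderiv_comp (hL : IsLegendrePair H V k Y₀ ρ r lo hi) {y : Euc n}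
    (hy : y ∈ Metric.ball (0 : Euc n) r) :
    fderiv ℝ V (gradient k y) ∘L fderiv ℝ (gradient k) y = -ContinuousLinearMap.id ℝ (Euc n) := by
  have h1 : DifferentiableAt ℝ V (gradient k y) :=
    (hL.smooth_V.contDiffAt (Metric.isOpen_ball.mem_nhds (hL.grad_mem y hy))).differentiableAt
      (by simp)
  have h2 : DifferentiableAt ℝ (gradient k) y :=
    ((hL.smooth_k.gradient_of_isOpen Metric.isOpen_ball).contDiffAt
      (Metric.isOpen_ball.mem_nhds hy)).differentiableAt (by simp)
  have h3 : HasFDerivAt (fun y => V (gradient k y))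
      (fderiv ℝ V (gradient k y) ∘L fderiv ℝ (gradient k) y) y :=
    h1.hasFDerivAt.comp y h2.hasFDerivAt
  refine h3.unique ((hasFDerivAt_id y).neg.congr_of_eventuallyEq ?_)
  filter_upwards [Metric.isOpen_ball.mem_nhds hy] with x hx using hL.V_grad x hx

/-- The points over which the lowest sheet of `S` is a smooth graph of height less than `η` and
slope less than `s` and `ρ`. -/
def flatPart (S : Set (Euc (n + 1))) (η s ρ : ℝ) : Set (Euc n) :=
  {x | ∃ d > 0, Metric.ball x d ⊆ Metric.ball 0 (1 / 3) ∧
    ContDiffOn ℝ ∞ (lowestHeight S) (Metric.ball x d) ∧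
    ∀ y ∈ Metric.ball x d, (vpoint y (lowestHeight S y) ∈ S ∧
      ∀ t, vpoint y t ∈ S → lowestHeight S y ≤ t) ∧ lowestHeight S y < η ∧
      ‖gradient (lowestHeight S) y‖ < s ∧ ‖gradient (lowestHeight S) y‖ < ρ}

lemma isOpen_flatPart (S : Set (Euc (n + 1))) (η s ρ : ℝ) : IsOpen (flatPart S η s ρ) := by
  rw [Metric.isOpen_iff]
  rintro x ⟨d, hd, h1, h2, h3⟩
  refine ⟨d, hd, fun y hy => ?_⟩
  have hsub : Metric.ball y (d - dist y x) ⊆ Metric.ball x d :=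
    Metric.ball_subset_ball' (by linarith)
  exact ⟨d - dist y x, sub_pos.2 hy, hsub.trans h1, h2.mono hsub, fun v hv => h3 v (hsub hv)⟩

lemma contDiffOn_flatPart (S : Set (Euc (n + 1))) (η s ρ : ℝ) :
    ContDiffOn ℝ ∞ (lowestHeight S) (flatPart S η s ρ) := by
  rintro x ⟨d, hd, -, h2, -⟩
  exact (h2.contDiffAt (Metric.ball_mem_nhds x hd)).contDiffWithinAt

/-- Each small translate of the Wulff shape touches `S` over a point of the flat part, where the
Jacobian of the contact map is at most one. -/
lemma IsLegendrePair.exists_contact (hn : 1 ≤ n) (hL : IsLegendrePair H V k Y₀ ρ r lo hi)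
    {E : Set (Euc (n + 1))} (hE : IsCriticalAboveBottom E V ρ) {δ L : ℝ} (hδ : 0 < δ)
    (hL1 : 1 ≤ L) (hLlo : 1 + hi < lo * L ^ 2) (hLr : L * δ < r) (hL3 : L * δ < 1 / 3)
    (hδ1 : (1 + hi) * δ ^ 2 < 1) {z : Euc n} (hz : z ∈ Metric.ball (0 : Euc n) (1 / 3 - L * δ))
    {x₁ : Euc n} {t₁ : ℝ} (hx₁ : dist x₁ z ≤ δ) (ht₁ : t₁ < δ ^ 2)
    (h₁ : vpoint x₁ t₁ ∈ frontier E ∩ unitCylinder n) :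
    ∃ x ∈ flatPart (frontier E ∩ unitCylinder n) ((2 + hi) * δ ^ 2) ((hi * L + 1) * δ) ρ,
      x + V (gradient (lowestHeight (frontier E ∩ unitCylinder n)) x) = z ∧
      |(fderiv ℝ (fun y => y +
        V (gradient (lowestHeight (frontier E ∩ unitCylinder n)) y)) x).det| ≤ 1 := by
  have hlo := hL.lo_pos
  have hhi := hL.hi_pos
  have hδ2 : 0 < δ ^ 2 := by positivity
  set S := frontier E ∩ unitCylinder n with hS
  rw [mem_ball_zero_iff] at hz
  have hδL : δ ≤ L * δ := le_mul_of_one_le_left hδ.le hL1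
  have hDr : ∀ x ∈ Metric.closedBall z (L * δ), x - z ∈ Metric.ball (0 : Euc n) r := by
    intro x hx
    rw [mem_closedBall_iff_norm] at hx
    rw [mem_ball_zero_iff]
    linarith
  have hD1 : Metric.closedBall z (L * δ) ⊆ Metric.ball 0 1 := by
    intro x hx
    rw [mem_closedBall_iff_norm] at hx
    rw [mem_ball_zero_iff]
    have := norm_le_norm_add_norm_sub' x z
    linarith
  have hkneg : ∀ y ∈ Metric.ball (0 : Euc n) r, k y ≤ 0 := fun y hy => by
    have := hL.lo_k y hy
    have : 0 ≤ lo * ‖y‖ ^ 2 := by positivity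
    linarith
  have hx₁D : x₁ ∈ Metric.closedBall z (L * δ) := hx₁.trans hδL
  have hkx₁ : -k (x₁ - z) ≤ hi * δ ^ 2 := by
    refine (hL.hi_k _ (hDr _ hx₁D)).trans ?_
    rw [dist_eq_norm] at hx₁
    gcongr
  obtain ⟨x₀, hx₀D, t₀, hp, hmin⟩ := exists_lowest_contact hE.bottom
    (isCompact_closedBall z (L * δ)) hD1 (q := fun x => k (x - z))
    (hL.smooth_k.continuousOn.comp (by fun_prop) hDr) hx₁D h₁ hδ1 (fun x hx => by
      have := hkneg _ (hDr x hx)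
      linarith)
  have hle : t₀ - k (x₀ - z) < (1 + hi) * δ ^ 2 :=
    (hmin x₁ hx₁D t₁ h₁).trans_lt (by linarith)
  have ht₀ : 0 < t₀ := (vpoint_mem_solidCylinder.1 hp.2).2.1
  have hx₀ : ‖x₀ - z‖ ≤ L * δ := mem_closedBall_iff_norm.1 hx₀D
  have hx₀r := hDr x₀ hx₀D
  -- At the rim `-k ≥ lo L² δ²`, which exceeds the value `(1 + hi) δ²` already achieved by the low
  -- point, so contact is interior.
  have hx₀1 : ‖x₀ - z‖ < L * δ := by
    refine lt_of_le_of_ne hx₀ fun heq => ?_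
    have h1 := hL.lo_k _ hx₀r
    rw [heq] at h1
    have h2 := mul_lt_mul_of_pos_right hLlo hδ2
    have h3 : lo * L ^ 2 * δ ^ 2 = lo * (L * δ) ^ 2 := by ring
    linarith
  set q : Euc n → ℝ := fun x => k (-z + x) - (k (x₀ - z) - t₀) with hq
  have hqk : ∀ x, q x = k (x - z) - (k (x₀ - z) - t₀) := fun x => by
    simp only [hq]; rw [neg_add_eq_sub]
  have hgq : gradient q = fun x => gradient k (-z + x) := gradient_comp_add_left k (-z) _
  have hgqx : gradient q x₀ = gradient k (x₀ - z) := by rw [hgq]; simp only; rw [neg_add_eq_sub]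
  have hDq : fderiv ℝ (gradient q) x₀ = fderiv ℝ (gradient k) (x₀ - z) := by
    rw [hgq, fderiv_comp_add_left, neg_add_eq_sub]
  have hqx₀ : q x₀ = t₀ := by rw [hqk]; ring
  have hqs : ContDiffOn ℝ ∞ q (Metric.ball z (L * δ)) := by
    refine ContDiffOn.sub (hL.smooth_k.comp (contDiff_const.add contDiff_id).contDiffOn
      fun x hx => ?_) contDiffOn_const
    rw [neg_add_eq_sub]
    exact hDr x (Metric.ball_subset_closedBall hx)
  have hgρ : gradient q x₀ ∈ Metric.ball (0 : Euc n) ρ := by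
    rw [hgqx]; exact hL.grad_mem _ hx₀r
  obtain ⟨d, hd, -, hws, hw0, hgrad, hlow, hPs, hPp, htr⟩ := hE.exists_graph hL.smooth_V (q := q)
    (by rw [hqx₀]; exact hp) Metric.isOpen_ball (mem_ball_iff_norm.2 hx₀1) hqs hgρ
    (fun x hx t ht => by
      have := hmin x (Metric.ball_subset_closedBall hx) t ht
      rw [hqk]; linarith) rfl
  rw [← hS] at hws hw0 hgrad hlow hPs hPp htr
  set w := lowestHeight S with hw
  have hx₀d : x₀ ∈ Metric.ball x₀ d := Metric.mem_ball_self hd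
  have hgw := hws.gradient_of_isOpen Metric.isOpen_ball
  have hgwc : ContinuousAt (gradient w) x₀ :=
    hgw.continuousOn.continuousAt (Metric.isOpen_ball.mem_nhds hx₀d)
  have hgradk : gradient w x₀ = gradient k (x₀ - z) := hgrad.trans hgqx
  have hVw : V (gradient w x₀) = -(x₀ - z) := by rw [hgradk]; exact hL.V_grad _ hx₀r
  refine ⟨x₀, ?_, by rw [hVw]; abel, ?_⟩
  · have hev : ∀ᶠ x in 𝓝 x₀, x ∈ Metric.ball x₀ d ∧ x ∈ Metric.ball (0 : Euc n) (1 / 3) ∧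
        w x < (2 + hi) * δ ^ 2 ∧ ‖gradient w x‖ < (hi * L + 1) * δ ∧ ‖gradient w x‖ < ρ := by
      refine (Metric.isOpen_ball.eventually_mem hx₀d).and ((Metric.isOpen_ball.eventually_mem
        ?_).and (((hws.continuousOn.continuousAt (Metric.isOpen_ball.mem_nhds hx₀d)).eventually
          (gt_mem_nhds ?_)).and ((hgwc.norm.eventually (gt_mem_nhds ?_)).and
            (hgwc.norm.eventually (gt_mem_nhds ?_)))))
      · rw [mem_ball_zero_iff]
        have := norm_le_norm_add_norm_sub' x₀ z
        linarith
      · rw [hw0, hqx₀]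
        have := hkneg _ hx₀r
        linarith
      · simp only [hgradk]
        refine (hL.norm_grad_k _ hx₀r).trans_lt ?_
        calc hi * ‖x₀ - z‖ ≤ hi * (L * δ) := by gcongr
          _ < (hi * L + 1) * δ := by linarith
      · simp only [hgrad]; exact mem_ball_zero_iff.1 hgρ
    obtain ⟨d', hd', hball⟩ := Metric.eventually_nhds_iff_ball.1 hev
    exact ⟨d', hd', fun x hx => (hball x hx).2.1, hws.mono fun x hx => (hball x hx).1,
      fun x hx => ⟨hlow x (hball x hx).1, (hball x hx).2.2⟩⟩
  · have hVd : DifferentiableAt ℝ V (gradient w x₀) := by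
      rw [hgrad]
      exact (hL.smooth_V.contDiffAt (Metric.isOpen_ball.mem_nhds hgρ)).differentiableAt (by simp)
    have hDw : DifferentiableAt ℝ (gradient w) x₀ :=
      (hgw.contDiffAt (Metric.isOpen_ball.mem_nhds hx₀d)).differentiableAt (by simp)
    have hT : HasFDerivAt (fun y => y + V (gradient w y)) (ContinuousLinearMap.id ℝ (Euc n) +
        fderiv ℝ V (gradient w x₀) ∘L fderiv ℝ (gradient w) x₀) x₀ :=
      (hasFDerivAt_id x₀).add (hVd.hasFDerivAt.comp x₀ hDw.hasFDerivAt)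
    -- Since `DV D²k = -I`, the differential of the contact map is `DV` composed with the
    -- nonnegative difference of Hessians.
    have hprod : fderiv ℝ V (gradient w x₀) ∘L
        (fderiv ℝ (gradient w) x₀ - fderiv ℝ (gradient q) x₀)
        = ContinuousLinearMap.id ℝ (Euc n) +
          fderiv ℝ V (gradient w x₀) ∘L fderiv ℝ (gradient w) x₀ := by
      rw [ContinuousLinearMap.comp_sub, hDq]
      nth_rewrite 2 [hgradk]
      rw [hL.fderiv_comp hx₀r]
      abel
    rw [hT.fderiv, ← hprod]
    have hgwρ : gradient w x₀ ∈ Metric.ball (0 : Euc n) ρ := by rw [hgrad]; exact hgρ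
    refine abs_det_comp_le_one hn (hL.symm_V _ hgwρ)
      (fun ξ => (by positivity : (0:ℝ) ≤ lo * ‖ξ‖ ^ 2).trans (hL.lo_V _ hgwρ ξ)) hPs hPp ?_
    rw [hprod, ContinuousLinearMap.toLinearMap_add, map_add, htr, add_zero]
    have : (ContinuousLinearMap.id ℝ (Euc n)).toLinearMap = LinearMap.id := rfl
    rw [this, LinearMap.trace_id, finrank_euclideanSpace_fin]

/-- A critical hypersurface close to the bottom at the origin is, up to a small set, a flat graph
close to the bottom. -/
lemma IsLegendrePair.exists_flat_sheet (hn : 1 ≤ n) (hL : IsLegendrePair H V k Y₀ ρ r lo hi) :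
    ∃ C₁ : ℝ, 0 < C₁ ∧ ∃ δ₀ : ℝ, 0 < δ₀ ∧ ∀ δ : ℝ, 0 < δ → δ < δ₀ → ∃ ε₀ : ℝ, 0 < ε₀ ∧
      ∀ E : Set (Euc (n + 1)), IsCriticalAboveBottom E V ρ → ∀ ε : ℝ,
        vpoint (0 : Euc n) ε ∈ frontier E ∩ unitCylinder n → ε < ε₀ →
        ∃ (G : Set (Euc n)) (w : Euc n → ℝ),
          IsOpen G ∧ G ⊆ Metric.ball (0 : Euc n) (1 / 3) ∧ ContDiffOn ℝ ∞ w G ∧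
          volume.real (Metric.ball (0 : Euc n) (1 / 3)) - C₁ * δ ^ (1 / 2 : ℝ) ≤ volume.real G ∧
          ∀ x ∈ G, vpoint x (w x) ∈ frontier E ∩ unitCylinder n ∧
            (∀ t : ℝ, vpoint x t ∈ frontier E ∩ unitCylinder n → w x ≤ t) ∧
            0 < w x ∧ w x < C₁ * δ ^ (3 / 2 : ℝ) ∧ ‖gradient w x‖ < C₁ * δ ^ (1 / 2 : ℝ) := by
  have hlo := hL.lo_pos
  have hhi := hL.hi_pos
  -- Any `L` with `lo L² > 1 + hi` confines the contact to radius `Lδ`.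
  set L : ℝ := 1 + (1 + hi) / lo with hLdef
  have hLpos : 0 < (1 + hi) / lo := by positivity
  have hL1 : 1 ≤ L := by linarith
  have hLlo : 1 + hi < lo * L ^ 2 := by
    have h1 : lo * ((1 + hi) / lo) = 1 + hi := by field_simp
    have h2 : lo * L ^ 2 = lo + 2 * (lo * ((1 + hi) / lo)) + lo * ((1 + hi) / lo) ^ 2 := by
      rw [hLdef]; ring
    have h3 : 0 < lo * ((1 + hi) / lo) ^ 2 := by positivity
    rw [h2, h1]; linarith
  set vol := volume.real (Metric.ball (0 : Euc n) (1 / 3)) with hvol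
  have hvol0 : 0 ≤ vol := measureReal_nonneg
  set C₁ : ℝ := (hi * L + 1) + (2 + hi) + n * (L * 3) * vol with hC₁
  have hL0 : 0 < L := by linarith
  have hterm : 0 ≤ n * (L * 3) * vol := by positivity
  have hterm2 : 0 < hi * L := by positivity
  refine ⟨C₁, by linarith, min (min 1 (1 / (1 + hi))) (min (r / L) (1 / (3 * L))),
    lt_min (lt_min one_pos (by positivity)) (lt_min (div_pos hL.r_pos hL0) (by positivity)),
    fun δ hδ hδ₀ => ?_⟩
  simp only [lt_min_iff] at hδ₀
  obtain ⟨⟨hδ1, hδhi⟩, hδr, hδ3⟩ := hδ₀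
  rw [lt_div_iff₀ (by positivity)] at hδhi hδr hδ3
  have hLr : L * δ < r := by linarith
  have hL3 : L * δ < 1 / 3 := by linarith
  have hsq : (1 + hi) * δ ^ 2 < 1 := by nlinarith
  obtain ⟨ε₀, hε₀, hlowpt⟩ := hL.exists_low_point hδ (pow_pos hδ 2 : 0 < δ ^ 2)
  -- The construction yields height `O(δ²)`, slope `O(δ)` and volume loss `O(δ)`. As `δ < 1`, these
  -- imply the stated powers.
  have hpow1 : δ ≤ δ ^ (1 / 2 : ℝ) := by
    have := Real.rpow_le_rpow_of_exponent_ge hδ hδ1.le (by norm_num : (1 / 2 : ℝ) ≤ 1)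
    rwa [Real.rpow_one] at this
  have hpow2 : δ ^ 2 ≤ δ ^ (3 / 2 : ℝ) := by
    have := Real.rpow_le_rpow_of_exponent_ge hδ hδ1.le (by norm_num : (3 / 2 : ℝ) ≤ 2)
    rwa [Real.rpow_two] at this
  have hpow0 : 0 < δ ^ (1 / 2 : ℝ) := Real.rpow_pos_of_pos hδ _
  have hpow0' : 0 < δ ^ (3 / 2 : ℝ) := Real.rpow_pos_of_pos hδ _
  refine ⟨ε₀, hε₀, fun E hE ε h0 hε => ?_⟩
  set S := frontier E ∩ unitCylinder n with hS
  set G := flatPart S ((2 + hi) * δ ^ 2) ((hi * L + 1) * δ) ρ with hG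
  have hGo : IsOpen G := isOpen_flatPart _ _ _ _
  have hGw : ContDiffOn ℝ ∞ (lowestHeight S) G := contDiffOn_flatPart _ _ _ _
  have hGball : G ⊆ Metric.ball (0 : Euc n) (1 / 3) := by
    rintro x ⟨d, hd, hsub, -⟩
    exact hsub (Metric.mem_ball_self hd)
  have hGprop : ∀ x ∈ G, (vpoint x (lowestHeight S x) ∈ S ∧
      ∀ t, vpoint x t ∈ S → lowestHeight S x ≤ t) ∧ lowestHeight S x < (2 + hi) * δ ^ 2 ∧
      ‖gradient (lowestHeight S) x‖ < (hi * L + 1) * δ ∧ ‖gradient (lowestHeight S) x‖ < ρ := by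
    rintro x ⟨d, hd, -, -, hx⟩
    exact hx x (Metric.mem_ball_self hd)
  refine ⟨G, lowestHeight S, hGo, hGball, hGw, ?_, fun x hx => ?_⟩
  · have hT : ContDiffOn ℝ ∞ (fun y => y + V (gradient (lowestHeight S) y)) G :=
      contDiffOn_id.add (hL.smooth_V.comp (hGw.gradient_of_isOpen hGo)
        fun x hx => mem_ball_zero_iff.2 (hGprop x hx).2.2.2)
    have hle : volume (Metric.ball (0 : Euc n) (1 / 3 - L * δ)) ≤ volume G :=
      volume_le_of_surjOn hGo hT fun z hz => by
        obtain ⟨x₁, t₁, hx₁, ht₁, h₁⟩ := hlowpt E hE ε hε h0 z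
          (Metric.ball_subset_ball (by linarith [mul_pos hL0 hδ]) hz)
        exact hL.exists_contact hn hE hδ hL1 hLlo hLr hL3 hsq hz hx₁ ht₁ h₁
    have hfin : volume G ≠ ⊤ := ((measure_mono hGball).trans_lt measure_ball_lt_top).ne
    have hle' : volume.real (Metric.ball (0 : Euc n) (1 / 3 - L * δ)) ≤ volume.real G :=
      ENNReal.toReal_mono hfin hle
    have h1 := volume_ball_sub_le (n := n) (R := 1 / 3) (s := L * δ) (by norm_num)
      hL3
    rw [← hvol] at h1
    have h2 : n * (L * δ / (1 / 3)) * vol = n * (L * 3) * vol * δ := by ring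
    have h3 : n * (L * 3) * vol * δ ≤ C₁ * δ ^ (1 / 2 : ℝ) := by
      gcongr
      linarith
    linarith
  · obtain ⟨⟨h1, h2⟩, h3, h4, -⟩ := hGprop x hx
    refine ⟨h1, h2, (vpoint_mem_solidCylinder.1 h1.2).2.1, h3.trans_le ?_, h4.trans_le ?_⟩
    · gcongr
      linarith
    · gcongr
      linarith

end ContactSet

/-! ### Assembly: choice of the side of `S` and of its orientation. -/

section Main

variable {n : ℕ}

/-- A hypersurface critical for the outer normal of `E` or of its complement. -/
lemma isCriticalAboveBottom_of_isOuterCritical (hn : 1 ≤ n) {K E A : Set (Euc (n + 1))} {σ : ℝ}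
    {V : Euc n → Euc n} {k : Euc n → ℝ} {Y₀ : Euc n} {ρ r lo hi : ℝ}
    (hL : IsLegendrePair (fun p => supportFn K (σ • vpoint (-p) 1)) V k Y₀ ρ r lo hi)
    (hE : HasSmoothBoundaryIn E (unitCylinder n))
    (hbot : ∀ x ∈ Metric.ball (0 : Euc n) 1, vpoint x 0 ∉ closure (frontier E ∩ unitCylinder n))
    (hlow : BottomIn E) (hA : (σ = 1 ∧ A = E) ∨ (σ = -1 ∧ A = Eᶜ))
    (hcrit : IsOuterCritical (supportFn K) A (unitCylinder n)) : IsCriticalAboveBottom E V ρ :=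
  ⟨hE, hbot, hlow, fun _ _ _ _ hsg hgr => hsg.trace_eq_zero hn hA hcrit hL hgr⟩

end Main

theorem lemma2p1 (n : ℕ) (hn : 1 ≤ n) (K : Set (Euc (n + 1))) (hK : IsWulffShape K) :
    ∃ C₁ : ℝ, 0 < C₁ ∧ ∃ δ₀ : ℝ, 0 < δ₀ ∧ ∀ δ : ℝ, 0 < δ → δ < δ₀ →
      ∃ ε₀ : ℝ, 0 < ε₀ ∧
        ∀ (E S : Set (Euc (n + 1))), E ⊆ solidCylinder (0 : Euc n) 1 0 1 →
          S = frontier E ∩ solidCylinder (0 : Euc n) 1 0 1 →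
          (∀ x ∈ Metric.ball (0 : Euc n) 1, vpoint x 0 ∉ closure S) →
          HasSmoothBoundaryIn E (solidCylinder (0 : Euc n) 1 0 1) →
          IsCriticalBoundary (supportFn K) E (solidCylinder (0 : Euc n) 1 0 1) →
          ∀ ε : ℝ, vpoint (0 : Euc n) ε ∈ S → ε < ε₀ →
            ∃ (G : Set (Euc n)) (w : Euc n → ℝ),
              IsOpen G ∧ G ⊆ Metric.ball (0 : Euc n) (1 / 3) ∧ ContDiffOn ℝ ∞ w G ∧
              volume.real G ≥
                volume.real (Metric.ball (0 : Euc n) (1 / 3)) - C₁ * δ ^ (1 / 2 : ℝ) ∧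
              ∀ x ∈ G,
                vpoint x (w x) ∈ S ∧ (∀ t : ℝ, vpoint x t ∈ S → w x ≤ t) ∧
                0 < w x ∧ w x < C₁ * δ ^ (3 / 2 : ℝ) ∧
                ‖gradient w x‖ < C₁ * δ ^ (1 / 2 : ℝ) := by
  obtain ⟨V, k, Y₀, ρ, r, lo, hi, hL⟩ := hK.exists_legendre
  obtain ⟨V', k', Y₀', ρ', r', lo', hi', hL'⟩ := hK.preimage_neg.exists_legendre
  have hL₁ : IsLegendrePair (fun p => supportFn K ((1 : ℝ) • vpoint (-p) 1)) V k Y₀ ρ r lo hi := by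
    simpa only [one_smul] using hL
  have hL₂ : IsLegendrePair (fun p => supportFn K ((-1 : ℝ) • vpoint (-p) 1)) V' k' Y₀' ρ' r'
      lo' hi' := by
    simpa only [neg_smul, one_smul, supportFn_preimage_neg] using hL'
  obtain ⟨C, hC, δ₀, hδ₀, hmain⟩ := hL₁.exists_flat_sheet hn
  obtain ⟨C', hC', δ₀', hδ₀', hmain'⟩ := hL₂.exists_flat_sheet hn
  -- The constants must not depend on the orientation of `S`, so those of `K` and `-K` are combined.
  refine ⟨max C C', lt_max_of_lt_left hC, min δ₀ δ₀', lt_min hδ₀ hδ₀', fun δ hδ hδlt => ?_⟩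
  rw [lt_min_iff] at hδlt
  obtain ⟨ε₀, hε₀, hres⟩ := hmain δ hδ hδlt.1
  obtain ⟨ε₀', hε₀', hres'⟩ := hmain' δ hδ hδlt.2
  have hpow0 : 0 < δ ^ (1 / 2 : ℝ) := Real.rpow_pos_of_pos hδ _
  have hpow0' : 0 < δ ^ (3 / 2 : ℝ) := Real.rpow_pos_of_pos hδ _
  refine ⟨min ε₀ ε₀', lt_min hε₀ hε₀', fun E S _ hS hbot hE hcrit ε h0 hε => ?_⟩
  rw [lt_min_iff] at hε
  subst hS
  -- Passing to the complement keeps the boundary and only swaps the two alternatives for the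
  -- orientation.
  obtain ⟨E', hfr, hE', hlow, hcrit'⟩ : ∃ E' : Set (Euc (n + 1)), frontier E' = frontier E ∧
      HasSmoothBoundaryIn E' (unitCylinder n) ∧ BottomIn E' ∧
      (IsOuterCritical (supportFn K) E' (unitCylinder n) ∨
        IsOuterCritical (supportFn K) E'ᶜ (unitCylinder n)) := by
    rcases bottomIn_or_bottomIn_compl hbot with h | h
    · exact ⟨E, rfl, hE, h, hcrit⟩
    · exact ⟨Eᶜ, frontier_compl E, hE.compl, h, by rw [compl_compl]; exact hcrit.symm⟩
  rw [← hfr] at hbot h0 ⊢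
  rcases hcrit' with hc | hc
  · obtain ⟨G, w, hGo, hGs, hw, hvol, hG⟩ := hres E' (isCriticalAboveBottom_of_isOuterCritical hn
      hL₁ hE' hbot hlow (Or.inl ⟨rfl, rfl⟩) hc) ε h0 hε.1
    refine ⟨G, w, hGo, hGs, hw, le_trans ?_ hvol, fun x hx => ?_⟩
    · gcongr
      exact le_max_left _ _
    · obtain ⟨h1, h2, h3, h4, h5⟩ := hG x hx
      exact ⟨h1, h2, h3, h4.trans_le (by gcongr; exact le_max_left _ _),
        h5.trans_le (by gcongr; exact le_max_left _ _)⟩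
  · obtain ⟨G, w, hGo, hGs, hw, hvol, hG⟩ := hres' E' (isCriticalAboveBottom_of_isOuterCritical hn
      hL₂ hE' hbot hlow (Or.inr ⟨rfl, rfl⟩) hc) ε h0 hε.2
    refine ⟨G, w, hGo, hGs, hw, le_trans ?_ hvol, fun x hx => ?_⟩
    · gcongr
      exact le_max_right _ _
    · obtain ⟨h1, h2, h3, h4, h5⟩ := hG x hx
      exact ⟨h1, h2, h3, h4.trans_le (by gcongr; exact le_max_right _ _),
        h5.trans_le (by gcongr; exact le_max_right _ _)⟩
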